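/- An instance of the Hospital Residents problem with lower and upper quotas (HR-$\mathrm{Q}_\mathrm{L}^\mathrm{U}$) consists of $n$ residents and $m$ hospitals, each of which has a strict preference list over the agents of the other side that it accepts, where acceptability is symmetric, and of quotas $1\le l(h)\le u(h)$ for each hospital $h$. A matching $M$ assigns each resident to at most one hospital such that assigned agents accept each other; $M(h)$ denotes the set of residents assigned to $h$, and $h$ is open if $M(h)\neq\emptyset$ and closed otherwise. Each resident prefers every acceptable hospital to being unmatched. $M$ is feasible if $l(h)\le |M(h)|\le u(h)$ for every open hospital $h$. A feasible matching is stable if (i) there is no resident $r$ and open hospital $h$ that accept each other such that $r$ prefers $h$ to her assignment in $M$, and $|M(h)|<u(h)$ or $h$ prefers $r$ to some resident in $M(h)$; and (ii) there is no closed hospital $h$ and set of $l(h)$ residents each of whom prefers $h$ to her assignment in $M$. HR-$\mathrm{Q}_\mathrm{L}$ is the special case in which $u(h)=n+1$ for all hospitals $h$. Theorem. There is an algorithm that, given an instance of HR-$\mathrm{Q}_\mathrm{L}^\mathrm{U}$ in which every hospital has lower quota at most two, finds a stable matching or correctly reports that none exists, in $\mathcal{O}(n^3m)$ time for $n,m\ge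 1$ (and in constant time if $n=0$ or $m=0$), on a random access machine that stores only numbers with $\mathcal{O}(\log(n+m+2))$ bits. In particular, the same holds for HR-$\mathrm{Q}_\mathrm{L}$ if every hospital has lower quota at most two. -/

import Mathlib

namespace HRQ

/-! ### Instances and stable matchings -/

/-- An instance of the Hospital Residents problem with lower and upper quotas, with residents
`Fin n` and hospitals `Fin m`. Every agent has a preference list, which ranks the agents it
accepts strictly, the best one first; acceptability is symmetric. -/
structure Instance (n m : ℕ) where
  /-- the preference list of each resident -/
  resPref : Fin n → List (Fin m)
  /-- the preference list of each hospital -/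
  hosPref : Fin m → List (Fin n)
  /-- the lower quota of each hospital -/
  lower : Fin m → ℕ
  /-- the upper quota of each hospital -/
  upper : Fin m → ℕ
  resPref_nodup : ∀ r, (resPref r).Nodup
  hosPref_nodup : ∀ h, (hosPref h).Nodup
  mem_iff : ∀ r h, h ∈ resPref r ↔ r ∈ hosPref h
  one_le_lower : ∀ h, 1 ≤ lower h
  lower_le_upper : ∀ h, lower h ≤ upper h

/-- `a` stands above `b` on the preference list `l` (both are on it). -/
def Above {α : Type*} [DecidableEq α] (l : List α) (a b : α) : Prop :=
  a ∈ l ∧ b ∈ l ∧ l.idxOf a < l.idxOf b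

/-- An assignment of every resident to at most one hospital (`none`: unmatched). -/
abbrev Assignment (n m : ℕ) : Type := Fin n → Option (Fin m)

/-- The set `M(h)` of residents that are matched to `h`. -/
def Assignment.at {n m : ℕ} (M : Assignment n m) (h : Fin m) : Finset (Fin n) :=
  Finset.univ.filter (fun r => M r = some h)

namespace Instance

variable {n m : ℕ} (I : Instance n m) (M : Assignment n m)

/-- `M` is a matching: matched agents accept each other. -/
def IsMatching : Prop := ∀ r h, M r = some h → h ∈ I.resPref r

/-- Every hospital is closed or respects its two quotas. -/
def IsFeasible : Prop :=
  ∀ h, (M.at h).card = 0 ∨ (I.lower h ≤ (M.at h).card ∧ (M.at h).card ≤ I.upper h)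

/-- Resident `r` prefers hospital `h` to `M(r)`; being unmatched is worse than every
acceptable hospital. -/
def ResPrefers (r : Fin n) (h : Fin m) : Prop :=
  h ∈ I.resPref r ∧ (M r = none ∨ ∃ h', M r = some h' ∧ Above (I.resPref r) h h')

/-- `(r, h)` is a blocking pair. -/
def IsBlockingPair (r : Fin n) (h : Fin m) : Prop :=
  (M.at h).card ≠ 0 ∧ I.ResPrefers M r h ∧
    ((M.at h).card < I.upper h ∨ ∃ r' ∈ M.at h, Above (I.hosPref h) r r')

/-- `(h, S)` is a blocking coalition. -/
def IsBlockingCoalition (h : Fin m) (S : Finset (Fin n)) : Prop :=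
  (M.at h).card = 0 ∧ S.card = I.lower h ∧ ∀ r ∈ S, I.ResPrefers M r h

/-- `M` is a stable matching. -/
def IsStable : Prop :=
  I.IsMatching M ∧ I.IsFeasible M ∧
    (∀ r h, ¬ I.IsBlockingPair M r h) ∧ ∀ h S, ¬ I.IsBlockingCoalition M h S

end Instance

/-! ### Random access machines

The memory consists of arrays of natural numbers. A program mentions only finitely many arrays, by
fixed numbers, so that this is the memory of a random access machine up to interleaving. Programs
have the usual control structures. Every operation, memory access, assignment and test
takes one step. -/

/-- The memory: `s a i` is the content of cell `i` of array `a`. -/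
abbrev Memory : Type := ℕ → ℕ → ℕ

/-- Expressions over the memory. -/
inductive Expr : Type
  /-- a constant -/
  | const (k : ℕ) : Expr
  /-- the content of a cell of array `a`, the index being computed -/
  | get (a : ℕ) (i : Expr) : Expr
  /-- sum -/
  | add (e₁ e₂ : Expr) : Expr
  /-- truncated difference -/
  | sub (e₁ e₂ : Expr) : Expr
  /-- product -/
  | mul (e₁ e₂ : Expr) : Expr
  /-- comparison, with value `1` or `0` -/
  | lt (e₁ e₂ : Expr) : Expr
  /-- equality test, with value `1` or `0` -/
  | eq (e₁ e₂ : Expr) : Expr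

namespace Expr

/-- The value of an expression. -/
def eval (s : Memory) : Expr → ℕ
  | const k => k
  | get a i => s a (i.eval s)
  | add e₁ e₂ => e₁.eval s + e₂.eval s
  | sub e₁ e₂ => e₁.eval s - e₂.eval s
  | mul e₁ e₂ => e₁.eval s * e₂.eval s
  | lt e₁ e₂ => if e₁.eval s < e₂.eval s then 1 else 0
  | eq e₁ e₂ => if e₁.eval s = e₂.eval s then 1 else 0

/-- The number of steps it takes to evaluate an expression. -/
def cost : Expr → ℕ
  | const _ => 1
  | get _ i => i.cost + 1
  | add e₁ e₂ => e₁.cost + e₂.cost + 1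
  | sub e₁ e₂ => e₁.cost + e₂.cost + 1
  | mul e₁ e₂ => e₁.cost + e₂.cost + 1
  | lt e₁ e₂ => e₁.cost + e₂.cost + 1
  | eq e₁ e₂ => e₁.cost + e₂.cost + 1

end Expr

/-- Programs. -/
inductive Prog : Type
  /-- do nothing -/
  | skip : Prog
  /-- store the value of `e` in cell `i` of array `a`, the index being computed -/
  | store (a : ℕ) (i e : Expr) : Prog
  /-- run `p`, then `q` -/
  | seq (p q : Prog) : Prog
  /-- run `p` if the value of `b` is not `0`, and `q` otherwise -/
  | ite (b : Expr) (p q : Prog) : Prog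
  /-- repeat `p` as long as the value of `b` is not `0` -/
  | loop (b : Expr) (p : Prog) : Prog

/-- `Exec W p s t s'`: started on memory `s`, program `p` halts after exactly `t` steps with memory
`s'`, and on the way it stores only numbers at most `W`, in cells with index at most `W`. -/
inductive Exec (W : ℕ) : Prog → Memory → ℕ → Memory → Prop
  | skip (s : Memory) : Exec W Prog.skip s 1 s
  | store (a : ℕ) (i e : Expr) (s : Memory) (hi : i.eval s ≤ W) (he : e.eval s ≤ W) :
      Exec W (Prog.store a i e) s (i.cost + e.cost + 1)
        (Function.update s a (Function.update (s a) (i.eval s) (e.eval s)))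
  | seq (p q : Prog) (s s' s'' : Memory) (t t' : ℕ)
      (hp : Exec W p s t s') (hq : Exec W q s' t' s'') :
      Exec W (Prog.seq p q) s (t + t') s''
  | ite_true (b : Expr) (p q : Prog) (s s' : Memory) (t : ℕ)
      (hb : b.eval s ≠ 0) (hp : Exec W p s t s') :
      Exec W (Prog.ite b p q) s (b.cost + 1 + t) s'
  | ite_false (b : Expr) (p q : Prog) (s s' : Memory) (t : ℕ)
      (hb : b.eval s = 0) (hq : Exec W q s t s') :
      Exec W (Prog.ite b p q) s (b.cost + 1 + t) s'
  | loop_true (b : Expr) (p : Prog) (s s' s'' : Memory) (t t' : ℕ)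
      (hb : b.eval s ≠ 0) (hp : Exec W p s t s') (hl : Exec W (Prog.loop b p) s' t' s'') :
      Exec W (Prog.loop b p) s (b.cost + 1 + t + t') s''
  | loop_false (b : Expr) (p : Prog) (s : Memory) (hb : b.eval s = 0) :
      Exec W (Prog.loop b p) s (b.cost + 1) s

/-! ### Input, output and solvability within a time bound -/

/-- The memory that holds the instance, and `0` in all cells not mentioned:
array `0` holds `n` and `m`, arrays `1` and `2` the lower and upper quotas, array `3` the lengths of
the residents' preference lists and array `4` these lists (entry `k` of the list of `r` in cell
`r * m + k`), array `5` the lengths of the hospitals' preference lists and array `6` these lists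
(entry `k` of the list of `h` in cell `h * n + k`). -/
def Instance.encode {n m : ℕ} (I : Instance n m) : Memory := fun a i =>
  match a with
  | 0 => if i = 0 then n else if i = 1 then m else 0
  | 1 => if h : i < m then I.lower ⟨i, h⟩ else 0
  | 2 => if h : i < m then I.upper ⟨i, h⟩ else 0
  | 3 => if h : i < n then (I.resPref ⟨i, h⟩).length else 0
  | 4 => if h : i / m < n then
      (match (I.resPref ⟨i / m, h⟩)[i % m]? with
        | some x => (x : ℕ)
        | none => 0)
      else 0
  | 5 => if h : i < m then (I.hosPref ⟨i, h⟩).length else 0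
  | 6 => if h : i / n < m then
      (match (I.hosPref ⟨i / n, h⟩)[i % n]? with
        | some x => (x : ℕ)
        | none => 0)
      else 0
  | _ => 0

/-- The code of the partner of a resident: `0` for being unmatched, `h + 1` for hospital `h`. -/
def code {m : ℕ} : Option (Fin m) → ℕ
  | none => 0
  | some h => (h : ℕ) + 1

/-- The output in memory `s` is correct: either cell `0` of array `7` says `1` and array `8` holds a
stable matching, or cell `0` of array `7` says `0` and there is no stable matching. -/
def Instance.CorrectOutput {n m : ℕ} (I : Instance n m) (s : Memory) : Prop :=
  (s 7 0 = 1 ∧ ∃ M : Assignment n m, I.IsStable M ∧ ∀ r : Fin n, s 8 r = code (M r)) ∨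
  (s 7 0 = 0 ∧ ¬ ∃ M : Assignment n m, I.IsStable M)

/-- On the instances in the class `P`, a stable matching can be found, or its absence be reported,
in time `O(T n m)`: a single program does so on each of these instances within `C * T n m` steps.
The numbers that it stores, and the addresses where it stores them, are polynomially bounded in
`n + m`, that is, they have `O(log (n + m))` bits. -/
def SolvableInTime (P : ∀ n m : ℕ, Instance n m → Prop) (T : ℕ → ℕ → ℕ) : Prop :=
  ∃ (p : Prog) (C k : ℕ), ∀ (n m : ℕ) (I : Instance n m), P n m I →
    ∃ (t : ℕ) (s : Memory),
      Exec ((n + m + 2) ^ k) p I.encode t s ∧ t ≤ C * T n m ∧ I.CorrectOutput s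

/-- All hospitals have lower quota at most two. -/
def LowerQuotaAtMostTwo (n m : ℕ) (I : Instance n m) : Prop := ∀ h, I.lower h ≤ 2

/-- The instance only has lower quotas: every upper quota is `n + 1`, so that no hospital
can be full. -/
def OnlyLowerQuotas (n m : ℕ) (I : Instance n m) : Prop := ∀ h, I.upper h = n + 1

end HRQ

/-! A matching is encoded by the vector q of positions of the residents' hospitals on their lists,
with one past the end for being unmatched. Say that r reaches h if r is at h or prefers h to its
assignment. Stability is then a local rule (`StablePos`, with `toPos_stable` and `ofPos_stable`):
every hospital takes the u(h) best among the residents that reach it (all of them if there are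
fewer), or nobody if fewer than l(h) reach it.

The set of residents reaching h grows with q. Bounds t ≤ q ≤ b therefore make some rejections and
some acceptances certain, and these raise t or lower b without losing a stable matching inside the
bounds (`refines_raise`, `refines_lower`). If the process ends with t r > b r for some r, no stable
matching lies within the initial bounds; otherwise it ends with a stable table.

The heart is `IsStableTable.clamp`: if all lower quotas are at most two, the componentwise median of
t, q and b is stable for every stable q. So if a stable matching exists at all, one exists inside
every stable table, and committing to any stable table is safe. The proof is a double count. At each
hospital, at least as many residents have it as last remaining choice as have it as first
(`StableAt.card_le`), and since t ≤ b the totals force equality. Then an exchange inequality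
compares q with both ends of the table at each hospital (`StableAt.card_exchange`). Summed over all
hospitals, its left side counts all residents with t < q and all with q < b, while its right side
counts at most these, so equality holds everywhere. The equality case says that the median obeys the
local rule (`StableAt.mem_median`).

In a stable table t itself is stable unless some hospital h is half-open: it needs two residents, is
the first choice left to some r, and nobody else surely reaches it (`IsStableTable.stablePos`). A
stable matching inside the table either keeps r at h, or leaves h closed with everybody else above h
(`StablePos.lt_of_halfOpen`). Closing h is tried first and opening it second. If one of them leads
to a consistent table, `clamp` allows the search to continue from there and never to return; if both
fail, there is no stable matching (`IsStableTable.not_exists`).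

For the time bound, each unit change of a bound puts one hospital on a stack, and rescanning a
hospital costs O(n). There are O(nm) changes along a run without failures, hence O(n²m) time. A
failed closing wastes that much, but the opening after it fixes the position of r, which happens at
most n times. Searching for a half-open hospital costs O(n²) per round, and each round uses up a
change or fixes a resident. The sum is O(n³m). The accounting uses credits (`Runs`). The input
quotas are only compared and never stored, so large quotas do not affect the word length. -/

namespace HRQ

/-! ### The best elements of a finite set -/

section Top

variable {α : Type*} {ρ : α → ℕ} {u : ℕ} {P Q S : Finset α} {x y : α}

/-- The elements of `P` of smaller rank than `x`. -/
def better (ρ : α → ℕ) (P : Finset α) (x : α) : Finset α := P.filter (fun y => ρ y < ρ x)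

/-- The `u` elements of `P` of smallest rank. -/
def top (ρ : α → ℕ) (u : ℕ) (P : Finset α) : Finset α := P.filter (fun x => (better ρ P x).card < u)

theorem mem_better : y ∈ better ρ P x ↔ y ∈ P ∧ ρ y < ρ x := by simp [better]

theorem mem_top : x ∈ top ρ u P ↔ x ∈ P ∧ (better ρ P x).card < u := by simp [top]

theorem top_subset : top ρ u P ⊆ P := Finset.filter_subset _ _

theorem better_mono (h : P ⊆ Q) : better ρ P x ⊆ better ρ Q x := Finset.filter_subset_filter _ h

theorem card_better_lt (hx : x ∈ P) (h : ρ x < ρ y) :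
    (better ρ P x).card < (better ρ P y).card := by
  apply Finset.card_lt_card
  rw [Finset.ssubset_iff_of_subset]
  · exact ⟨x, by simp [mem_better, hx, h], by simp [mem_better]⟩
  · intro z hz
    rw [mem_better] at *
    exact ⟨hz.1, hz.2.trans h⟩

/-- Counting the better elements numbers P bijectively by 0, ..., |P| - 1, and `top` consists of the
elements with numbers below u. -/
theorem card_top (hρ : Function.Injective ρ) : (top ρ u P).card = min u P.card := by
  classical
  have hinj : Set.InjOn (fun x => (better ρ P x).card) P := by
    intro x hx y hy h
    rcases lt_trichotomy (ρ x) (ρ y) with h' | h' | h'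
    · exact absurd h (card_better_lt hx h').ne
    · exact hρ h'
    · exact absurd h (card_better_lt hy h').ne'
  have himg : P.image (fun x => (better ρ P x).card) = Finset.range P.card := by
    apply Finset.eq_of_subset_of_card_le
    · intro i hi
      obtain ⟨x, hx, rfl⟩ := Finset.mem_image.1 hi
      rw [Finset.mem_range]
      apply Finset.card_lt_card
      rw [better, Finset.ssubset_iff_of_subset (Finset.filter_subset _ _)]
      exact ⟨x, hx, by simp⟩
    · rw [Finset.card_image_of_injOn hinj, Finset.card_range]
  have h1 : (top ρ u P).image (fun x => (better ρ P x).card) = Finset.range (min u P.card) := by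
    ext i
    have := congrArg (i ∈ ·) himg
    simp only [Finset.mem_image, Finset.mem_range, eq_iff_iff, mem_top, lt_min_iff] at *
    grind
  rw [← Finset.card_range (min u P.card), ← h1,
    Finset.card_image_of_injOn (hinj.mono (by exact_mod_cast top_subset))]

theorem top_eq_self (hρ : Function.Injective ρ) (h : P.card ≤ u) : top ρ u P = P :=
  Finset.eq_of_subset_of_card_le top_subset (by rw [card_top hρ]; omega)

theorem mem_top_of_lt (hx : x ∈ top ρ u P) (hy : y ∈ P) (h : ρ y < ρ x) : y ∈ top ρ u P :=
  mem_top.2 ⟨hy, (card_better_lt hy h).trans (mem_top.1 hx).2⟩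

theorem card_top_of_notMem (hρ : Function.Injective ρ) (hx : x ∈ P) (h : x ∉ top ρ u P) :
    (top ρ u P).card = u := by
  have h1 : u ≤ (better ρ P x).card := by
    by_contra h'
    exact h (mem_top.2 ⟨hx, by omega⟩)
  have h2 := Finset.card_le_card (Finset.filter_subset (fun y => ρ y < ρ x) P)
  rw [card_top hρ]
  have : (better ρ P x).card ≤ P.card := h2
  omega

theorem lt_of_mem_top (hρ : Function.Injective ρ) (hx : x ∈ P) (h : x ∉ top ρ u P)
    (hy : y ∈ top ρ u P) : ρ y < ρ x := by
  rcases lt_trichotomy (ρ y) (ρ x) with h' | h' | h'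
  · exact h'
  · exact absurd (hρ h' ▸ hy) h
  · exact absurd (mem_top_of_lt hy hx h') h

theorem top_eq_of_forall (hρ : Function.Injective ρ) (hS : S ⊆ P) (hc : S.card = u)
    (h : ∀ x ∈ P, x ∉ S → ∀ y ∈ S, ρ y < ρ x) : top ρ u P = S := by
  apply Finset.eq_of_subset_of_card_le
  · intro x hx
    by_contra hxS
    have h1 : S ⊆ better ρ P x := fun y hy => mem_better.2
      ⟨hS hy, h x (top_subset hx) hxS y hy⟩
    have := Finset.card_le_card h1
    have := (mem_top.1 hx).2
    omega
  · rw [card_top hρ, hc]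
    have := Finset.card_le_card hS
    omega

/-- Removing candidates that were not selected does not affect the selection. -/
theorem top_of_subset (hρ : Function.Injective ρ) (h1 : P ⊆ Q) (h2 : top ρ u Q ⊆ P) :
    top ρ u P = top ρ u Q := by
  symm
  apply Finset.eq_of_subset_of_card_le
  · intro x hx
    exact mem_top.2 ⟨h2 hx, (Finset.card_le_card (better_mono h1)).trans_lt (mem_top.1 hx).2⟩
  · rw [card_top hρ, card_top hρ]
    have := Finset.card_le_card h1
    omega

variable [DecidableEq α] {P₁ P₂ P₃ : Finset α}

/-- If some f selected from P₁ is rejected from P₂, then the selection from P₂ is full and better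
than f, so its members in P₁ are selected from P₁ as well. Together with the rejected ones they fit
into at most u places, which gives the inequality. Equality means that both sides vanish, or that
both selections are full and the one from P₁ lies inside P₂. -/
theorem card_exchange (hρ : Function.Injective ρ) :
    ((top ρ u P₁ ∩ P₂) \ top ρ u P₂).card ≤ (top ρ u P₂ \ P₁).card ∧
    (((top ρ u P₁ ∩ P₂) \ top ρ u P₂).card = (top ρ u P₂ \ P₁).card →
      (top ρ u P₂ ⊆ P₁ ∧ top ρ u P₁ ∩ P₂ ⊆ top ρ u P₂) ∨
      (top ρ u P₁ ⊆ P₂ ∧ (top ρ u P₁).card = u ∧ (top ρ u P₂).card = u ∧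
        top ρ u P₂ ∩ P₁ ⊆ top ρ u P₁ ∧
        ∃ f ∈ top ρ u P₁, f ∈ P₂ ∧ f ∉ top ρ u P₂)) := by
  by_cases he : top ρ u P₁ ∩ P₂ ⊆ top ρ u P₂
  · have h0 : (top ρ u P₁ ∩ P₂) \ top ρ u P₂ = ∅ := Finset.sdiff_eq_empty_iff_subset.2 he
    rw [h0]
    refine ⟨by simp, fun h => Or.inl ⟨?_, he⟩⟩
    rw [Finset.card_empty, eq_comm, Finset.card_eq_zero] at h
    exact Finset.sdiff_eq_empty_iff_subset.1 h
  · obtain ⟨f, hf, hfM⟩ := Finset.not_subset.1 he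
    obtain ⟨hf1, hf2⟩ := Finset.mem_inter.1 hf
    have hM : (top ρ u P₂).card = u := card_top_of_notMem hρ hf2 hfM
    have hlt : ∀ y ∈ top ρ u P₂, ρ y < ρ f := fun y hy => lt_of_mem_top hρ hf2 hfM hy
    have hsub : top ρ u P₂ ∩ P₁ ⊆ top ρ u P₁ \ ((top ρ u P₁ ∩ P₂) \ top ρ u P₂) := by
      intro y hy
      obtain ⟨hy1, hy2⟩ := Finset.mem_inter.1 hy
      have := mem_top_of_lt hf1 hy2 (hlt y hy1)
      grind
    have hc := Finset.card_le_card hsub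
    have hc1 : (top ρ u P₁ \ ((top ρ u P₁ ∩ P₂) \ top ρ u P₂)).card +
        ((top ρ u P₁ ∩ P₂) \ top ρ u P₂).card = (top ρ u P₁).card :=
      Finset.card_sdiff_add_card_eq_card
        (Finset.sdiff_subset.trans Finset.inter_subset_left)
    have hc2 := Finset.card_sdiff_add_card_inter (top ρ u P₂) P₁
    have hF : (top ρ u P₁).card ≤ u := by rw [card_top hρ]; omega
    refine ⟨by omega, fun h => Or.inr ?_⟩
    have heq := Finset.eq_of_subset_of_card_le hsub (by omega)
    refine ⟨?_, by omega, hM, hsub.trans Finset.sdiff_subset, f, hf1, hf2, hfM⟩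
    intro y hy
    by_contra hy2
    have : y ∈ top ρ u P₂ ∩ P₁ := by rw [heq]; grind
    exact hy2 (top_subset (Finset.mem_inter.1 this).1)

/-- The median of three sets of best elements. -/
theorem mem_median_top (hρ : Function.Injective ρ) (h13 : P₁ ⊆ P₃)
    (hc : (top ρ u P₁).card = (top ρ u P₃).card)
    (hW : ∀ x ∈ P₁, x ∉ top ρ u P₁ → x ∉ top ρ u P₃)
    (h1 : ((top ρ u P₁ ∩ P₂) \ top ρ u P₂).card = (top ρ u P₂ \ P₁).card)
    (h2 : ((top ρ u P₂ ∩ P₃) \ top ρ u P₃).card = (top ρ u P₃ \ P₂).card)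
    (hx : x ∈ P₁ ∪ (P₂ ∩ P₃)) :
    ((x ∈ P₁ ∧ x ∉ top ρ u P₁) ∨ ((x ∈ P₂ ∧ x ∉ top ρ u P₂) ∧ x ∈ P₃ ∧ x ∉ top ρ u P₃)) ↔
      x ∉ top ρ u (P₁ ∪ (P₂ ∩ P₃)) := by
  have s1 : top ρ u P₁ ⊆ P₁ := top_subset
  have s2 : top ρ u P₂ ⊆ P₂ := top_subset
  have s3 : top ρ u P₃ ⊆ P₃ := top_subset
  have l1 : ∀ x ∈ P₁, x ∉ top ρ u P₁ → ∀ y ∈ top ρ u P₁, ρ y < ρ x :=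
    fun x hx h y hy => lt_of_mem_top hρ hx h hy
  have l2 : ∀ x ∈ P₂, x ∉ top ρ u P₂ → ∀ y ∈ top ρ u P₂, ρ y < ρ x :=
    fun x hx h y hy => lt_of_mem_top hρ hx h hy
  have l3 : ∀ x ∈ P₃, x ∉ top ρ u P₃ → ∀ y ∈ top ρ u P₃, ρ y < ρ x :=
    fun x hx h y hy => lt_of_mem_top hρ hx h hy
  -- The equality cases identify the selection from the median pool as that from P₁, P₃ or P₂
  -- respectively, in the order in which they are treated.
  rcases (card_exchange hρ).2 h1 with ⟨a1, a2⟩ | ⟨a1, a2, a3, a4, f, f1, f2, f3⟩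
  · by_cases hu : P₂.card ≤ u
    · have hM := top_eq_self hρ hu
      rw [hM] at a1
      have : P₁ ∪ (P₂ ∩ P₃) = P₁ := Finset.union_eq_left.2
        (Finset.inter_subset_left.trans a1)
      rw [this] at hx ⊢
      grind
    · have hM : (top ρ u P₂).card = u := by rw [card_top hρ]; omega
      have hP : u ≤ P₁.card := hM ▸ Finset.card_le_card a1
      have hF : (top ρ u P₁).card = u := by rw [card_top hρ]; omega
      have key : top ρ u (P₁ ∪ (P₂ ∩ P₃)) = top ρ u P₁ := by
        apply top_eq_of_forall hρ (s1.trans Finset.subset_union_left) hF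
        intro x hx hxF y hy
        by_cases hx1 : x ∈ P₁
        · exact l1 x hx1 hxF y hy
        · have hx2 : x ∈ P₂ ∩ P₃ := by grind
          -- Otherwise the u members of `top ρ u P₂` all lie in P₁ and precede x, hence also y,
          -- which then could not be selected from P₁.
          by_contra hlt
          have hxy : ∀ z ∈ top ρ u P₂, z ∈ better ρ P₁ y := by
            intro z hz
            refine mem_better.2 ⟨a1 hz, ?_⟩
            have := l2 x (Finset.mem_inter.1 hx2).1 (fun h => hx1 (a1 h)) z hz
            omega
          have := Finset.card_le_card hxy
          have := (mem_top.1 hy).2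
          omega
      rw [key]
      have hB : ∀ x ∈ P₂ ∩ P₃, x ∉ P₁ → x ∉ top ρ u P₃ := by
        intro x hx hx1 hx3
        have hxy : ∀ z ∈ top ρ u P₂, z ∈ better ρ P₃ x := by
          intro z hz
          exact mem_better.2 ⟨h13 (a1 hz),
            l2 x (Finset.mem_inter.1 hx).1 (fun h => hx1 (a1 h)) z hz⟩
        have := Finset.card_le_card hxy
        have := (mem_top.1 hx3).2
        omega
      grind
  · rcases (card_exchange hρ).2 h2 with ⟨b1, b2⟩ | ⟨b1, b2, b3, b4, g, g1, g2, g3⟩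
    · have key : top ρ u (P₁ ∪ (P₂ ∩ P₃)) = top ρ u P₃ := by
        apply top_eq_of_forall hρ
        · grind
        · omega
        · intro x hx hxB y hy
          exact l3 x (by grind) hxB y hy
      rw [key]
      grind
    · have key : top ρ u (P₁ ∪ (P₂ ∩ P₃)) = top ρ u P₂ := by
        apply top_eq_of_forall hρ
        · grind
        · omega
        · intro x hx hxM y hy
          by_cases hx2 : x ∈ P₂
          · exact l2 x hx2 hxM y hy
          · have h4 := l1 x (by grind) (by grind) f f1
            have h5 := l2 f f2 f3 y hy
            omega
      rw [key]
      grind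

end Top

/-! ### One hospital in a stable table -/

section Hospital

variable {α : Type*} {ρ : α → ℕ} {l u : ℕ} {x : α}

/-- The residents that a hospital with quotas `l` and `u` chooses from `P`. -/
def chosen (ρ : α → ℕ) (l u : ℕ) (P : Finset α) : Finset α := if P.card < l then ∅ else top ρ u P

theorem chosen_subset {P : Finset α} : chosen ρ l u P ⊆ P := by
  unfold chosen
  split_ifs
  · simp
  · exact top_subset

theorem notMem_chosen {P : Finset α} (hx : x ∈ P) :
    x ∉ chosen ρ l u P ↔ P.card < l ∨ u ≤ (better ρ P x).card := by
  unfold chosen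
  split_ifs with h <;> simp [h, mem_top, hx]

variable [DecidableEq α] {P₁ P₂ P₃ F B : Finset α}

/-- The situation at one hospital in a stable table: the residents in `P₁` surely reach it and those
in `P₃` possibly do, `F` and `B` are those for which it is the first, respectively the last
remaining hospital. -/
structure StableAt (ρ : α → ℕ) (l u : ℕ) (P₁ F P₃ B : Finset α) : Prop where
  inj : Function.Injective ρ
  one_le : 1 ≤ l
  le_two : l ≤ 2
  le : l ≤ u
  sub : P₁ ⊆ P₃
  subF : F ⊆ P₁
  passed : ∀ x ∈ P₁, x ∉ F → x ∉ B
  mem_first : ∀ x ∈ P₁, (x ∈ F ↔ l ≤ P₃.card ∧ (better ρ P₁ x).card < u)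
  mem_last : ∀ x ∈ P₃, l ≤ (insert x P₁).card → (better ρ P₃ x).card < u → x ∈ B

namespace StableAt

variable (H : StableAt ρ l u P₁ F P₃ B)
include H

/-- With P₁ also P₃ meets the lower quota, so that only the upper quota can cause a sure rejection.
-/
theorem first_eq (h : l ≤ P₁.card) : F = top ρ u P₁ := by
  have := Finset.card_le_card H.sub
  ext x
  constructor
  · intro hx
    exact mem_top.2 ⟨H.subF hx, ((H.mem_first x (H.subF hx)).1 hx).2⟩
  · intro hx
    exact (H.mem_first x (top_subset hx)).2 ⟨by omega, (mem_top.1 hx).2⟩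

theorem top_subset_last (h : l ≤ P₁.card) : top ρ u P₃ ⊆ B := by
  intro x hx
  have := Finset.card_le_card (Finset.subset_insert x P₁)
  exact H.mem_last x (top_subset hx) (by omega) (mem_top.1 hx).2

/-- This is a main use of the bound two on lower quotas: a hospital that some, but not enough,
residents surely reach misses just one. -/
theorem eq_singleton {r : α} (h : P₁.card < l) (hr : r ∈ P₁) : l = 2 ∧ P₁ = {r} := by
  have := H.le_two
  have h0 := Finset.card_pos.2 ⟨r, hr⟩
  obtain ⟨a, ha⟩ := Finset.card_eq_one.1 (show P₁.card = 1 by omega)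
  subst ha
  simp at hr
  subst hr
  exact ⟨by omega, rfl⟩

/-- If x came to the hospital, then x and r would meet the lower quota, and x is good enough even
when all of P₃ come. So x is surely accepted and cannot go below this hospital. -/
theorem mem_last_of_ne {r : α} (h : P₁.card < l) (hr : r ∈ P₁) (hx : x ∈ top ρ u P₃)
    (hxr : x ≠ r) : x ∈ B := by
  obtain ⟨h1, rfl⟩ := H.eq_singleton h hr
  refine H.mem_last x (top_subset hx) ?_ (mem_top.1 hx).2
  rw [Finset.card_insert_of_notMem (by simpa using hxr)]
  simpa using H.le_two

theorem exists_last {r : α} (h : P₁.card < l) (hr : r ∈ F) : ∃ x ∈ top ρ u P₃, x ≠ r := by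
  obtain ⟨h1, h2⟩ := H.eq_singleton h (H.subF hr)
  have h3 := ((H.mem_first r (H.subF hr)).1 hr).1
  have h4 := H.le
  have h5 : 1 < (top ρ u P₃).card := by rw [card_top H.inj]; omega
  exact Finset.exists_mem_ne h5 r

/-- This is the local half of the double count. If P₁ meets the lower quota, the selections from P₁
⊆ P₃ are compared. Otherwise F has at most one member r, and the second resident that the hospital
would take from P₃ is in B. -/
theorem card_le : F.card ≤ B.card := by
  by_cases h : l ≤ P₁.card
  · refine le_trans ?_ (Finset.card_le_card (H.top_subset_last h))
    rw [H.first_eq h, card_top H.inj, card_top H.inj]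
    have := Finset.card_le_card H.sub
    omega
  · rcases F.eq_empty_or_nonempty with h0 | ⟨r, hr⟩
    · simp [h0]
    · obtain ⟨x, hx, hxr⟩ := H.exists_last (by omega) hr
      have h1 : 0 < B.card := Finset.card_pos.2 ⟨x, H.mem_last_of_ne (by omega) (H.subF hr) hx hxr⟩
      have := Finset.card_le_card H.subF
      have := H.le_two
      omega

/-- If the hospital rejects one of the two residents in question, then it has only the other
one among `P₃`. -/
theorem inter_subset_of_rejected {y z : α} (htop : top ρ u P₃ = {y, z}) (hy2 : y ∈ P₂)
    (hy : y ∉ top ρ u P₂) : top ρ u P₂ ∩ P₃ ⊆ {z} := by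
  intro w hw
  obtain ⟨hw1, hw2⟩ := Finset.mem_inter.1 hw
  have h1 : y ∈ top ρ u P₃ := by simp [htop]
  have h2 := mem_top_of_lt h1 hw2 (lt_of_mem_top H.inj hy2 hy hw1)
  rw [htop] at h2
  have : w ≠ y := fun h => hy (h ▸ hw1)
  simpa [this] using h2

/-- This is the exchange inequality for a half-open hospital, where P₁ = F = {r} and B = {x}, with
its equality cases. As r and x are the best two of P₃, the rejection of one of them from P₂ leaves
only the other one among the members of P₃ that are chosen. -/
theorem card_exchange_halfOpen {r x : α} (hl : l = 2) (hxr : x ≠ r) (htop : top ρ u P₃ = {r, x}) :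
    (({r} ∩ P₂) \ chosen ρ l u P₂).card + ((chosen ρ l u P₂ ∩ P₃) \ {x}).card ≤
      (chosen ρ l u P₂ \ {r}).card + ({x} \ P₂).card ∧
    ((({r} ∩ P₂) \ chosen ρ l u P₂).card + ((chosen ρ l u P₂ ∩ P₃) \ {x}).card =
      (chosen ρ l u P₂ \ {r}).card + ({x} \ P₂).card →
      (P₂ = {r} ∨ P₂ = {x}) ∨ (2 ≤ P₂.card ∧ r ∈ top ρ u P₂ ∧ ((top ρ u P₂ ⊆ P₃ ∧ (x ∈ P₂ → x ∈ top ρ u P₂)) ∨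
        (x ∈ P₂ ∧ top ρ u P₂ ∩ P₃ ⊆ {r})))) := by
  have hlu := H.le
  have hx3 : x ∈ P₃ := top_subset (u := u) (ρ := ρ) (by simp [htop])
  by_cases hM : P₂.card < l
  · simp only [chosen, if_pos hM, Finset.sdiff_empty, Finset.empty_inter, Finset.empty_sdiff,
        Finset.card_empty, zero_add, add_zero]
    have hss : P₂ = ∅ ∨ ∃ a, P₂ = {a} := by
      rcases P₂.eq_empty_or_nonempty with h | h
      · exact Or.inl h
      · exact Or.inr (Finset.card_eq_one.1 (by have := h.card_pos; omega))
    rcases hss with rfl | ⟨a, rfl⟩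
    · simp
    · by_cases har : a = r
      · subst har
        simp [Finset.sdiff_singleton_eq_erase, Finset.erase_eq_of_notMem, Ne.symm hxr]
      · have e : ({r} : Finset α) ∩ {a} = ∅ := by simp [Ne.symm har]
        rw [e]
        refine ⟨by simp, fun h => Or.inl (Or.inr ?_)⟩
        rw [Finset.card_empty, eq_comm, Finset.card_eq_zero] at h
        simp at h
        rw [h]
  · have hu : 2 ≤ (top ρ u P₂).card := by rw [card_top H.inj]; omega
    rw [chosen, if_neg hM]
    have hM2 : top ρ u P₂ ⊆ P₂ := top_subset
    generalize hT : top ρ u P₂ = M at *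
    by_cases hrM : r ∈ M
    · have e1 : ({r} ∩ P₂) \ M = ∅ := by grind
      have e2 : (M \ {r}).card = M.card - 1 := by
        rw [Finset.sdiff_singleton_eq_erase, Finset.card_erase_of_mem hrM]
      rw [e1, e2, Finset.card_empty, zero_add]
      by_cases hxM : x ∈ M
      · have e3 : ({x} : Finset α) \ P₂ = ∅ := by grind
        have e4 : ((M ∩ P₃) \ {x}).card = (M ∩ P₃).card - 1 := by
          rw [Finset.sdiff_singleton_eq_erase, Finset.card_erase_of_mem (by grind)]
        have e5 := Finset.card_le_card (Finset.inter_subset_left (s₁ := M) (s₂ := P₃))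
        have e6 : 0 < (M ∩ P₃).card := Finset.card_pos.2 ⟨x, by grind⟩
        rw [e3, e4, Finset.card_empty]
        refine ⟨by omega, fun h => Or.inr ⟨by omega, hrM, Or.inl ⟨?_, by grind⟩⟩⟩
        have := Finset.eq_of_subset_of_card_le (Finset.inter_subset_left (s₁ := M) (s₂ := P₃))
          (by omega)
        exact Finset.inter_eq_left.1 this
      · by_cases hx2 : x ∈ P₂
        · have e3 : ({x} : Finset α) \ P₂ = ∅ := by grind
          have e4 : M ∩ P₃ ⊆ {r} := by
            have := H.inter_subset_of_rejected (P₂ := P₂) (y := x) (z := r)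
              (by rw [htop, Finset.pair_comm]) hx2 (by rw [hT]; exact hxM)
            rwa [hT] at this
          have e5 : ((M ∩ P₃) \ {x}).card ≤ 1 :=
            (Finset.card_le_card (Finset.sdiff_subset.trans e4)).trans (by simp)
          rw [e3, Finset.card_empty]
          exact ⟨by omega, fun h => Or.inr ⟨by omega, hrM, Or.inr ⟨hx2, e4⟩⟩⟩
        · have e3 : ({x} : Finset α) \ P₂ = {x} := by grind
          have e4 := Finset.card_le_card ((Finset.sdiff_subset (s := M ∩ P₃) (t := {x})).trans
            Finset.inter_subset_left)
          rw [e3, Finset.card_singleton]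
          refine ⟨by omega, fun h => Or.inr ⟨by omega, hrM, Or.inl ⟨?_, by grind⟩⟩⟩
          have := Finset.eq_of_subset_of_card_le ((Finset.sdiff_subset (s := M ∩ P₃) (t := {x})).trans
            Finset.inter_subset_left) (by omega)
          intro y hy
          rw [← this] at hy
          grind
    · have e2 : M \ {r} = M := by grind
      rw [e2]
      by_cases hr2 : r ∈ P₂
      · have e4 : M ∩ P₃ ⊆ {x} := by
          have := H.inter_subset_of_rejected (P₂ := P₂) htop hr2 (by rw [hT]; exact hrM)
          rwa [hT] at this
        have e5 : (M ∩ P₃) \ {x} = ∅ := Finset.sdiff_eq_empty_iff_subset.2 e4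
        have e6 : (({r} ∩ P₂) \ M).card ≤ 1 :=
          (Finset.card_le_card (Finset.sdiff_subset.trans Finset.inter_subset_left)).trans
            (by simp)
        rw [e5, Finset.card_empty]
        exact ⟨by omega, fun h => by omega⟩
      · have e1 : ({r} ∩ P₂) \ M = ∅ := by grind
        have e4 := Finset.card_le_card ((Finset.sdiff_subset (s := M ∩ P₃) (t := {x})).trans
            Finset.inter_subset_left)
        rw [e1, Finset.card_empty]
        refine ⟨by omega, fun h => ?_⟩
        have e5 := Finset.eq_of_subset_of_card_le
          ((Finset.sdiff_subset (s := M ∩ P₃) (t := {x})).trans Finset.inter_subset_left)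
          (by omega)
        have hxM : x ∉ M := by
          intro hx
          rw [← e5] at hx
          simp at hx
        rw [e5] at h
        have e6 : ({x} \ P₂).card = 0 := by omega
        have hx2 : x ∈ P₂ := by
          rw [Finset.card_eq_zero] at e6
          simpa using e6
        have e7 : M ∩ P₃ ⊆ {r} := by
          have := H.inter_subset_of_rejected (P₂ := P₂) (y := x) (z := r)
            (by rw [htop, Finset.pair_comm]) hx2 (by rw [hT]; exact hxM)
          rwa [hT] at this
        -- All of M would lie in P₃, and there only r is left; but r is not even in P₂.
        obtain ⟨y, hy⟩ := Finset.card_pos.1 (show 0 < M.card by omega)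
        have hy' := hy
        rw [← e5] at hy'
        have := e7 (Finset.sdiff_subset hy')
        simp at this
        exact absurd (this ▸ hy) hrM

variable (hc : F.card = B.card)
include hc

/-- One inclusion is known, and |B| = |F| is at most the size of the selection from P₃. -/
theorem last_eq (h : l ≤ P₁.card) : B = top ρ u P₃ := by
  symm
  apply Finset.eq_of_subset_of_card_le (H.top_subset_last h)
  rw [← hc, H.first_eq h, card_top H.inj, card_top H.inj]
  have := Finset.card_le_card H.sub
  omega

/-- The situation at a hospital that a single resident reaches surely, if it needs two. -/
theorem halfOpen {r : α} (h : P₁.card < l) (hr : r ∈ F) :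
    l = 2 ∧ P₁ = {r} ∧ F = {r} ∧ ∃ x, x ≠ r ∧ B = {x} ∧ top ρ u P₃ = {r, x} := by
  obtain ⟨h1, h2⟩ := H.eq_singleton h (H.subF hr)
  have hF : F = {r} := (Finset.subset_singleton_iff.1 (h2 ▸ H.subF)).resolve_left
    (Finset.ne_empty_of_mem hr)
  obtain ⟨x, hx, hxr⟩ := H.exists_last h hr
  have hxB := H.mem_last_of_ne h (H.subF hr) hx hxr
  have hB : B = {x} := by
    obtain ⟨a, ha⟩ := Finset.card_eq_one.1 (show B.card = 1 by rw [← hc, hF]; simp)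
    rw [ha] at hxB ⊢
    simp at hxB
    rw [hxB]
  refine ⟨h1, h2, hF, x, hxr, hB, ?_⟩
  apply Finset.eq_of_subset_of_card_le
  · intro y hy
    by_cases hyr : y = r
    · simp [hyr]
    · have := H.mem_last_of_ne h (H.subF hr) hy hyr
      rw [hB] at this
      simp at this
      simp [this]
  · have h3 := ((H.mem_first r (H.subF hr)).1 hr).1
    have h4 := H.le
    rw [card_top H.inj, Finset.card_pair (Ne.symm hxr)]
    omega

/-- A hospital that is nobody's first one. -/
theorem first_empty (h : P₁.card < l) (hF : F = ∅) : B = ∅ ∧ (P₁ = ∅ ∨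
    (l = 2 ∧ ∃ r, P₁ = {r} ∧ P₃ = {r})) := by
  have hlu := H.le
  refine ⟨by rw [hF] at hc; simpa using hc.symm, ?_⟩
  rcases P₁.eq_empty_or_nonempty with h1 | ⟨r, hr⟩
  · exact Or.inl h1
  · obtain ⟨h1, h2⟩ := H.eq_singleton h hr
    -- Nobody in P₁ = {r} is better than r, so r can have been rejected only because P₃ has fewer
    -- than two members.
    have h4 := H.mem_first r hr
    have h5 : (better ρ {r} r).card = 0 := by simp [better]
    have h6 := Finset.card_le_card H.sub
    refine Or.inr ⟨h1, r, h2, ?_⟩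
    rw [← h2]
    refine (Finset.eq_of_subset_of_card_le H.sub ?_).symm
    rw [hF, h2] at h4
    rw [h2] at h6 ⊢
    simp at h4 h6 ⊢
    have := mt h4
    omega

/-- The left side counts residents for whom q is worse than t or better than b and whose better
choice of the two is this hospital; the right side counts those for whom it is the worse choice.
Globally every such resident has a better choice, so the reverse inequality will hold for the sums.
-/
theorem card_exchange :
    ((F ∩ P₂) \ chosen ρ l u P₂).card + ((chosen ρ l u P₂ ∩ P₃) \ B).card ≤
      (chosen ρ l u P₂ \ P₁).card + (B \ P₂).card := by
  have hM2 : chosen ρ l u P₂ ⊆ P₂ := chosen_subset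
  have hl2 := H.le_two
  have hl1 := H.one_le
  have hlu := H.le
  by_cases hA : l ≤ P₁.card
  · have e1 := H.first_eq hA
    have e2 := H.last_eq hc hA
    by_cases hM : P₂.card < l
    · simp only [chosen, if_pos hM, Finset.sdiff_empty, Finset.empty_inter, Finset.empty_sdiff,
        Finset.card_empty]
      -- Since |P₂| < l ≤ 2, twice |P₂| is at most l, and l is at most |F| = |B|. Hence B has at
      -- least |P₂| members outside P₂. This fails for larger lower quotas.
      have h1 := Finset.card_le_card (Finset.inter_subset_right (s₁ := F) (s₂ := P₂))
      have h2 := Finset.le_card_sdiff P₂ B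
      have h3 : l ≤ F.card := by rw [e1, card_top H.inj]; omega
      omega
    · rw [chosen, if_neg hM, e1, e2]
      exact add_le_add (HRQ.card_exchange H.inj).1 (HRQ.card_exchange H.inj).1
  · rcases F.eq_empty_or_nonempty with h0 | ⟨r, hr⟩
    · obtain ⟨hB, h1 | ⟨h1, r, h2, h3⟩⟩ := H.first_empty hc (by omega) h0
      all_goals rw [h0, hB]
      · rw [h1]
        simpa using Finset.card_le_card Finset.inter_subset_left
      · rw [h2, h3]
        have h4 : (chosen ρ l u P₂ ∩ {r}).card ≤ 1 :=
          (Finset.card_le_card Finset.inter_subset_right).trans (by simp)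
        have h5 := Finset.card_sdiff_add_card_inter (chosen ρ l u P₂) {r}
        -- A nonempty choice has at least two members, so that r cannot be chosen without somebody
        -- outside P₁.
        rcases (chosen ρ l u P₂).eq_empty_or_nonempty with h6 | h6
        · simp [h6]
        · have h7 : l ≤ (chosen ρ l u P₂).card := by
            by_cases hM : P₂.card < l
            · simp [chosen, hM] at h6
            · rw [chosen, if_neg hM, card_top H.inj]; omega
          simp
          omega
    · obtain ⟨h1, h2, h3, x, hxr, hB, htop⟩ := H.halfOpen hc (by omega) hr
      rw [h2, h3, hB]
      exact (H.card_exchange_halfOpen h1 hxr htop).1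

/-- The union on the right consists of the residents that reach the hospital under the median of t,
q and b, and the left side describes those whose median position is beyond it. So equality in the
exchange is what makes the median obey the rule of a stable matching here. -/
theorem mem_median
    (he : ((F ∩ P₂) \ chosen ρ l u P₂).card + ((chosen ρ l u P₂ ∩ P₃) \ B).card =
      (chosen ρ l u P₂ \ P₁).card + (B \ P₂).card) {y : α} (hy : y ∈ P₁ ∪ (P₂ ∩ P₃)) :
    ((y ∈ P₁ ∧ y ∉ F) ∨ ((y ∈ P₂ ∧ y ∉ chosen ρ l u P₂) ∧ y ∈ P₃ ∧ y ∉ B)) ↔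
      y ∉ chosen ρ l u (P₁ ∪ (P₂ ∩ P₃)) := by
  have hM2 : chosen ρ l u P₂ ⊆ P₂ := chosen_subset
  have hl2 := H.le_two
  have hl1 := H.one_le
  have hlu := H.le
  have hsub := H.sub
  by_cases hA : l ≤ P₁.card
  · have e1 := H.first_eq hA
    have e2 := H.last_eq hc hA
    have hP := Finset.card_le_card (Finset.subset_union_left (s₁ := P₁) (s₂ := P₂ ∩ P₃))
    rw [chosen, chosen, if_neg (show ¬ (P₁ ∪ (P₂ ∩ P₃)).card < l by omega)]
    by_cases hM : P₂.card < l
    · simp only [chosen, if_pos hM, Finset.sdiff_empty, Finset.empty_inter, Finset.empty_sdiff,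
        Finset.card_empty, add_zero, zero_add] at he
      have h1 := Finset.card_le_card (Finset.inter_subset_right (s₁ := F) (s₂ := P₂))
      have h2 := Finset.le_card_sdiff P₂ B
      have h3 : l ≤ F.card := by rw [e1, card_top H.inj]; omega
      -- Equality leaves no slack in the two estimates, so P₂ is contained in both F and B and adds
      -- nothing to P₁.
      have h4 : F ∩ P₂ = P₂ := Finset.eq_of_subset_of_card_le Finset.inter_subset_right (by omega)
      have h5 : P₂ ⊆ F := Finset.inter_eq_right.1 h4
      have h6 : P₁ ∪ (P₂ ∩ P₃) = P₁ := Finset.union_eq_left.2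
        (Finset.inter_subset_left.trans (h5.trans H.subF))
      have h7 : P₂ ⊆ B := by
        have h8 := Finset.card_sdiff_add_card_inter B P₂
        have h9 : B ∩ P₂ = P₂ :=
          Finset.eq_of_subset_of_card_le Finset.inter_subset_right (by omega)
        exact Finset.inter_eq_right.1 h9
      rw [h6, if_pos hM, ← e1]
      rw [h6] at hy
      grind
    · rw [chosen, if_neg hM, e1, e2] at he
      rw [if_neg hM]
      have i1 := (HRQ.card_exchange H.inj (u := u) (P₁ := P₁) (P₂ := P₂)).1
      have i2 := (HRQ.card_exchange H.inj (u := u) (P₁ := P₂) (P₂ := P₃)).1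
      rw [e1, e2]
      exact mem_median_top H.inj hsub (by rw [← e1, ← e2]; exact hc)
        (by rw [← e1, ← e2]; exact H.passed) (by omega) (by omega) hy
  · rcases F.eq_empty_or_nonempty with h0 | ⟨r, hr⟩
    · obtain ⟨hB, h1 | ⟨h1, r, h2, h3⟩⟩ := H.first_empty hc (by omega) h0
      · rw [h0, hB, h1] at he
        rw [h0, hB, h1]
        rw [h1] at hy
        simp only [Finset.empty_inter, Finset.empty_sdiff, Finset.sdiff_empty, Finset.card_empty,
          zero_add, add_zero, Finset.empty_union, Finset.notMem_empty, false_and, false_or] at *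
        -- With P₁, F and B empty, equality says that everybody chosen from P₂ belongs to P₃.
        have h2 := Finset.inter_eq_left.1
          (Finset.eq_of_subset_of_card_le Finset.inter_subset_left he.ge)
        by_cases hM : P₂.card < l
        · have := Finset.card_le_card (Finset.inter_subset_left (s₁ := P₂) (s₂ := P₃))
          rw [chosen, if_pos hM, chosen, if_pos (by omega)]
          grind
        · rw [chosen, if_neg hM] at *
          have h3 := Finset.card_le_card (Finset.subset_inter hM2 h2)
          have h4 := card_top H.inj (u := u) (P := P₂)
          rw [chosen, if_neg (show ¬ (P₂ ∩ P₃).card < l by omega),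
            top_of_subset H.inj Finset.inter_subset_left (Finset.subset_inter hM2 h2)]
          grind
      · have h6 : P₁ ∪ (P₂ ∩ P₃) = {r} := by
          rw [h2, h3]; exact Finset.union_eq_left.2 Finset.inter_subset_right
        rw [h6] at hy ⊢
        rw [h0, h2, hB, h3]
        simp at hy
        subst hy
        rw [chosen, chosen, if_pos (show ({y} : Finset α).card < l by simp; omega)]
        simp
    · obtain ⟨h1, h2, h3, x, hxr, hB, htop⟩ := H.halfOpen hc (by omega) hr
      rw [h2, h3, hB] at he
      rw [h2, hB, h3]
      rw [h2] at hy
      have hr3 : r ∈ P₃ := hsub (H.subF hr)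
      have hx3 : x ∈ P₃ := top_subset (u := u) (ρ := ρ) (by simp [htop])
      rcases (H.card_exchange_halfOpen h1 hxr htop).2 he with (h4 | h4) | ⟨h4, h5, h6⟩
      · have h6 : {r} ∪ (P₂ ∩ P₃) = {r} := by
          rw [h4]; exact Finset.union_eq_left.2 Finset.inter_subset_left
        rw [h6] at hy ⊢
        rw [h4, chosen, if_pos (show ({r} : Finset α).card < l by simp; omega)]
        grind
      · have h6 : {r} ∪ (P₂ ∩ P₃) = {r, x} := by grind
        have h7 : ({r, x} : Finset α).card = 2 := Finset.card_pair (Ne.symm hxr)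
        rw [h6] at hy ⊢
        rw [h4, chosen, chosen, if_neg (show ¬ ({r, x} : Finset α).card < l by omega),
          if_pos (show ({x} : Finset α).card < l by simp; omega), top_eq_self H.inj (by omega)]
        grind
      · have h7 : 2 ≤ (top ρ u P₂).card := by rw [card_top H.inj]; omega
        have hT2 : top ρ u P₂ ⊆ P₂ := top_subset
        rw [chosen, if_neg (show ¬ P₂.card < l by omega), chosen]
        -- The selection from the median pool is that from P₂ in the first case, and the pair r, x
        -- selected from P₃ in the second.
        rcases h6 with ⟨h6, h6'⟩ | ⟨hx2, h6⟩
        · have h8 : top ρ u P₂ ⊆ {r} ∪ (P₂ ∩ P₃) := by grind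
          have h9 := Finset.card_le_card h8
          rw [if_neg (by omega), top_of_subset H.inj (by grind) h8]
          grind
        · have h8 : top ρ u P₃ ⊆ {r} ∪ (P₂ ∩ P₃) := by grind
          have h9 := Finset.card_le_card h8
          have h10 : (top ρ u P₃).card = 2 := by rw [htop]; exact Finset.card_pair (Ne.symm hxr)
          rw [if_neg (by omega), top_of_subset H.inj (by grind) h8, htop]
          grind

end StableAt

end Hospital

namespace Instance

variable {n m : ℕ} (I : Instance n m)

/-! ### Stable matchings as vectors of positions -/

/-- The position of `h` on the list of `r`, counted from `1`. -/
def rk (r : Fin n) (h : Fin m) : ℕ := (I.resPref r).idxOf h + 1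

/-- The priority of `r` at `h`, extended injectively to all residents. -/
def prio (h : Fin m) (r : Fin n) : ℕ :=
  if r ∈ I.hosPref h then (I.hosPref h).idxOf r else (I.hosPref h).length + r

/-- The residents whose position in `p` is that of `h` or a worse one. -/
def reach (p : Fin n → ℕ) (h : Fin m) : Finset (Fin n) :=
  Finset.univ.filter (fun r => r ∈ I.hosPref h ∧ I.rk r h ≤ p r)

/-- The residents whose position in `p` is that of `h`. -/
def at' (p : Fin n → ℕ) (h : Fin m) : Finset (Fin n) :=
  Finset.univ.filter (fun r => r ∈ I.hosPref h ∧ p r = I.rk r h)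

/-- The position vectors of stable matchings. -/
structure StablePos (q : Fin n → ℕ) : Prop where
  one_le : ∀ r, 1 ≤ q r
  le : ∀ r, q r ≤ (I.resPref r).length + 1
  rejected : ∀ h, ∀ r ∈ I.reach q h, (I.rk r h < q r ↔ (I.reach q h).card < I.lower h ∨
    I.upper h ≤ (better (I.prio h) (I.reach q h) r).card)

variable {I} {p q t b : Fin n → ℕ} {r : Fin n} {h : Fin m}

theorem mem_reach : r ∈ I.reach p h ↔ r ∈ I.hosPref h ∧ I.rk r h ≤ p r := by simp [reach]

theorem mem_at' : r ∈ I.at' p h ↔ r ∈ I.hosPref h ∧ p r = I.rk r h := by simp [at']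

theorem reach_mono (hpq : ∀ r, p r ≤ q r) : I.reach p h ⊆ I.reach q h := by
  intro r hr
  rw [mem_reach] at *
  exact ⟨hr.1, hr.2.trans (hpq r)⟩

theorem rk_le_length (hr : r ∈ I.hosPref h) : I.rk r h ≤ (I.resPref r).length :=
  List.idxOf_lt_length_of_mem ((I.mem_iff r h).2 hr)

theorem one_le_rk : 1 ≤ I.rk r h := Nat.le_add_left 1 _

theorem rk_inj {h' : Fin m} (hr : r ∈ I.hosPref h) (e : I.rk r h = I.rk r h') :
    h = h' := by
  unfold rk at e
  exact (List.idxOf_inj ((I.mem_iff r h).2 hr)).1 (by omega)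

theorem prio_inj : Function.Injective (I.prio h) := by
  intro x y e
  unfold prio at e
  split_ifs at e with h1 h2 h2
  · exact (List.idxOf_inj h1).1 e
  · have := List.idxOf_lt_length_of_mem h1
    omega
  · have := List.idxOf_lt_length_of_mem h2
    omega
  · exact Fin.ext (by omega)

theorem prio_eq (hr : r ∈ I.hosPref h) : I.prio h r = (I.hosPref h).idxOf r := if_pos hr

theorem StablePos.at'_eq (hq : I.StablePos q) :
    I.at' q h = chosen (I.prio h) (I.lower h) (I.upper h) (I.reach q h) := by
  ext r
  by_cases hr : r ∈ I.reach q h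
  · have h1 := hq.rejected h r hr
    rw [← notMem_chosen hr] at h1
    rw [mem_reach] at hr
    rw [mem_at']
    constructor
    · rintro ⟨_, h3⟩
      by_contra h4
      have := h1.2 h4
      omega
    · intro h3
      refine ⟨hr.1, ?_⟩
      by_contra h4
      exact h1.1 (by omega) h3
  · refine iff_of_false ?_ (fun h' => hr (chosen_subset h'))
    rw [mem_at']
    rw [mem_reach] at hr
    intro h'
    exact hr ⟨h'.1, h'.2.ge⟩

/-- The position vector of an assignment. -/
def toPos (I : Instance n m) (M : Assignment n m) (r : Fin n) : ℕ :=
  match M r with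
  | none => (I.resPref r).length + 1
  | some h => I.rk r h

/-- The assignment with a given position vector. -/
def ofPos (I : Instance n m) (q : Fin n → ℕ) : Assignment n m := fun r => (I.resPref r)[q r - 1]?

theorem toPos_eq_iff {M : Assignment n m} (hr : r ∈ I.hosPref h) :
    I.toPos M r = I.rk r h ↔ M r = some h := by
  unfold toPos
  rcases e : M r with _ | h'
  · have := rk_le_length hr
    simp
    omega
  · simp only [Option.some.injEq]
    constructor
    · intro e'
      exact (rk_inj hr e'.symm).symm
    · rintro rfl
      rfl

theorem resPrefers_iff {M : Assignment n m} (hM : I.IsMatching M) :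
    I.ResPrefers M r h ↔ r ∈ I.hosPref h ∧ I.rk r h < I.toPos M r := by
  unfold ResPrefers toPos
  rw [I.mem_iff]
  refine and_congr_right (fun hr => ?_)
  rcases e : M r with _ | h'
  · have := rk_le_length hr
    simp
    omega
  · have h1 := hM r h' e
    have h2 := (I.mem_iff r h).2 hr
    simp [Above, h1, h2, rk]

/-- If r prefers h although neither quota justifies the rejection, then r blocks with an open h, or
l(h) residents reaching h block with a closed h. Conversely, if r is at h, then h meets its lower
quota, and u(h) better residents reaching h would include one that is not at h and blocks. -/
theorem toPos_stable {M : Assignment n m} (hM : I.IsStable M) : I.StablePos (I.toPos M) := by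
  obtain ⟨h1, h2, h3, h4⟩ := hM
  have hmem : ∀ r h, r ∈ M.at h ↔ M r = some h := by simp [Assignment.at]
  have hacc : ∀ r h, M r = some h → r ∈ I.hosPref h := fun r h e => (I.mem_iff r h).1 (h1 r h e)
  constructor
  · intro r
    unfold toPos
    split
    · omega
    · exact one_le_rk
  · intro r
    unfold toPos
    split
    · omega
    · next h e => exact (rk_le_length (hacc r h e)).trans (Nat.le_succ _)
  · intro h r hr
    rw [mem_reach] at hr
    have hsub : M.at h ⊆ I.reach (I.toPos M) h := by
      intro x hx
      rw [hmem] at hx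
      exact mem_reach.2 ⟨hacc x h hx, ((toPos_eq_iff (hacc x h hx)).2 hx).ge⟩
    constructor
    · intro hlt
      by_contra! hcon
      have hpref := (resPrefers_iff h1).2 ⟨hr.1, hlt⟩
      by_cases h0 : (M.at h).card = 0
      · obtain ⟨S, hS, hSc⟩ := Finset.exists_subset_card_eq hcon.1
        refine h4 h S ⟨h0, hSc, fun x hx => (resPrefers_iff h1).2 ?_⟩
        have hx' := mem_reach.1 (hS hx)
        refine ⟨hx'.1, lt_of_le_of_ne hx'.2 (fun e => ?_)⟩
        have := (hmem x h).2 ((toPos_eq_iff hx'.1).1 e.symm)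
        rw [Finset.card_eq_zero] at h0
        simp [h0] at this
      · refine h3 r h ⟨h0, hpref, ?_⟩
        by_contra! hcon2
        have hss : M.at h ⊆ better (I.prio h) (I.reach (I.toPos M) h) r := by
          intro x hx
          have hxr : x ≠ r := by
            rintro rfl
            have := (toPos_eq_iff hr.1).2 ((hmem x h).1 hx)
            omega
          have hxa := hacc x h ((hmem x h).1 hx)
          refine mem_better.2 ⟨hsub hx, ?_⟩
          by_contra hle
          have hne : I.prio h x ≠ I.prio h r := fun e => hxr (prio_inj e)
          refine hcon2.2 x hx ⟨hr.1, hxa, ?_⟩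
          rw [prio_eq hxa, prio_eq hr.1] at *
          omega
        have := Finset.card_le_card hss
        omega
    · intro hrej
      by_contra hlt
      have hMr : M r = some h := (toPos_eq_iff hr.1).1 (by omega)
      have hra := (hmem r h).2 hMr
      have hpos := Finset.card_pos.2 ⟨r, hra⟩
      have hf := (h2 h).resolve_left hpos.ne'
      have hle := Finset.card_le_card hsub
      have hu : I.upper h ≤ (better (I.prio h) (I.reach (I.toPos M) h) r).card := by omega
      -- The better residents together with r are more than the u(h) places.
      have hex : ∃ x ∈ better (I.prio h) (I.reach (I.toPos M) h) r, x ∉ M.at h := by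
        by_contra! hcon
        have hss : better (I.prio h) (I.reach (I.toPos M) h) r ⊂ M.at h := by
          rw [Finset.ssubset_iff_of_subset hcon]
          exact ⟨r, hra, by simp [mem_better]⟩
        have := Finset.card_lt_card hss
        omega
      obtain ⟨x, hx, hxa⟩ := hex
      rw [mem_better, mem_reach] at hx
      refine h3 x h ⟨hpos.ne', (resPrefers_iff h1).2 ⟨hx.1.1, ?_⟩,
        Or.inr ⟨r, hra, hx.1.1, hr.1, ?_⟩⟩
      · refine lt_of_le_of_ne hx.1.2 (fun e => hxa ((hmem x h).2 ?_))
        exact (toPos_eq_iff hx.1.1).1 e.symm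
      · rw [← prio_eq hx.1.1, ← prio_eq hr.1]
        exact hx.2

theorem ofPos_matching (q : Fin n → ℕ) : I.IsMatching (I.ofPos q) := fun _ _ e =>
  List.mem_of_getElem? e

/-- The position one past the end makes the lookup fail and thus encodes being unmatched. -/
theorem toPos_ofPos (h1 : 1 ≤ q r) (h2 : q r ≤ (I.resPref r).length + 1) :
    I.toPos (I.ofPos q) r = q r := by
  unfold toPos ofPos
  split
  · next e => rw [List.getElem?_eq_none_iff] at e; omega
  · next h e =>
    obtain ⟨h3, h4⟩ := List.getElem?_eq_some_iff.1 e
    unfold rk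
    rw [← h4, (I.resPref_nodup r).idxOf_getElem]
    omega

theorem ofPos_stable (hq : I.StablePos q) : I.IsStable (I.ofPos q) := by
  have hM : I.IsMatching (I.ofPos q) := ofPos_matching q
  have hpos : I.toPos (I.ofPos q) = q := funext fun r => toPos_ofPos (hq.one_le r) (hq.le r)
  have hat : ∀ h, (I.ofPos q).at h =
      chosen (I.prio h) (I.lower h) (I.upper h) (I.reach q h) := by
    intro h
    rw [← hq.at'_eq]
    ext r
    simp only [Assignment.at, Finset.mem_filter, Finset.mem_univ, true_and, mem_at']
    constructor
    · intro e
      have hr := (I.mem_iff r h).1 (hM r h e)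
      exact ⟨hr, by have := (toPos_eq_iff hr).2 e; rwa [hpos] at this⟩
    · rintro ⟨hr, e⟩
      exact (toPos_eq_iff hr).1 (by rwa [hpos])
  have hcard : ∀ h, ¬ (I.reach q h).card < I.lower h →
      I.lower h ≤ ((I.ofPos q).at h).card ∧ ((I.ofPos q).at h).card ≤ I.upper h := by
    intro h hlt
    have := I.lower_le_upper h
    rw [hat, chosen, if_neg hlt, card_top prio_inj]
    omega
  refine ⟨hM, ?_, ?_, ?_⟩
  · intro h
    by_cases hlt : (I.reach q h).card < I.lower h
    · left
      rw [hat, chosen, if_pos hlt, Finset.card_empty]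
    · exact Or.inr (hcard h hlt)
  · rintro r h ⟨h1, h2, h3⟩
    rw [resPrefers_iff hM, hpos] at h2
    have hlt : ¬ (I.reach q h).card < I.lower h := by
      intro hlt
      rw [hat, chosen, if_pos hlt] at h1
      exact h1 rfl
    have hr : r ∈ I.reach q h := mem_reach.2 ⟨h2.1, h2.2.le⟩
    have hnot : r ∉ top (I.prio h) (I.upper h) (I.reach q h) := by
      intro h4
      have h5 : r ∈ I.at' q h := by rw [hq.at'_eq, chosen, if_neg hlt]; exact h4
      have := (mem_at'.1 h5).2
      omega
    rw [hat, chosen, if_neg hlt] at h3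
    rcases h3 with h3 | ⟨r', h4, h5, h6, h7⟩
    · have := card_top_of_notMem prio_inj hr hnot
      omega
    · rw [← prio_eq h5, ← prio_eq h6] at h7
      exact hnot (mem_top_of_lt h4 hr h7)
  · rintro h S ⟨h1, h2, h3⟩
    -- A blocking coalition would reach h and be large enough to have it opened.
    have hsub : S ⊆ I.reach q h := by
      intro x hx
      have := (resPrefers_iff hM).1 (h3 x hx)
      rw [hpos] at this
      exact mem_reach.2 ⟨this.1, this.2.le⟩
    have := Finset.card_le_card hsub
    have := (hcard h (by omega)).1
    have := I.one_le_lower h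
    omega

theorem exists_stable_iff : (∃ M, I.IsStable M) ↔ ∃ q, I.StablePos q :=
  ⟨fun ⟨_, hM⟩ => ⟨_, toPos_stable hM⟩, fun ⟨_, hq⟩ => ⟨_, ofPos_stable hq⟩⟩

/-! ### Tables -/

/-- If every position lies between `t` and `b`, then `h` surely rejects `r`. -/
def SurelyRejects (I : Instance n m) (t b : Fin n → ℕ) (h : Fin m) (r : Fin n) : Prop :=
  (I.reach b h).card < I.lower h ∨ I.upper h ≤ (better (I.prio h) (I.reach t h) r).card

/-- If every position lies between `t` and `b`, then `h` surely accepts `r`. -/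
def SurelyAccepts (I : Instance n m) (t b : Fin n → ℕ) (h : Fin m) (r : Fin n) : Prop :=
  I.lower h ≤ (insert r (I.reach t h)).card ∧
    (better (I.prio h) (I.reach b h) r).card < I.upper h

/-- The bounds `t` and `b` on the position of `r` cannot be improved at `h`. -/
def ClosedAt (I : Instance n m) (t b : Fin n → ℕ) (h : Fin m) (r : Fin n) : Prop :=
  (I.rk r h = t r → ¬ I.SurelyRejects t b h r) ∧ (I.rk r h < b r → ¬ I.SurelyAccepts t b h r)

/-- A pair of bounds on positions, of which the lower one is justified. -/
structure IsTable (I : Instance n m) (t b : Fin n → ℕ) : Prop where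
  one_le : ∀ r, 1 ≤ t r
  le : ∀ r, t r ≤ (I.resPref r).length + 1
  le' : ∀ r, b r ≤ (I.resPref r).length + 1
  justified : ∀ h, ∀ r ∈ I.hosPref h, I.rk r h < t r → I.SurelyRejects t b h r

/-- A pair of bounds on positions that cannot be improved. -/
structure IsStableTable (I : Instance n m) (t b : Fin n → ℕ) : Prop extends IsTable I t b where
  t_le_b : ∀ r, t r ≤ b r
  closed : ∀ h, ∀ r ∈ I.hosPref h, I.ClosedAt t b h r

/-- Each resident of X whose position is on the list is at exactly one hospital. This turns local
counts into global ones. -/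
theorem sum_card_at' (X : Finset (Fin n)) (h1 : ∀ r, 1 ≤ p r ∨ r ∉ X) :
    ∑ h, (X ∩ I.at' p h).card = (X.filter (fun r => p r ≤ (I.resPref r).length)).card := by
  rw [← Finset.card_biUnion]
  · congr 1
    ext r
    simp only [Finset.mem_biUnion, Finset.mem_univ, true_and, Finset.mem_inter, Finset.mem_filter,
      mem_at']
    constructor
    · rintro ⟨h, h2, h3, h4⟩
      exact ⟨h2, h4 ▸ rk_le_length h3⟩
    · rintro ⟨h2, h3⟩
      have h4 := (h1 r).resolve_right (fun h => h h2)
      have h5 : p r - 1 < (I.resPref r).length := by omega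
      refine ⟨(I.resPref r)[p r - 1], h2, (I.mem_iff _ _).1 (List.getElem_mem h5), ?_⟩
      unfold rk
      rw [(I.resPref_nodup r).idxOf_getElem]
      omega
  · intro h _ h' _ hne
    rw [Function.onFun, Finset.disjoint_left]
    intro r hr hr'
    rw [Finset.mem_inter, mem_at'] at hr hr'
    exact hne (rk_inj hr.2.1 (hr.2.2.symm.trans hr'.2.2))

theorem IsStableTable.stableAt (H : I.IsStableTable t b) (hl : I.lower h ≤ 2) :
    StableAt (I.prio h) (I.lower h) (I.upper h) (I.reach t h) (I.at' t h) (I.reach b h)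
      (I.at' b h) where
  inj := prio_inj
  one_le := I.one_le_lower h
  le_two := hl
  le := I.lower_le_upper h
  sub := reach_mono H.t_le_b
  subF := fun r hr => by rw [mem_at'] at hr; exact mem_reach.2 ⟨hr.1, hr.2.ge⟩
  passed := fun r hr h1 h2 => by
    rw [mem_at'] at *
    rw [mem_reach] at hr
    have := H.t_le_b r
    exact h1 ⟨hr.1, by omega⟩
  mem_first := fun r hr => by
    rw [mem_reach] at hr
    rw [mem_at']
    constructor
    · intro h1
      have := (H.closed h r hr.1).1 h1.2.symm
      unfold SurelyRejects at this
      omega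
    · intro h1
      refine ⟨hr.1, ?_⟩
      by_contra h2
      have := H.justified h r hr.1 (by omega)
      unfold SurelyRejects at this
      omega
  mem_last := fun r hr h1 h2 => by
    rw [mem_reach] at hr
    rw [mem_at']
    refine ⟨hr.1, ?_⟩
    by_contra h3
    exact (H.closed h r hr.1).2 (by omega) ⟨h1, h2⟩

/-- Since t ≤ b, at least as many residents are matched under t as under b, while at each hospital
the comparison goes the other way. So equality holds at every hospital. -/
theorem IsStableTable.card_at' (H : I.IsStableTable t b) (hl : ∀ h, I.lower h ≤ 2) (h : Fin m) :
    (I.at' t h).card = (I.at' b h).card := by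
  have h1 := sum_card_at' (I := I) (p := t) Finset.univ (fun r => Or.inl (H.one_le r))
  have h2 := sum_card_at' (I := I) (p := b) Finset.univ
    (fun r => Or.inl ((H.one_le r).trans (H.t_le_b r)))
  simp only [Finset.univ_inter] at h1 h2
  have h3 : (Finset.univ.filter (fun r => b r ≤ (I.resPref r).length)).card ≤
      (Finset.univ.filter (fun r => t r ≤ (I.resPref r).length)).card := by
    apply Finset.card_le_card
    intro r
    simp only [Finset.mem_filter, Finset.mem_univ, true_and]
    exact (H.t_le_b r).trans
  have h4 : ∀ h ∈ Finset.univ, (I.at' t h).card ≤ (I.at' b h).card :=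
    fun h _ => (H.stableAt (hl h)).card_le
  have h5 := Finset.sum_le_sum h4
  exact (Finset.sum_eq_sum_iff_of_le h4).1 (by omega) h (Finset.mem_univ h)

/-- Moving a stable matching into the bounds of a stable table results in a stable matching. -/
theorem IsStableTable.clamp (H : I.IsStableTable t b) (hl : ∀ h, I.lower h ≤ 2)
    (hq : I.StablePos q) : I.StablePos (fun r => max (t r) (min (q r) (b r))) := by
  have key : ∀ h, _ := fun h =>
    (H.stableAt (hl h)).card_exchange (P₂ := I.reach q h) (H.card_at' hl h)
  have key2 : ∀ h, _ := fun h =>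
    (H.stableAt (hl h)).mem_median (P₂ := I.reach q h) (H.card_at' hl h)
  simp only [← hq.at'_eq] at key key2
  -- The four sets of the exchange inequality are the residents with t r < q r at their t- or
  -- q-hospital, and those with q r < b r at their q- or b-hospital.
  have e1 : ∀ h, (I.at' t h ∩ I.reach q h) \ I.at' q h =
      Finset.univ.filter (fun r => t r < q r) ∩ I.at' t h := by
    intro h
    ext r
    simp only [Finset.mem_sdiff, Finset.mem_inter, mem_at', mem_reach, Finset.mem_filter,
      Finset.mem_univ, true_and]
    grind
  have e2 : ∀ h, (I.at' q h ∩ I.reach b h) \ I.at' b h =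
      Finset.univ.filter (fun r => q r < b r) ∩ I.at' q h := by
    intro h
    ext r
    simp only [Finset.mem_sdiff, Finset.mem_inter, mem_at', mem_reach, Finset.mem_filter,
      Finset.mem_univ, true_and]
    grind
  have e3 : ∀ h, I.at' q h \ I.reach t h =
      Finset.univ.filter (fun r => t r < q r) ∩ I.at' q h := by
    intro h
    ext r
    simp only [Finset.mem_sdiff, Finset.mem_inter, mem_at', mem_reach, Finset.mem_filter,
      Finset.mem_univ, true_and]
    grind
  have e4 : ∀ h, I.at' b h \ I.reach q h =
      Finset.univ.filter (fun r => q r < b r) ∩ I.at' b h := by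
    intro h
    ext r
    simp only [Finset.mem_sdiff, Finset.mem_inter, mem_at', mem_reach, Finset.mem_filter,
      Finset.mem_univ, true_and]
    grind
  have ht := H.one_le
  have hb : ∀ r, 1 ≤ b r := fun r => (H.one_le r).trans (H.t_le_b r)
  have s1 := sum_card_at' (I := I) (p := t) (Finset.univ.filter (fun r => t r < q r))
    (fun r => Or.inl (ht r))
  have s2 := sum_card_at' (I := I) (p := q) (Finset.univ.filter (fun r => q r < b r))
    (fun r => Or.inl (hq.one_le r))
  have s3 := sum_card_at' (I := I) (p := q) (Finset.univ.filter (fun r => t r < q r))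
    (fun r => Or.inl (hq.one_le r))
  have s4 := sum_card_at' (I := I) (p := b) (Finset.univ.filter (fun r => q r < b r))
    (fun r => Or.inl (hb r))
  -- The smaller position is a real one, as the larger one is at most one past the end. So nobody is
  -- missed on the left side, whereas the right side may miss residents that are unmatched at the
  -- worse position.
  have f1 : (Finset.univ.filter (fun r => t r < q r)).filter
      (fun r => t r ≤ (I.resPref r).length) = Finset.univ.filter (fun r => t r < q r) := by
    refine Finset.filter_true_of_mem (fun r hr => ?_)
    have := hq.le r
    rw [Finset.mem_filter] at hr
    omega
  have f2 : (Finset.univ.filter (fun r => q r < b r)).filter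
      (fun r => q r ≤ (I.resPref r).length) = Finset.univ.filter (fun r => q r < b r) := by
    refine Finset.filter_true_of_mem (fun r hr => ?_)
    have := H.le' r
    rw [Finset.mem_filter] at hr
    omega
  rw [f1] at s1
  rw [f2] at s2
  have s5 := Finset.card_filter_le (Finset.univ.filter (fun r => t r < q r))
    (fun r => q r ≤ (I.resPref r).length)
  have s6 := Finset.card_filter_le (Finset.univ.filter (fun r => q r < b r))
    (fun r => b r ≤ (I.resPref r).length)
  have hsum := Finset.sum_le_sum (fun h (_ : h ∈ Finset.univ) => key h)
  have heq := (Finset.sum_eq_sum_iff_of_le (fun h (_ : h ∈ Finset.univ) => key h)).1 (by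
    simp only [e1, e2, e3, e4, Finset.sum_add_distrib] at hsum ⊢
    omega)
  -- Reaching h is a threshold condition, so maximum and minimum of positions become union and
  -- intersection.
  have hreach : ∀ h, I.reach (fun r => max (t r) (min (q r) (b r))) h =
      I.reach t h ∪ (I.reach q h ∩ I.reach b h) := by
    intro h
    ext r
    simp only [Finset.mem_union, Finset.mem_inter, mem_reach]
    grind
  constructor
  · intro r
    exact (ht r).trans (le_max_left _ _)
  · intro r
    have := H.le r
    have := H.le' r
    grind
  · intro h r hr
    rw [hreach] at hr ⊢
    rw [← notMem_chosen hr, ← key2 h (heq h (Finset.mem_univ h)) hr]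
    simp only [Finset.mem_union, Finset.mem_inter, mem_at', mem_reach] at hr ⊢
    have := H.t_le_b r
    grind

/-! ### Half-open hospitals -/

/-- Resident `r` is the only one that surely reaches its first remaining hospital `h`, which needs
two residents. -/
structure HalfOpen (I : Instance n m) (t : Fin n → ℕ) (r : Fin n) (h : Fin m) : Prop where
  mem : r ∈ I.hosPref h
  first : t r = I.rk r h
  lower : I.lower h = 2
  alone : (I.reach t h).card = 1

/-- The last choice at a half-open hospital is made by somebody other than r, so the position of r
is undetermined. As r is among the best residents that possibly reach h, only a lack of residents
can make h reject r. -/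
theorem IsStableTable.halfOpen (H : I.IsStableTable t b) (hl : ∀ h, I.lower h ≤ 2)
    (hr : I.HalfOpen t r h) : t r < b r ∧
      (better (I.prio h) (I.reach b h) r).card < I.upper h := by
  obtain ⟨h1, h2, h3, x, h4, h5, h6⟩ := (H.stableAt (hl h)).halfOpen (H.card_at' hl h)
    (by rw [hr.alone, hr.lower]; omega) (mem_at'.2 ⟨hr.mem, hr.first⟩)
  constructor
  · refine lt_of_le_of_ne (H.t_le_b r) (fun e => ?_)
    have : r ∈ I.at' b h := mem_at'.2 ⟨hr.mem, e ▸ hr.first⟩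
    rw [h5, Finset.mem_singleton] at this
    exact h4 this.symm
  · exact (mem_top.1 (h6 ▸ Finset.mem_insert_self r {x})).2

/-- A position passed by t was surely rejected, hence is rejected under t itself. If t violated the
rule at its current position, then not because of the upper quota; h would need more residents than
surely reach it, and so be half-open. -/
theorem IsStableTable.stablePos (H : I.IsStableTable t b) (hl : ∀ h, I.lower h ≤ 2)
    (hno : ∀ r h, ¬ I.HalfOpen t r h) : I.StablePos t := by
  refine ⟨H.one_le, H.le, ?_⟩
  intro h r hr
  have hr' := mem_reach.1 hr
  have h1 := Finset.card_le_card (reach_mono (I := I) (h := h) H.t_le_b)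
  constructor
  · intro h2
    have := H.justified h r hr'.1 h2
    unfold SurelyRejects at this
    omega
  · intro h2
    by_contra h3
    have h4 : t r = I.rk r h := by omega
    have h5 := (H.closed h r hr'.1).1 h4.symm
    unfold SurelyRejects at h5
    have h6 : (I.reach t h).card < I.lower h := by omega
    have h7 := Finset.card_pos.2 ⟨r, hr⟩
    have h8 := hl h
    exact hno r h ⟨hr'.1, h4, by omega, by omega⟩

/-- If a stable matching in the table does not assign `r` to `h`, then it leaves `h` closed, so that
all other residents are better off than with `h`. -/
theorem StablePos.lt_of_halfOpen (hq : I.StablePos q) (H : I.IsStableTable t b)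
    (hl : ∀ h, I.lower h ≤ 2) (hr : I.HalfOpen t r h) (hb : ∀ r, q r ≤ b r) (hlt : t r < q r)
    {x : Fin n} (hx : x ∈ I.hosPref h) (hxr : x ≠ r) : q x < I.rk x h := by
  by_contra hle
  have h0 := hr.first
  have h1 : r ∈ I.reach q h := mem_reach.2 ⟨hr.mem, by omega⟩
  have h2 : x ∈ I.reach q h := mem_reach.2 ⟨hx, by omega⟩
  -- Both x and r would reach h and meet its lower quota two, and r is good enough for the upper
  -- quota, so r could not have been rejected.
  have h3 := Finset.one_lt_card.2 ⟨x, h2, r, h1, hxr⟩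
  have h4 := (hq.rejected h r h1).1 (by omega)
  have h5 := Finset.card_le_card (better_mono (ρ := I.prio h) (x := r)
    (reach_mono (I := I) (h := h) hb))
  have h6 := (H.halfOpen hl hr).2
  have h7 := hr.lower
  omega

end Instance

/-! ### Tables under improvement -/

namespace Instance

variable {n m : ℕ} {I : Instance n m} {t b t' b' t'' b'' q : Fin n → ℕ} {r x : Fin n} {h g : Fin m}

/-- The bounds `t'` and `b'` are at least as tight as `t` and `b`, and no stable matching within the
latter is lost. -/
structure Refines (I : Instance n m) (t b t' b' : Fin n → ℕ) : Prop where
  t_le : ∀ r, t r ≤ t' r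
  b_le : ∀ r, b' r ≤ b r
  keep : ∀ q, I.StablePos q → (∀ r, t r ≤ q r) → (∀ r, q r ≤ b r) →
    (∀ r, t' r ≤ q r) ∧ ∀ r, q r ≤ b' r

theorem Refines.refl : I.Refines t b t b := ⟨fun _ => le_rfl, fun _ => le_rfl, fun _ _ h h' => ⟨h, h'⟩⟩

theorem Refines.trans (h1 : I.Refines t b t' b') (h2 : I.Refines t' b' t'' b'') :
    I.Refines t b t'' b'' where
  t_le r := (h1.t_le r).trans (h2.t_le r)
  b_le r := (h2.b_le r).trans (h1.b_le r)
  keep q hq ht hb := h2.keep q hq (h1.keep q hq ht hb).1 (h1.keep q hq ht hb).2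

theorem SurelyRejects.mono (H : I.SurelyRejects t b h r) (ht : ∀ r, t r ≤ t' r)
    (hb : ∀ r, b' r ≤ b r) : I.SurelyRejects t' b' h r := by
  have h1 := Finset.card_le_card (reach_mono (I := I) (h := h) hb)
  have h2 := Finset.card_le_card (better_mono (ρ := I.prio h) (x := r)
    (reach_mono (I := I) (h := h) ht))
  unfold SurelyRejects at *
  omega

/-- A resident that asks for h reaches it, which is why r may be counted towards the lower quota in
addition to those that surely reach h. -/
theorem SurelyAccepts.not_rejected (H : I.SurelyAccepts t b h r) (ht : ∀ r, t r ≤ q r)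
    (hb : ∀ r, q r ≤ b r) (hr : r ∈ I.reach q h) : ¬ I.SurelyRejects q q h r := by
  have h1 := Finset.card_le_card (Finset.insert_subset hr (reach_mono (I := I) (h := h) ht))
  have h2 := Finset.card_le_card (better_mono (ρ := I.prio h) (x := r)
    (reach_mono (I := I) (h := h) hb))
  unfold SurelyAccepts SurelyRejects at *
  omega

/-- Sure rejections persist under tighter bounds, so only the newly passed positions need a
justification. -/
theorem IsTable.mono (H : I.IsTable t b) (ht : ∀ r, t r ≤ t' r) (hb : ∀ r, b' r ≤ b r)
    (hle : ∀ r, t' r ≤ (I.resPref r).length + 1)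
    (hj : ∀ h, ∀ r ∈ I.hosPref h, t r ≤ I.rk r h → I.rk r h < t' r → I.SurelyRejects t' b' h r) :
    I.IsTable t' b' where
  one_le r := (H.one_le r).trans (ht r)
  le := hle
  le' r := (hb r).trans (H.le' r)
  justified h r hr hlt := by
    by_cases h1 : I.rk r h < t r
    · exact (H.justified h r hr h1).mono ht hb
    · exact hj h r hr (by omega) hlt

theorem le_update (r : Fin n) : ∀ x, t x ≤ Function.update t r (t r + 1) x := by
  intro x
  by_cases hx : x = r
  · subst hx; simp
  · simp [hx]

theorem update_le {v : ℕ} (hv : v ≤ b r) : ∀ x, Function.update b r v x ≤ b x := by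
  intro x
  by_cases hx : x = r
  · subst hx; simpa
  · simp [hx]

theorem IsTable.raise (H : I.IsTable t b) (hr : r ∈ I.hosPref h) (he : t r = I.rk r h)
    (hs : I.SurelyRejects t b h r) : I.IsTable (Function.update t r (t r + 1)) b := by
  have := rk_le_length hr
  refine H.mono (le_update r) (fun _ => le_rfl) ?_ ?_
  · intro x
    by_cases hx : x = r
    · subst hx; simp; omega
    · simpa [hx] using H.le x
  · intro g x hx h1 h2
    by_cases hxr : x = r
    · subst hxr
      simp at h2
      rw [rk_inj hx (show I.rk x g = I.rk x h by omega)]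
      exact hs.mono (le_update x) (fun _ => le_rfl)
    · simp [hxr] at h2
      omega

theorem refines_raise (hr : r ∈ I.hosPref h) (he : t r = I.rk r h)
    (hs : I.SurelyRejects t b h r) : I.Refines t b (Function.update t r (t r + 1)) b where
  t_le := le_update r
  b_le _ := le_rfl
  keep q hq ht hb := by
    refine ⟨fun x => ?_, hb⟩
    by_cases hx : x = r
    · subst hx
      simp only [Function.update_self]
      have h1 := ht x
      have h2 := (hq.rejected h x (mem_reach.2 ⟨hr, by omega⟩)).2 (hs.mono ht hb)
      omega
    · simpa [hx] using ht x

theorem IsTable.lower (H : I.IsTable t b) {v : ℕ} (hv : v ≤ b r) :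
    I.IsTable t (Function.update b r v) :=
  H.mono (fun _ => le_rfl) (update_le hv) H.le (fun _ _ _ h1 h2 => by omega)

/-- A stable position below h would mean that h rejected r, which sure acceptance excludes. So the
bound can jump to h at once. -/
theorem refines_lower (hr : r ∈ I.hosPref h) (hlt : I.rk r h < b r)
    (hs : I.SurelyAccepts t b h r) : I.Refines t b t (Function.update b r (I.rk r h)) where
  t_le _ := le_rfl
  b_le := update_le hlt.le
  keep q hq ht hb := by
    refine ⟨ht, fun x => ?_⟩
    by_cases hx : x = r
    · subst hx
      simp only [Function.update_self]
      by_contra h1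
      have hm : x ∈ I.reach q h := mem_reach.2 ⟨hr, by omega⟩
      exact hs.not_rejected ht hb hm ((hq.rejected h x hm).1 (by omega))
    · simpa [hx] using hb x

/-- The tests at h see the bounds only through the two sets of residents reaching h and the bounds
of x itself. So h needs to be rescanned only if one of these sets changes or x newly arrives there.
-/
theorem ClosedAt.congr (H : I.ClosedAt t b h x) (h1 : I.reach t' h = I.reach t h)
    (h2 : I.reach b' h = I.reach b h) (h3 : t' x = t x ∨ t' x ≠ I.rk x h) (h4 : b' x ≤ b x) :
    I.ClosedAt t' b' h x := by
  unfold ClosedAt SurelyRejects SurelyAccepts at *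
  rw [h1, h2]
  exact ⟨fun h5 => H.1 (by omega), fun h5 => H.2 (by omega)⟩

theorem reach_update {v : ℕ} (hg : r ∈ I.hosPref g → (I.rk r g ≤ v ↔ I.rk r g ≤ t r)) :
    I.reach (Function.update t r v) g = I.reach t g := by
  ext x
  rw [mem_reach, mem_reach]
  by_cases hx : x = r
  · subst hx
    simp only [Function.update_self]
    exact and_congr_right hg
  · simp [hx]

/-- The only hospital that is affected is the one at the new position, which gains r as a sure
resident. -/
theorem ClosedAt.raise (H : I.ClosedAt t b g x) (hx : x ∈ I.hosPref g)
    (hg : r ∈ I.hosPref g → I.rk r g ≠ t r + 1) :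
    I.ClosedAt (Function.update t r (t r + 1)) b g x := by
  refine H.congr (reach_update (fun h' => ?_)) rfl ?_ le_rfl
  · have := hg h'
    omega
  · by_cases hxr : x = r
    · subst hxr
      right
      simpa [eq_comm] using hg hx
    · simp [hxr]

/-- Only the hospitals strictly below the new bound and not below the old one lose r. -/
theorem ClosedAt.lower {v : ℕ} (H : I.ClosedAt t b g x) (hv : v ≤ b r)
    (hg : r ∈ I.hosPref g → v < I.rk r g → b r < I.rk r g) :
    I.ClosedAt t (Function.update b r v) g x := by
  refine H.congr rfl (reach_update (fun h' => ?_)) (Or.inl rfl) (update_le hv x)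
  have := hg h'
  omega

/-- The number of improvements of the bounds that are still possible. -/
def moves (m : ℕ) {n : ℕ} (t b : Fin n → ℕ) : ℕ := ∑ r, (m + 1 - t r) + ∑ r, b r

theorem moves_raise (h : t r ≤ m) :
    moves m (Function.update t r (t r + 1)) b + 1 = moves m t b := by
  have h1 := Finset.add_sum_erase Finset.univ (fun r => m + 1 - t r) (Finset.mem_univ r)
  have h2 := Finset.add_sum_erase Finset.univ
    (fun x => m + 1 - Function.update t r (t r + 1) x) (Finset.mem_univ r)
  have h3 : ∑ x ∈ Finset.univ.erase r, (m + 1 - Function.update t r (t r + 1) x) =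
      ∑ x ∈ Finset.univ.erase r, (m + 1 - t x) :=
    Finset.sum_congr rfl (fun x hx => by simp [Finset.ne_of_mem_erase hx])
  simp only [Function.update_self] at h1 h2
  unfold moves
  omega

theorem moves_lower (h : 1 ≤ b r) : moves m t (Function.update b r (b r - 1)) + 1 = moves m t b := by
  have h1 := Finset.add_sum_erase Finset.univ b (Finset.mem_univ r)
  have h2 := Finset.add_sum_erase Finset.univ (Function.update b r (b r - 1)) (Finset.mem_univ r)
  have h3 : ∑ x ∈ Finset.univ.erase r, Function.update b r (b r - 1) x =
      ∑ x ∈ Finset.univ.erase r, b x :=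
    Finset.sum_congr rfl (fun x hx => by simp [Finset.ne_of_mem_erase hx])
  simp only [Function.update_self] at h1 h2
  unfold moves
  omega

end Instance

/-! ### A program logic with credits -/

/-- The memory after storing `x` in cell `i` of array `a`. -/
def Memory.set (s : Memory) (a i x : ℕ) : Memory :=
  Function.update s a (Function.update (s a) i x)

theorem Memory.set_apply (s : Memory) (a i x a' j : ℕ) :
    s.set a i x a' j = if a' = a ∧ j = i then x else s a' j := by
  unfold Memory.set
  by_cases h : a' = a
  · subst h
    by_cases h' : j = i <;> simp [h']
  · simp [h]

theorem Memory.set_ne (s : Memory) {a a' : ℕ} (i x : ℕ) (h : a' ≠ a) : s.set a i x a' = s a' :=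
  Function.update_of_ne h _ _

/-- The arrays to which a program writes. -/
def Prog.writes : Prog → List ℕ
  | Prog.skip => []
  | Prog.store a _ _ => [a]
  | Prog.seq p q => p.writes ++ q.writes
  | Prog.ite _ p q => p.writes ++ q.writes
  | Prog.loop _ p => p.writes

theorem Exec.frame {W : ℕ} {p : Prog} {s s' : Memory} {t : ℕ} (h : Exec W p s t s') :
    ∀ a, a ∉ p.writes → s' a = s a := by
  induction h with
  | skip => intros; rfl
  | store a i e s hi he => intro a' h; exact Function.update_of_ne (by simpa [Prog.writes] using h) _ _
  | seq p q s s' s'' t t' _ _ ih1 ih2 =>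
    intro a h
    simp only [Prog.writes, List.mem_append, not_or] at h
    rw [ih2 a h.2, ih1 a h.1]
  | ite_true b p q s s' t _ _ ih =>
    intro a h
    simp only [Prog.writes, List.mem_append, not_or] at h
    exact ih a h.1
  | ite_false b p q s s' t _ _ ih =>
    intro a h
    simp only [Prog.writes, List.mem_append, not_or] at h
    exact ih a h.2
  | loop_true b p s s' s'' t t' _ _ _ ih1 ih2 =>
    intro a h
    rw [ih2 a h, ih1 a h]
  | loop_false => intros; rfl

/-- Started on memory `s` with credit `c`, which pays for the steps, the program `p` halts, and the
remaining credit and the memory satisfy `Q`. -/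
def Runs (W : ℕ) (p : Prog) (s : Memory) (c : ℕ) (Q : ℕ → Memory → Prop) : Prop :=
  ∃ t s' c', Exec W p s t s' ∧ t + c' ≤ c ∧ Q c' s'

namespace Runs

variable {W : ℕ} {p q : Prog} {s : Memory} {c : ℕ} {Q Q' : ℕ → Memory → Prop}

theorem mono (h : Runs W p s c Q) (hQ : ∀ c' s', Q c' s' → Q' c' s') : Runs W p s c Q' := by
  obtain ⟨t, s', c', h1, h2, h3⟩ := h
  exact ⟨t, s', c', h1, h2, hQ _ _ h3⟩

theorem more {c₀ : ℕ} (h : Runs W p s c₀ Q) (hc : c₀ ≤ c) : Runs W p s c Q := by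
  obtain ⟨t, s', c', h1, h2, h3⟩ := h
  exact ⟨t, s', c', h1, h2.trans hc, h3⟩

theorem frame (h : Runs W p s c Q) :
    Runs W p s c (fun c' s' => Q c' s' ∧ ∀ a, a ∉ p.writes → s' a = s a) := by
  obtain ⟨t, s', c', h1, h2, h3⟩ := h
  exact ⟨t, s', c', h1, h2, h3, h1.frame⟩

theorem skip (hc : 1 ≤ c) (hQ : Q (c - 1) s) : Runs W Prog.skip s c Q :=
  ⟨1, s, c - 1, Exec.skip s, by omega, hQ⟩

theorem store {a : ℕ} {i e : Expr} (hi : i.eval s ≤ W) (he : e.eval s ≤ W)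
    (hc : i.cost + e.cost + 1 ≤ c)
    (hQ : Q (c - (i.cost + e.cost + 1)) (s.set a (i.eval s) (e.eval s))) :
    Runs W (Prog.store a i e) s c Q :=
  ⟨_, _, _, Exec.store a i e s hi he, by omega, hQ⟩

theorem seq (h : Runs W p s c (fun c' s' => Runs W q s' c' Q)) : Runs W (Prog.seq p q) s c Q := by
  obtain ⟨t, s', c', h1, h2, t', s'', c'', h3, h4, h5⟩ := h
  exact ⟨_, _, c'', Exec.seq p q s s' s'' t t' h1 h3, by omega, h5⟩

theorem ite {b : Expr} (hc : b.cost + 1 ≤ c)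
    (h1 : b.eval s ≠ 0 → Runs W p s (c - (b.cost + 1)) Q)
    (h2 : b.eval s = 0 → Runs W q s (c - (b.cost + 1)) Q) : Runs W (Prog.ite b p q) s c Q := by
  by_cases hb : b.eval s = 0
  · obtain ⟨t, s', c', h3, h4, h5⟩ := h2 hb
    exact ⟨_, s', c', Exec.ite_false b p q s s' t hb h3, by omega, h5⟩
  · obtain ⟨t, s', c', h3, h4, h5⟩ := h1 hb
    exact ⟨_, s', c', Exec.ite_true b p q s s' t hb h3, by omega, h5⟩

/-- Each test consumes credit, so the credit itself is the termination measure and no further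
variant is required. -/
theorem loop {b : Expr} (Inv : ℕ → Memory → Prop)
    (h : ∀ c s, Inv c s → b.cost + 1 ≤ c ∧
      (b.eval s ≠ 0 → Runs W p s (c - (b.cost + 1)) Inv) ∧
      (b.eval s = 0 → ∃ c₁, c₁ + (b.cost + 1) ≤ c ∧ Q c₁ s)) (h0 : Inv c s) :
    Runs W (Prog.loop b p) s c Q := by
  induction c using Nat.strong_induction_on generalizing s with
  | _ c ih =>
    obtain ⟨h1, h2, h3⟩ := h c s h0
    by_cases hb : b.eval s = 0
    · obtain ⟨c₁, h4, h5⟩ := h3 hb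
      exact ⟨_, s, c₁, Exec.loop_false b p s hb, by omega, h5⟩
    · obtain ⟨t, s', c', h4, h5, h6⟩ := h2 hb
      obtain ⟨t', s'', c'', h7, h8, h9⟩ := ih c' (by omega) h6
      exact ⟨_, s'', c'', Exec.loop_true b p s s' s'' t t' hb h4 h7, by omega, h9⟩

end Runs

/-- A variable: cell `0` of array `x`. -/
def var (x : ℕ) : Expr := Expr.get x (Expr.const 0)

theorem eval_var (x : ℕ) (s : Memory) : (var x).eval s = s x 0 := rfl

theorem cost_var (x : ℕ) : (var x).cost = 2 := rfl

/-- Assignment to a variable. -/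
def assign (x : ℕ) (e : Expr) : Prog := Prog.store x (Expr.const 0) e

/-- Run `p` for all values of the variable `x` that are less than `e`. -/
def forLess (x : ℕ) (e : Expr) (p : Prog) : Prog :=
  Prog.seq (assign x (Expr.const 0)) (Prog.loop (Expr.lt (var x) e)
    (Prog.seq p (assign x (Expr.add (var x) (Expr.const 1)))))

namespace Runs

variable {W : ℕ} {p q : Prog} {s : Memory} {c : ℕ} {Q Q' : ℕ → Memory → Prop}

theorem assign {x : ℕ} {e : Expr} (he : e.eval s ≤ W) (hc : e.cost + 2 ≤ c)
    (hQ : Q (c - (e.cost + 2)) (s.set x 0 (e.eval s))) : Runs W (assign x e) s c Q := by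
  refine Runs.store (by simp [Expr.eval]) he (by simp only [Expr.cost]; omega) ?_
  have : (Expr.const 0).cost + e.cost + 1 = e.cost + 2 := by simp only [Expr.cost]; omega
  rw [this]
  exact hQ

/-- The rule for bounded loops: `D` pays for one execution of the body. -/
theorem forLess {x K D : ℕ} {e : Expr} (J : ℕ → ℕ → Memory → Prop) (hK : K ≤ W)
    (h0 : J 0 c (s.set x 0 0))
    (he : ∀ k c s, k ≤ K → J k c s → s x 0 = k → e.eval s = K)
    (hbody : ∀ k c s, k < K → J k c s → s x 0 = k → Runs W p s (c + D)
      (fun c' s' => s' x 0 = k ∧ J (k + 1) c' (s'.set x 0 (k + 1)))) :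
    Runs W (forLess x e p) s (c + (K * (D + (e.cost + 10)) + (e.cost + 7)))
      (fun c' s' => J K c' s' ∧ s' x 0 = K) := by
  refine Runs.seq (Runs.assign (by simp [Expr.eval]) (by simp only [Expr.cost]; omega) ?_)
  -- Besides the credit c₀ that is passed on, the cost of the K - k remaining iterations and of the
  -- final test is reserved. A test and an increment cost `e.cost + 10`.
  refine Runs.loop (fun c' s' => ∃ k c₀, k ≤ K ∧ J k c₀ s' ∧ s' x 0 = k ∧
    c₀ + ((K - k) * (D + (e.cost + 10)) + (e.cost + 4)) ≤ c') ?_ ?_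
  · rintro c' s' ⟨k, c₀, hk, hJ, hx, hc⟩
    have hee := he k c₀ s' hk hJ hx
    have hcost : (Expr.lt (var x) e).cost + 1 = e.cost + 4 := by
      simp only [Expr.cost, var]; omega
    rw [hcost]
    refine ⟨by omega, ?_, ?_⟩
    · intro hb
      have hlt : k < K := by
        simp only [Expr.eval, var, hx, hee] at hb
        by_contra h
        simp [h] at hb
      have e1 : (K - k) * (D + (e.cost + 10)) =
          (K - (k + 1)) * (D + (e.cost + 10)) + (D + (e.cost + 10)) := by
        rw [show K - k = (K - (k + 1)) + 1 by omega, Nat.succ_mul]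
      have h1 := hbody k c₀ s' hlt hJ hx
      obtain ⟨t, s'', c'', h2, h3, h4, h5⟩ := h1
      refine Runs.seq ⟨t, s'', c'' + ((K - (k + 1)) * (D + (e.cost + 10)) + (e.cost + 10)),
        h2, by omega, ?_⟩
      refine Runs.assign (by simp only [Expr.eval, var, h4]; omega)
        (by simp only [Expr.cost, var]; omega) ?_
      simp only [Expr.eval, var, h4, Expr.cost]
      exact ⟨k + 1, c'', hlt, h5, by simp [Memory.set_apply], by omega⟩
    · intro hb
      have hge : k = K := by
        simp only [Expr.eval, var, hx, hee] at hb
        by_contra h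
        simp [show k < K by omega] at hb
      subst hge
      exact ⟨c₀, by omega, hJ, hx⟩
  · exact ⟨0, c, Nat.zero_le K, by simpa [Expr.eval] using h0, by simp [Memory.set_apply, Expr.eval],
      by simp only [Expr.cost, Nat.sub_zero]; omega⟩

end Runs

set_option linter.unusedSimpArgs false

/-! ### The contents of the memory -/

variable {n m : ℕ}

/-- The input is untouched and array `9` holds the positions of the hospitals on the residents'
lists. -/
structure Ready (I : Instance n m) (s : Memory) : Prop where
  input : ∀ a ≤ 6, s a = I.encode a
  rank : ∀ (r : Fin n) (h : Fin m), r ∈ I.hosPref h → s 9 (r * m + h) = I.rk r h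

theorem length_hosPref_le (I : Instance n m) (h : Fin m) : (I.hosPref h).length ≤ n := by
  simpa using (I.hosPref_nodup h).length_le_card

theorem length_resPref_le (I : Instance n m) (r : Fin n) : (I.resPref r).length ≤ m := by
  simpa using (I.resPref_nodup r).length_le_card

theorem Instance.encode_resList (I : Instance n m) (r : Fin n) {k : ℕ}
    (hk : k < (I.resPref r).length) : I.encode 4 (r * m + k) = ((I.resPref r)[k] : ℕ) := by
  have hkm : k < m := hk.trans_le (length_resPref_le I r)
  have h1 : (r * m + k) / m = r := by
    rw [Nat.mul_comm, Nat.mul_add_div (by omega), Nat.div_eq_of_lt hkm, Nat.add_zero]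
  have h2 : (r * m + k) % m = k := by
    rw [Nat.mul_comm, Nat.mul_add_mod, Nat.mod_eq_of_lt hkm]
  simp [Instance.encode, h1, h2, List.getElem?_eq_getElem hk]

namespace Ready

variable {I : Instance n m} {s s' : Memory} (H : Ready I s)
include H

theorem congr (h : ∀ a ≤ 6, s' a = s a) (h9 : s' 9 = s 9) : Ready I s' where
  input a ha := (h a ha).trans (H.input a ha)
  rank r h hr := by rw [h9, H.rank r h hr]

theorem res_count : s 0 0 = n := by rw [H.input 0 (by omega)]; rfl

theorem hos_count : s 0 1 = m := by rw [H.input 0 (by omega)]; rfl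

theorem lower_eq (h : Fin m) : s 1 h = I.lower h := by
  rw [H.input 1 (by omega)]; simp [Instance.encode]

theorem upper_eq (h : Fin m) : s 2 h = I.upper h := by
  rw [H.input 2 (by omega)]; simp [Instance.encode]

theorem resLen (r : Fin n) : s 3 r = (I.resPref r).length := by
  rw [H.input 3 (by omega)]; simp [Instance.encode]

theorem hosLen (h : Fin m) : s 5 h = (I.hosPref h).length := by
  rw [H.input 5 (by omega)]; simp [Instance.encode]

theorem resList (r : Fin n) {k : ℕ} (hk : k < (I.resPref r).length) :
    s 4 (r * m + k) = ((I.resPref r)[k] : ℕ) := by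
  rw [H.input 4 (by omega), I.encode_resList r hk]

theorem hosList (h : Fin m) {k : ℕ} (hk : k < (I.hosPref h).length) :
    s 6 (h * n + k) = ((I.hosPref h)[k] : ℕ) := by
  have hkm : k < n := hk.trans_le (length_hosPref_le I h)
  have h1 : (h * n + k) / n = h := by
    rw [Nat.mul_comm, Nat.mul_add_div (by omega), Nat.div_eq_of_lt hkm, Nat.add_zero]
  have h2 : (h * n + k) % n = k := by
    rw [Nat.mul_comm, Nat.mul_add_mod, Nat.mod_eq_of_lt hkm]
  rw [H.input 6 (by omega)]
  simp [Instance.encode, h1, h2, List.getElem?_eq_getElem hk]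

/-- When a bound is one past the end of a list, the program reads a cell outside the list. Whatever
it finds there is still the number of a hospital, which is harmless on the stack. -/
theorem resList_lt (hm : 0 < m) (i : ℕ) : s 4 i < m := by
  rw [H.input 4 (by omega)]
  simp only [Instance.encode]
  split_ifs with h
  · split
    · next x _ => exact x.2
    · exact hm
  · exact hm

end Ready

/-- The lower bounds on the positions, in array `10`. -/
def tOf (n : ℕ) (s : Memory) (r : Fin n) : ℕ := s 10 r

/-- The upper bounds on the positions, in array `11`. -/
def bOf (n : ℕ) (s : Memory) (r : Fin n) : ℕ := s 11 r

theorem tOf_set (s : Memory) (r : Fin n) (x : ℕ) :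
    tOf n (s.set 10 r x) = Function.update (tOf n s) r x := by
  ext y
  by_cases h : y = r
  · subst h; simp [tOf, Memory.set_apply]
  · simp [tOf, Memory.set_apply, h, Fin.val_inj]

theorem bOf_set (s : Memory) (r : Fin n) (x : ℕ) :
    bOf n (s.set 11 r x) = Function.update (bOf n s) r x := by
  ext y
  by_cases h : y = r
  · subst h; simp [bOf, Memory.set_apply]
  · simp [bOf, Memory.set_apply, h, Fin.val_inj]

theorem tOf_congr {s s' : Memory} (h : s' 10 = s 10) : tOf n s' = tOf n s := by
  ext r; simp [tOf, h]

theorem bOf_congr {s s' : Memory} (h : s' 11 = s 11) : bOf n s' = bOf n s := by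
  ext r; simp [bOf, h]

/-- A bound on the numbers in use. -/
def cap (n m : ℕ) : ℕ := 4 * (n + 1) * (m + 2)

/-- Hospital `h` is on the stack, which is in array `12`, with its height in array `13`. -/
def OnStack (s : Memory) (h : ℕ) : Prop := ∃ i < s 13 0, s 12 i = h

/-- The number of improvements of the bounds that are still possible. -/
def movesOf (n m : ℕ) (s : Memory) : ℕ := Instance.moves m (tOf n s) (bOf n s)

/-- The memory during the improvement of the bounds. -/
structure Work (I : Instance n m) (s : Memory) : Prop extends Ready I s where
  stack : ∀ i < s 13 0, s 12 i < m
  bound : s 13 0 + movesOf n m s ≤ cap n m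

/-- The credit that is set aside for the stack, at the rate of `A` for each entry, and for future
improvements. -/
def pot (n m A : ℕ) (s : Memory) : ℕ := A * s 13 0 + (A + 100) * movesOf n m s

theorem bOf_le_moves (s : Memory) (r : Fin n) : bOf n s r ≤ movesOf n m s :=
  (Finset.single_le_sum (f := bOf n s) (fun _ _ => Nat.zero_le _) (Finset.mem_univ r)).trans
    (Nat.le_add_left _ _)

theorem Work.congr {I : Instance n m} {s s' : Memory} (H : Work I s)
    (h : ∀ a ≤ 13, a ≠ 7 → a ≠ 8 → s' a = s a) :
    Work I s' where
  input a ha := (h a (by omega) (by omega) (by omega)).trans (H.input a ha)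
  rank r g hr := by rw [h 9 (by omega) (by omega) (by omega), H.rank r g hr]
  stack i hi := by
    rw [h 13 (by omega) (by omega) (by omega)] at hi
    rw [h 12 (by omega) (by omega) (by omega)]
    exact H.stack i hi
  bound := by
    unfold movesOf
    rw [h 13 (by omega) (by omega) (by omega), tOf_congr (h 10 (by omega) (by omega) (by omega)),
      bOf_congr (h 11 (by omega) (by omega) (by omega))]
    exact H.bound

/-! ### Improving one bound -/

open _root_.HRQ.Prog _root_.HRQ.Expr

/-- Put the value of `e` on the stack. -/
def push (e : Expr) : Prog :=
  seq (store 12 (var 13) e) (assign 13 (add (var 13) (const 1)))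

/-- The entry at position `e` of the list of the resident in variable `x`. -/
def entry (x : ℕ) (e : Expr) : Expr :=
  get 4 (add (mul (var x) (get 0 (const 1))) (sub e (const 1)))

theorem eval_entry (x : ℕ) (e : Expr) (s : Memory) :
    (entry x e).eval s = s 4 (s x 0 * s 0 1 + (e.eval s - 1)) := rfl

theorem cost_entry (x : ℕ) (e : Expr) : (entry x e).cost = e.cost + 9 := by
  simp only [entry, Expr.cost, cost_var]
  omega

/-- Lower the upper bound of the resident in variable `19` to the value of variable `25`. -/
def lowerProg : Prog :=
  loop (lt (var 25) (get 11 (var 19)))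
    (seq (push (entry 19 (get 11 (var 19))))
      (store 11 (var 19) (sub (get 11 (var 19)) (const 1))))

/-- Raise the lower bound of the resident in variable `19` by `1`. -/
def raiseProg : Prog :=
  seq (store 10 (var 19) (add (get 10 (var 19)) (const 1))) (push (entry 19 (get 10 (var 19))))

theorem Runs.push {W c : ℕ} {e : Expr} {s : Memory} {Q : ℕ → Memory → Prop} (he : e.eval s ≤ W)
    (hsp : s 13 0 + 1 ≤ W) (hc : e.cost + 9 ≤ c)
    (hQ : Q (c - (e.cost + 9)) ((s.set 12 (s 13 0) (e.eval s)).set 13 0 (s 13 0 + 1))) :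
    Runs W (push e) s c Q := by
  refine Runs.seq (Runs.store ?_ he (by simp only [cost_var, Expr.cost]; omega) ?_)
  · simp only [eval_var, Expr.eval]; omega
  · refine Runs.assign ?_ (by simp only [cost_var, Expr.cost]; omega) ?_
    · simp only [eval_var, Expr.eval, Memory.set_apply]
      simpa using hsp
    · simp only [eval_var, Expr.eval, Memory.set_apply, Expr.cost, cost_var]
      have : c - (2 + e.cost + 1) - (2 + 1 + 1 + 2) = c - (e.cost + 9) := by omega
      rw [this]
      simpa using hQ

theorem onStack_push {s : Memory} {x h : ℕ} :
    OnStack ((s.set 12 (s 13 0) x).set 13 0 (s 13 0 + 1)) h ↔ OnStack s h ∨ h = x := by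
  simp only [OnStack, Memory.set_apply]
  simp
  constructor
  · rintro ⟨i, hi, h⟩
    by_cases hi' : i = s 13 0
    · simp [hi'] at h
      exact Or.inr h.symm
    · simp [hi'] at h
      exact Or.inl ⟨i, by omega, h⟩
  · rintro (⟨i, hi, h⟩ | h)
    · exact ⟨i, by omega, by simp [hi.ne, h]⟩
    · exact ⟨s 13 0, by omega, by simp [h]⟩

section

variable {I : Instance n m} {W A : ℕ} {s : Memory}

/-- The bound goes down in unit steps, and each step puts the abandoned hospital on the stack. A
step releases A + 100 credits of `pot`: A for the new stack entry and 100 for the step. -/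
theorem runs_lower (hW : cap n m ≤ W) (hm : 0 < m) (H : Work I s) (r : Fin n) (hr : s 19 0 = r)
    {e c : ℕ} (hc : pot n m A s + 10 + e ≤ c) :
    Runs W lowerProg s c (fun c' s' => Work I s' ∧ pot n m A s' + e ≤ c' ∧
      bOf n s' = Function.update (bOf n s) r (min (bOf n s r) (s 25 0)) ∧
      (∀ h, OnStack s h → OnStack s' h) ∧
      (∀ h, r ∈ I.hosPref h → s 25 0 < I.rk r h → I.rk r h ≤ bOf n s r → OnStack s' h) ∧
      ∀ a, a ≠ 11 → a ≠ 12 → a ≠ 13 → s' a = s a) := by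
  refine Runs.loop (fun c' s' => Work I s' ∧ pot n m A s' + 10 + e ≤ c' ∧
      (∃ y, bOf n s' = Function.update (bOf n s) r y ∧ y ≤ bOf n s r ∧
        min (bOf n s r) (s 25 0) ≤ y ∧
        (∀ h, r ∈ I.hosPref h → y < I.rk r h → I.rk r h ≤ bOf n s r → OnStack s' h)) ∧
      (∀ h, OnStack s h → OnStack s' h) ∧
      ∀ a, a ≠ 11 → a ≠ 12 → a ≠ 13 → s' a = s a) ?_ ?_
  · rintro c' s' ⟨h1, h2, ⟨y, h3, h4, h5, h6⟩, h7, h8⟩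
    have e19 : s' 19 0 = r := by rw [h8 19 (by omega) (by omega) (by omega), hr]
    have e25 : s' 25 0 = s 25 0 := by rw [h8 25 (by omega) (by omega) (by omega)]
    have e11 : s' 11 r = y := by
      have := congrFun h3 r
      simpa [bOf] using this
    simp only [Expr.eval, Expr.cost, eval_var, cost_var, e19, e25, e11]
    refine ⟨by omega, ?_, ?_⟩
    · intro hlt
      have hlt : s 25 0 < y := by
        by_contra h
        simp [h] at hlt
      have hmv := bOf_le_moves (m := m) s' r
      have hb : bOf n s' r = y := e11
      have hbound := h1.bound
      have hlist := h1.toReady.resList_lt hm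
      have hcapm : m ≤ cap n m := by unfold cap; nlinarith
      have hcapn : n ≤ cap n m := by unfold cap; nlinarith
      -- A positive upper bound means that at least one move is left.
      have hp : 100 ≤ pot n m A s' := by
        have : 1 ≤ movesOf n m s' := by omega
        unfold pot
        nlinarith
      refine Runs.seq (Runs.push ?_ (by omega) (by simp only [cost_entry, cost_var, Expr.cost]; omega) ?_)
      · simp only [eval_entry]
        exact (hlist _).le.trans (hcapm.trans hW)
      have e0 : (entry 19 (get 11 (var 19))).eval s' = s' 4 (r * m + (y - 1)) := by
        simp only [eval_entry, Expr.eval, eval_var, e19, e11, h1.toReady.hos_count]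
      rw [e0]
      generalize hs1 : (s'.set 12 (s' 13 0) (s' 4 (r * m + (y - 1)))).set 13 0 (s' 13 0 + 1) = s₁
      have f1 : ∀ a, a ≠ 12 → a ≠ 13 → s₁ a = s' a := by
        intro a ha hb
        rw [← hs1, Memory.set_ne _ _ _ hb, Memory.set_ne _ _ _ ha]
      have g19 : s₁ 19 0 = r := by rw [f1 19 (by omega) (by omega), e19]
      have g11 : s₁ 11 r = y := by rw [f1 11 (by omega) (by omega), e11]
      have hon : ∀ h, OnStack s₁ h ↔ OnStack s' h ∨ h = s' 4 (r * m + (y - 1)) := by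
        intro h
        rw [← hs1, onStack_push]
      have h13 : s₁ 13 0 = s' 13 0 + 1 := by rw [← hs1]; simp [Memory.set_apply]
      refine Runs.store (by simp only [eval_var, Expr.eval, g19]; omega)
        (by simp only [eval_var, Expr.eval, g19, g11]; omega)
        (by simp only [cost_entry, cost_var, Expr.cost]; omega) ?_
      simp only [eval_var, Expr.eval, g19, g11]
      have hbn : bOf n (s₁.set 11 r (y - 1)) = Function.update (bOf n s') r (bOf n s' r - 1) := by
        rw [bOf_set, bOf_congr (f1 11 (by omega) (by omega)), hb]
      have htn : tOf n (s₁.set 11 r (y - 1)) = tOf n s' := by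
        apply tOf_congr
        rw [Memory.set_ne _ _ _ (by omega), f1 10 (by omega) (by omega)]
      have hmn : movesOf n m (s₁.set 11 r (y - 1)) + 1 = movesOf n m s' := by
        unfold movesOf
        rw [hbn, htn]
        exact Instance.moves_lower (by omega)
      have hspn : (s₁.set 11 r (y - 1)) 13 0 = s' 13 0 + 1 := by
        rw [Memory.set_ne _ _ _ (by omega), h13]
      have hall : ∀ a, a ≠ 11 → a ≠ 12 → a ≠ 13 → (s₁.set 11 r (y - 1)) a = s' a := by
        intro a ha1 ha2 ha3
        rw [Memory.set_ne _ _ _ ha1, f1 a ha2 ha3]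
      have hons : ∀ h, OnStack (s₁.set 11 r (y - 1)) h ↔ OnStack s₁ h := by
        intro h
        unfold OnStack
        rw [Memory.set_ne _ _ _ (by omega), Memory.set_ne _ _ _ (by omega)]
      refine ⟨⟨h1.toReady.congr (fun a ha => hall a (by omega) (by omega) (by omega))
        (hall 9 (by omega) (by omega) (by omega)), ?_, ?_⟩, ?_, ⟨y - 1, ?_, by omega, by omega, ?_⟩,
        ?_, ?_⟩
      · intro i hi
        have : OnStack (s₁.set 11 r (y - 1)) (s₁.set 11 r (y - 1) 12 i) := ⟨i, hi, rfl⟩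
        rw [hons, hon] at this
        rcases this with ⟨j, hj, hj'⟩ | h
        · rw [← hj']
          exact h1.stack j hj
        · rw [h]
          exact hlist _
      · rw [hspn]; omega
      · unfold pot at h2 ⊢
        rw [hspn]
        rw [← hmn] at h2
        simp only [cost_entry, cost_var, Expr.cost]
        rw [Nat.mul_add] at h2 ⊢
        omega
      · rw [hbn, h3]
        simp
      · intro h hrh h9 h10
        rw [hons, hon]
        by_cases h11 : y < I.rk r h
        · exact Or.inl (h6 h hrh h11 h10)
        · right
          have h12 : I.rk r h = y := by omega
          have hmem := (I.mem_iff r h).2 hrh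
          have h13 : y - 1 = (I.resPref r).idxOf h := by
            unfold Instance.rk at h12
            omega
          rw [h13, h1.toReady.resList r (List.idxOf_lt_length_of_mem hmem)]
          simp
      · intro h hh
        rw [hons, hon]
        exact Or.inl (h7 h hh)
      · intro a ha1 ha2 ha3
        rw [hall a ha1 ha2 ha3, h8 a ha1 ha2 ha3]
    · intro hge
      have hge : y ≤ s 25 0 := by
        by_contra h
        simp [show s 25 0 < y by omega] at hge
      refine ⟨pot n m A s' + e, by omega, h1, le_rfl, ?_, h7, ?_, h8⟩
      · rw [h3]
        congr 1
        omega
      · intro h hrh h9 h10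
        exact h6 h hrh (by omega) h10
  · exact ⟨H, hc, ⟨bOf n s r, by simp, le_rfl, by omega, fun h _ h1 h2 => by omega⟩,
      fun _ h => h, fun _ _ _ _ => rfl⟩

/-- The hospital at the new position is put on the stack. As with lowering, the move pays for itself
and for this entry. -/
theorem runs_raise (hW : cap n m ≤ W) (hm : 0 < m) (H : Work I s) (r : Fin n) (hr : s 19 0 = r)
    (ht : tOf n s r ≤ m) {e c : ℕ} (hc : pot n m A s + e ≤ c) :
    Runs W raiseProg s c (fun c' s' => Work I s' ∧ pot n m A s' + e ≤ c' ∧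
      tOf n s' = Function.update (tOf n s) r (tOf n s r + 1) ∧
      (∀ h, OnStack s h → OnStack s' h) ∧
      (∀ h, r ∈ I.hosPref h → I.rk r h = tOf n s r + 1 → OnStack s' h) ∧
      ∀ a, a ≠ 10 → a ≠ 12 → a ≠ 13 → s' a = s a) := by
  have e10 : s 10 r = tOf n s r := rfl
  have hlist := H.toReady.resList_lt hm
  have hcapm : m + 1 ≤ cap n m := by unfold cap; nlinarith
  have hcapn : n ≤ cap n m := by unfold cap; nlinarith
  have hmv := Instance.moves_raise (b := bOf n s) ht
  have hmv' : Instance.moves m (tOf n s) (bOf n s) = movesOf n m s := rfl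
  have hbound := H.bound
  generalize hs1 : s.set 10 r (tOf n s r + 1) = s₁
  have f1 : ∀ a, a ≠ 10 → s₁ a = s a := by
    intro a ha
    rw [← hs1, Memory.set_ne _ _ _ ha]
  have g19 : s₁ 19 0 = r := by rw [f1 19 (by omega), hr]
  have g10 : s₁ 10 r = tOf n s r + 1 := by rw [← hs1]; simp [Memory.set_apply]
  have hR1 : Ready I s₁ := H.toReady.congr (fun a ha => f1 a (by omega)) (f1 9 (by omega))
  have ht1 : tOf n s₁ = Function.update (tOf n s) r (tOf n s r + 1) := by rw [← hs1, tOf_set]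
  have hpot : pot n m A s = A * s 13 0 + (A + 100) *
      Instance.moves m (Function.update (tOf n s) r (tOf n s r + 1)) (bOf n s) + (A + 100) := by
    unfold pot
    rw [← hmv', ← hmv, Nat.mul_add, Nat.mul_one, Nat.add_assoc]
  refine Runs.seq (Runs.store (by simp only [eval_var, Expr.eval, hr]; omega)
    (by simp only [eval_var, Expr.eval, hr, e10]; omega)
    (by simp only [cost_var, Expr.cost]; omega) ?_)
  simp only [eval_var, Expr.eval, hr, e10, hs1]
  have e0 : (entry 19 (get 10 (var 19))).eval s₁ = s₁ 4 (r * m + tOf n s r) := by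
    simp only [eval_entry, Expr.eval, eval_var, g19, g10, hR1.hos_count]
    rfl
  refine Runs.push ?_ (by rw [f1 13 (by omega)]; omega)
    (by simp only [cost_entry, cost_var, Expr.cost]; omega) ?_
  · rw [e0, f1 4 (by omega)]
    exact (hlist _).le.trans (by omega)
  rw [e0]
  generalize hs2 : (s₁.set 12 (s₁ 13 0) (s₁ 4 (r * m + tOf n s r))).set 13 0 (s₁ 13 0 + 1) = s₂
  have f2 : ∀ a, a ≠ 10 → a ≠ 12 → a ≠ 13 → s₂ a = s a := by
    intro a ha1 ha hb
    rw [← hs2, Memory.set_ne _ _ _ hb, Memory.set_ne _ _ _ ha, f1 a ha1]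
  have hon : ∀ h, OnStack s₂ h ↔ OnStack s h ∨ h = s 4 (r * m + tOf n s r) := by
    intro h
    rw [← hs2, onStack_push, f1 4 (by omega)]
    unfold OnStack
    rw [f1 13 (by omega), f1 12 (by omega)]
  have h13 : s₂ 13 0 = s 13 0 + 1 := by
    rw [← hs2, f1 13 (by omega)]; simp [Memory.set_apply]
  have ht2 : tOf n s₂ = Function.update (tOf n s) r (tOf n s r + 1) := by
    rw [← ht1]
    apply tOf_congr
    rw [← hs2, Memory.set_ne _ _ _ (by omega), Memory.set_ne _ _ _ (by omega)]
  have hb2 : bOf n s₂ = bOf n s := bOf_congr (f2 11 (by omega) (by omega) (by omega))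
  refine ⟨⟨H.toReady.congr (fun a ha => f2 a (by omega) (by omega) (by omega))
    (f2 9 (by omega) (by omega) (by omega)), ?_, ?_⟩, ?_, ht2, ?_, ?_, f2⟩
  · intro i hi
    have : OnStack s₂ (s₂ 12 i) := ⟨i, hi, rfl⟩
    rw [hon] at this
    rcases this with ⟨j, hj, hj'⟩ | h
    · rw [← hj']
      exact H.stack j hj
    · rw [h]
      exact hlist _
  · unfold movesOf
    rw [h13, ht2, hb2]
    omega
  · unfold pot at hc ⊢
    rw [← hmv', ← hmv] at hc
    unfold movesOf
    rw [h13, ht2, hb2]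
    simp only [cost_entry, cost_var, Expr.cost]
    rw [Nat.mul_add] at hc ⊢
    omega
  · intro h hh
    exact (hon h).2 (Or.inl hh)
  · intro h hrh h1
    rw [hon]
    right
    have hmem := (I.mem_iff r h).2 hrh
    have h2 : tOf n s r = (I.resPref r).idxOf h := by
      unfold Instance.rk at h1
      omega
    rw [h2, H.toReady.resList r (List.idxOf_lt_length_of_mem hmem)]
    simp

end

/-! ### Scanning the list of a hospital -/

namespace Instance

variable {I : Instance n m} {p t b : Fin n → ℕ} {r : Fin n} {h : Fin m} {k : ℕ}

/-- The residents among the first `k` on the list of `h` that belong to `I.reach p h`. -/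
def reachBelow (I : Instance n m) (p : Fin n → ℕ) (h : Fin m) (k : ℕ) : Finset (Fin n) :=
  (I.reach p h).filter (fun r => I.prio h r < k)

theorem prio_getElem (hk : k < (I.hosPref h).length) : I.prio h (I.hosPref h)[k] = k := by
  rw [prio_eq (List.getElem_mem hk), (I.hosPref_nodup h).idxOf_getElem]

theorem card_reachBelow_succ (hk : k < (I.hosPref h).length) (hr : (I.hosPref h)[k] = r) :
    (I.reachBelow p h (k + 1)).card =
      (I.reachBelow p h k).card + if I.rk r h ≤ p r then 1 else 0 := by
  subst hr
  have hmem := List.getElem_mem hk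
  have hpk := prio_getElem hk
  split_ifs with h1
  · have : I.reachBelow p h (k + 1) = insert (I.hosPref h)[k] (I.reachBelow p h k) := by
      ext x
      simp only [reachBelow, Finset.mem_filter, Finset.mem_insert, mem_reach]
      constructor
      · rintro ⟨h2, h3⟩
        by_cases h4 : I.prio h x = k
        · exact Or.inl (prio_inj (h := h) (I := I) (by rw [h4, hpk]))
        · exact Or.inr ⟨h2, by omega⟩
      · rintro (rfl | ⟨h2, h3⟩)
        · exact ⟨⟨hmem, by omega⟩, by omega⟩
        · exact ⟨h2, by omega⟩
    rw [this, Finset.card_insert_of_notMem]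
    simp [reachBelow, hpk]
  · have : I.reachBelow p h (k + 1) = I.reachBelow p h k := by
      ext x
      simp only [reachBelow, Finset.mem_filter, mem_reach]
      constructor
      · rintro ⟨h2, h3⟩
        refine ⟨h2, ?_⟩
        by_contra h4
        have h5 : x = (I.hosPref h)[k] := prio_inj (h := h) (I := I) (by omega)
        subst h5
        omega
      · rintro ⟨h2, h3⟩
        exact ⟨h2, by omega⟩
    rw [this, Nat.add_zero]

theorem reachBelow_zero : I.reachBelow p h 0 = ∅ := by simp [reachBelow]

theorem reachBelow_length : I.reachBelow p h (I.hosPref h).length = I.reach p h := by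
  unfold reachBelow
  apply Finset.filter_true_of_mem
  intro r hr
  rw [mem_reach] at hr
  rw [prio_eq hr.1]
  exact List.idxOf_lt_length_of_mem hr.1

/-- Thus a running count along the list of h supplies the number of better residents for each entry.
-/
theorem better_getElem (hk : k < (I.hosPref h).length) (hr : (I.hosPref h)[k] = r) :
    better (I.prio h) (I.reach p h) r = I.reachBelow p h k := by
  subst hr
  rw [better, prio_getElem hk, reachBelow]

theorem card_reachBelow_le : (I.reachBelow p h k).card ≤ n :=
  (Finset.card_le_univ _).trans (by simp)

/-- This lets the test for sure acceptance use the total count, corrected by one comparison. -/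
theorem card_insert_reach (hr : r ∈ I.hosPref h) : (insert r (I.reach p h)).card =
    (I.reach p h).card + if p r < I.rk r h then 1 else 0 := by
  split_ifs with h1
  · rw [Finset.card_insert_of_notMem]
    rw [mem_reach]
    omega
  · rw [Finset.insert_eq_of_mem (mem_reach.2 ⟨hr, by omega⟩), Nat.add_zero]

end Instance

/-- Load the resident at position `17` of the list of hospital `18` into variable `19`, and the
position of the hospital on the list of this resident into variable `20`. -/
def loadProg : Prog :=
  seq (assign 19 (get 6 (add (mul (var 18) (get 0 (const 0))) (var 17))))
    (assign 20 (get 9 (add (mul (var 19) (get 0 (const 1))) (var 18))))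

/-- Whether the position in variable `20` is at most the bound in array `a`. -/
def within (a : ℕ) : Expr := lt (var 20) (add (get a (var 19)) (const 1))

/-- Count the residents that surely, or possibly, reach the hospital in variable `18`. -/
def countProg : Prog :=
  seq (assign 21 (const 0)) (seq (assign 22 (const 0))
    (forLess 17 (get 5 (var 18)) (seq loadProg
      (seq (assign 21 (add (var 21) (within 10))) (assign 22 (add (var 22) (within 11)))))))

/-- Whether the hospital in variable `18` surely rejects the resident in variable `19`, for which it
is the first one. -/
def rejectExpr : Expr :=
  mul (eq (get 10 (var 19)) (var 20))
    (add (lt (var 22) (get 1 (var 18))) (lt (get 2 (var 18)) (add (var 23) (const 1))))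

/-- Whether the hospital in variable `18` surely accepts the resident in variable `19`, for which it
is not the last one. -/
def acceptExpr : Expr :=
  mul (lt (var 20) (get 11 (var 19)))
    (mul (lt (get 1 (var 18)) (add (var 21) (add (lt (get 10 (var 19)) (var 20)) (const 1))))
      (lt (var 24) (get 2 (var 18))))

/-- Make all improvements that are possible at the hospital in variable `18`. -/
def scanProg : Prog :=
  seq countProg (seq (assign 23 (const 0)) (seq (assign 24 (const 0))
    (forLess 17 (get 5 (var 18)) (seq loadProg
      (seq (ite rejectExpr raiseProg skip)
      (seq (ite acceptExpr (seq (assign 25 (var 20)) lowerProg) skip)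
      (seq (assign 23 (add (var 23) (within 10))) (assign 24 (add (var 24) (within 11))))))))))

/-- Make all possible improvements. -/
def improveProg : Prog :=
  loop (lt (const 0) (var 13))
    (seq (assign 13 (sub (var 13) (const 1))) (seq (assign 18 (get 12 (var 13))) scanProg))

section

variable {I : Instance n m} {W A : ℕ} {s : Memory} {r : Fin n} {h : Fin m} {k c : ℕ}

theorem le_cap_m : m + 1 ≤ cap n m := by unfold cap; nlinarith

theorem le_cap_n : n + 1 ≤ cap n m := by unfold cap; nlinarith

theorem rk_le (hr : r ∈ I.hosPref h) : I.rk r h ≤ m :=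
  (Instance.rk_le_length hr).trans (length_resPref_le I r)

theorem runs_load {Q : ℕ → Memory → Prop} (hW : cap n m ≤ W) (H : Ready I s) (hh : s 18 0 = h)
    (hk17 : s 17 0 = k) (hk : k < (I.hosPref h).length) (hr : (I.hosPref h)[k] = r)
    (hc : 22 ≤ c) (hQ : Q (c - 22) ((s.set 19 0 r).set 20 0 (I.rk r h))) :
    Runs W loadProg s c Q := by
  have hc1 := le_cap_m (n := n) (m := m)
  have hc2 := le_cap_n (n := n) (m := m)
  have hmem : r ∈ I.hosPref h := hr ▸ List.getElem_mem hk
  have hrm := rk_le hmem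
  have hrn := r.2
  have e1 : (get 6 (add (mul (var 18) (get 0 (const 0))) (var 17))).eval s = r := by
    simp only [Expr.eval, eval_var, hh, hk17, H.res_count]
    rw [H.hosList h hk, hr]
  have e2 : (get 9 (add (mul (var 19) (get 0 (const 1))) (var 18))).eval (s.set 19 0 r) =
      I.rk r h := by
    simp only [Expr.eval, eval_var, Memory.set_apply]
    simp [hh, H.hos_count, H.rank r h hmem]
  refine Runs.seq (Runs.assign (by rw [e1]; omega) (by simp only [Expr.cost, cost_var]; omega) ?_)
  rw [e1]
  refine Runs.assign (by rw [e2]; omega) (by simp only [Expr.cost, cost_var]; omega) ?_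
  rw [e2]
  simp only [Expr.cost, cost_var]
  exact hQ

theorem runs_count (hW : cap n m ≤ W) (H : Ready I s) (hh : s 18 0 = h) {e : ℕ}
    (hc : 70 * (n + 1) + e ≤ c) :
    Runs W countProg s c (fun c' s' => (e ≤ c' ∧ s' 21 0 = (I.reach (tOf n s) h).card ∧
      s' 22 0 = (I.reach (bOf n s) h).card) ∧ ∀ a, a ∉ countProg.writes → s' a = s a) := by
  apply Runs.frame
  have hc1 := le_cap_m (n := n) (m := m)
  have hc2 := le_cap_n (n := n) (m := m)
  have hlen := length_hosPref_le I h
  refine Runs.seq (Runs.assign (by simp [Expr.eval]) (by simp only [Expr.cost]; omega) ?_)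
  refine Runs.seq (Runs.assign (by simp [Expr.eval]) (by simp only [Expr.cost]; omega) ?_)
  simp only [Expr.eval, Expr.cost]
  have hfor := Runs.forLess (W := W) (x := 17) (K := (I.hosPref h).length) (D := 48) (c := e)
    (e := get 5 (var 18)) (s := (s.set 21 0 0).set 22 0 0)
    (p := (seq loadProg
      (seq (assign 21 (add (var 21) (within 10))) (assign 22 (add (var 22) (within 11))))))
    (fun k c s' => e ≤ c ∧ Ready I s' ∧ s' 18 0 = h ∧ s' 10 = s 10 ∧ s' 11 = s 11 ∧
      s' 21 0 = (I.reachBelow (tOf n s) h k).card ∧ s' 22 0 = (I.reachBelow (bOf n s) h k).card)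
    (by omega) ?_ ?_ ?_
  · refine (hfor.more ?_).mono ?_
    · simp only [Expr.cost, cost_var]
      omega
    · rintro c' s' ⟨⟨h1, h2, h3, h4, h5, h6, h7⟩, h8⟩
      rw [Instance.reachBelow_length] at h6 h7
      exact ⟨h1, h6, h7⟩
  · refine ⟨le_rfl, H.congr (fun a ha => ?_) ?_, ?_, ?_, ?_, ?_, ?_⟩
    · rw [Memory.set_ne _ _ _ (by omega), Memory.set_ne _ _ _ (by omega),
        Memory.set_ne _ _ _ (by omega)]
    all_goals simp [Memory.set_ne, Memory.set_apply, hh, Instance.reachBelow_zero]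
  · rintro k c s' hk ⟨h1, h2, h3, h4, h5, h6, h7⟩ h8
    simp only [Expr.eval, eval_var, h3, h2.hosLen]
  · rintro k c s' hk ⟨h1, h2, h3, h4, h5, h6, h7⟩ h8
    obtain ⟨r, hr⟩ : ∃ r, (I.hosPref h)[k] = r := ⟨_, rfl⟩
    have hb1 := Instance.card_reachBelow_succ (p := tOf n s) hk hr
    have hb2 := Instance.card_reachBelow_succ (p := bOf n s) hk hr
    have hb3 := Instance.card_reachBelow_le (I := I) (p := tOf n s) (h := h) (k := k + 1)
    have hb4 := Instance.card_reachBelow_le (I := I) (p := bOf n s) (h := h) (k := k + 1)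
    refine Runs.seq (runs_load hW h2 h3 h8 hk hr (by omega) ?_)
    have et : s' 10 r = tOf n s r := by rw [h4]; rfl
    have eb : s' 11 r = bOf n s r := by rw [h5]; rfl
    refine Runs.seq (Runs.assign ?_ (by simp only [within, Expr.cost, cost_var]; omega) ?_)
    · simp only [within, Expr.eval, eval_var, Memory.set_apply]
      simp [et, h6]
      omega
    refine Runs.assign ?_ (by simp only [within, Expr.cost, cost_var]; omega) ?_
    · simp only [within, Expr.eval, eval_var, Memory.set_apply]
      simp [eb, h7]
      omega
    refine ⟨?_, ?_, h2.congr (fun a ha => ?_) ?_, ?_, ?_, ?_, ?_, ?_⟩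
    · simp [Memory.set_apply, h8]
    · simp only [within, Expr.cost, cost_var]
      omega
    · simp only [Memory.set_ne _ _ _ (show a ≠ 17 by omega), Memory.set_ne _ _ _ (show a ≠ 19 by omega),
        Memory.set_ne _ _ _ (show a ≠ 20 by omega), Memory.set_ne _ _ _ (show a ≠ 21 by omega),
        Memory.set_ne _ _ _ (show a ≠ 22 by omega)]
    · simp [Memory.set_ne]
    · simp [Memory.set_apply, h3]
    · simp [Memory.set_ne, h4]
    · simp [Memory.set_ne, h5]
    · rw [hb1]
      simp [Memory.set_apply, within, Expr.eval, eval_var, h6, et]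
    · rw [hb2]
      simp [Memory.set_apply, within, Expr.eval, eval_var, h7, eb]

end

/-! ### Correctness and cost of a scan and of the improvement loop -/

/-- The memory in the course of a scan of the list of `h`, of which `k` entries are done. -/
structure Scanning (I : Instance n m) (t b : Fin n → ℕ) (h : Fin m) (k : ℕ) (s : Memory) : Prop
    extends Work I s where
  table : I.IsTable (tOf n s) (bOf n s)
  refines : I.Refines t b (tOf n s) (bOf n s)
  reach_t : I.reach (tOf n s) h = I.reach t h
  reach_b : I.reach (bOf n s) h = I.reach b h
  done : ∀ r ∈ I.hosPref h, I.prio h r < k → I.ClosedAt (tOf n s) (bOf n s) h r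
  others : ∀ g : Fin m, g ≠ h → ¬ OnStack s g →
    ∀ r ∈ I.hosPref g, I.ClosedAt (tOf n s) (bOf n s) g r

/-- The memory in the course of improvements: these are possible at hospitals on the stack only. -/
structure Improving (I : Instance n m) (t b : Fin n → ℕ) (s : Memory) : Prop extends Work I s where
  table : I.IsTable (tOf n s) (bOf n s)
  refines : I.Refines t b (tOf n s) (bOf n s)
  closed : ∀ g : Fin m, ¬ OnStack s g → ∀ r ∈ I.hosPref g, I.ClosedAt (tOf n s) (bOf n s) g r

section

variable {I : Instance n m} {W A : ℕ} {s s' : Memory} {r : Fin n} {h : Fin m} {k c : ℕ}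
  {t b : Fin n → ℕ}

theorem Scanning.congr (H : Scanning I t b h k s) (hs : ∀ a ≤ 13, s' a = s a) :
    Scanning I t b h k s' := by
  have et : tOf n s' = tOf n s := tOf_congr (hs 10 (by omega))
  have eb : bOf n s' = bOf n s := bOf_congr (hs 11 (by omega))
  have eo : ∀ g, OnStack s' g ↔ OnStack s g := by
    intro g
    unfold OnStack
    rw [hs 12 (by omega), hs 13 (by omega)]
  refine ⟨H.toWork.congr (fun a ha _ _ => hs a ha), ?_, ?_, ?_, ?_, ?_, ?_⟩
  all_goals simp only [et, eb]
  · exact H.table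
  · exact H.refines
  · exact H.reach_t
  · exact H.reach_b
  · exact H.done
  · intro g hg hgs
    exact H.others g hg (fun h' => hgs ((eo g).2 h'))

/-- A resident that moves past h still reaches h, so raising at h leaves the counts at h valid and
the entries done stay closed. The one other hospital affected is on the stack. -/
theorem Scanning.raise (H : Scanning I t b h k s) (hr : r ∈ I.hosPref h)
    (he : tOf n s r = I.rk r h) (hs : I.SurelyRejects (tOf n s) (bOf n s) h r) (hw : Work I s')
    (ht : tOf n s' = Function.update (tOf n s) r (tOf n s r + 1)) (hb : s' 11 = s 11)
    (ho : ∀ h, OnStack s h → OnStack s' h)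
    (hn : ∀ h, r ∈ I.hosPref h → I.rk r h = tOf n s r + 1 → OnStack s' h) :
    Scanning I t b h k s' := by
  have eb : bOf n s' = bOf n s := bOf_congr hb
  refine ⟨hw, ?_, ?_, ?_, ?_, ?_, ?_⟩
  all_goals simp only [ht, eb]
  · exact H.table.raise hr he hs
  · exact H.refines.trans (Instance.refines_raise hr he hs)
  · rw [Instance.reach_update (fun _ => by omega), H.reach_t]
  · exact H.reach_b
  · intro x hx hxk
    exact (H.done x hx hxk).raise hx (fun _ => by omega)
  · intro g hg hgs x hx
    exact (H.others g hg (fun h' => hgs (ho g h')) x hx).raise hx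
      (fun hrg h' => hgs (hn g hrg h'))

/-- Lowering the bound of r exactly to h keeps r among the residents that possibly reach h, so
nothing changes at h. The hospitals that lose r are on the stack. -/
theorem Scanning.lower (H : Scanning I t b h k s) (hr : r ∈ I.hosPref h)
    (hlt : I.rk r h < bOf n s r) (hs : I.SurelyAccepts (tOf n s) (bOf n s) h r) (hw : Work I s')
    (hb : bOf n s' = Function.update (bOf n s) r (I.rk r h)) (ht : s' 10 = s 10)
    (ho : ∀ h, OnStack s h → OnStack s' h)
    (hn : ∀ g, r ∈ I.hosPref g → I.rk r h < I.rk r g → I.rk r g ≤ bOf n s r → OnStack s' g) :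
    Scanning I t b h k s' := by
  have et : tOf n s' = tOf n s := tOf_congr ht
  refine ⟨hw, ?_, ?_, ?_, ?_, ?_, ?_⟩
  all_goals simp only [et, hb]
  · exact H.table.lower hlt.le
  · exact H.refines.trans (Instance.refines_lower hr hlt hs)
  · exact H.reach_t
  · rw [Instance.reach_update (fun _ => by omega), H.reach_b]
  · intro x hx hxk
    exact (H.done x hx hxk).lower hlt.le (fun _ _ => by omega)
  · intro g hg hgs x hx
    refine (H.others g hg (fun h' => hgs (ho g h')) x hx).lower hlt.le (fun hrg h' => ?_)
    by_contra h''
    exact hgs (hn g hrg h' (by omega))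

/-- Improvements made at h never change the sets of residents that surely or possibly reach h. Hence
the totals counted in advance stay correct, one pass closes h, and the cost beyond what `pot` covers
is linear in n. -/
theorem runs_scan (hW : cap n m ≤ W) (H : Work I s) (hh : s 18 0 = h)
    (hT : I.IsTable (tOf n s) (bOf n s))
    (hcl : ∀ g : Fin m, g ≠ h → ¬ OnStack s g →
      ∀ r ∈ I.hosPref g, I.ClosedAt (tOf n s) (bOf n s) g r) {e : ℕ}
    (hc : pot n m A s + 220 * (n + 1) + e ≤ c) :
    Runs W scanProg s c (fun c' s' => pot n m A s' + e ≤ c' ∧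
      Improving I (tOf n s) (bOf n s) s') := by
  have hm : 0 < m := h.pos
  have hc1 := le_cap_m (n := n) (m := m)
  have hc2 := le_cap_n (n := n) (m := m)
  have hlen := length_hosPref_le I h
  refine Runs.seq ((runs_count (e := pot n m A s + 150 * (n + 1) + e) hW H.toReady hh
    (by omega)).mono ?_)
  rintro c₁ s₁ ⟨⟨h1, h2, h3⟩, h4⟩
  have hfr : ∀ a ≤ 13, s₁ a = s a := by
    intro a ha
    apply h4
    simp [countProg, loadProg, assign, forLess, Prog.writes]
    omega
  have hh1 : s₁ 18 0 = h := by
    rw [h4 18 (by simp [countProg, loadProg, assign, forLess, Prog.writes]), hh]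
  refine Runs.seq (Runs.assign (by simp [Expr.eval]) (by simp only [Expr.cost]; omega) ?_)
  refine Runs.seq (Runs.assign (by simp [Expr.eval]) (by simp only [Expr.cost]; omega) ?_)
  simp only [Expr.eval, Expr.cost]
  have hS0 : Scanning I (tOf n s) (bOf n s) h 0 s :=
    ⟨H, hT, Instance.Refines.refl, rfl, rfl, fun r _ h' => absurd h' (by omega), hcl⟩
  have hpot : ∀ {x y : Memory}, x 13 = y 13 → x 10 = y 10 → x 11 = y 11 →
      pot n m A x = pot n m A y := by
    intro x y e1 e2 e3
    unfold pot movesOf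
    rw [e1, tOf_congr e2, bOf_congr e3]
  have hfor := Runs.forLess (W := W) (x := 17) (K := (I.hosPref h).length) (D := 120)
    (c := pot n m A s + e)
    (e := get 5 (var 18)) (s := (s₁.set 23 0 0).set 24 0 0)
    (p := (seq loadProg
      (seq (ite rejectExpr raiseProg skip)
      (seq (ite acceptExpr (seq (assign 25 (var 20)) lowerProg) skip)
      (seq (assign 23 (add (var 23) (within 10))) (assign 24 (add (var 24) (within 11))))))))
    (fun k c s' => pot n m A s' + e ≤ c ∧ Scanning I (tOf n s) (bOf n s) h k s' ∧ s' 18 0 = h ∧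
      s' 21 0 = (I.reach (tOf n s) h).card ∧ s' 22 0 = (I.reach (bOf n s) h).card ∧
      s' 23 0 = (I.reachBelow (tOf n s) h k).card ∧ s' 24 0 = (I.reachBelow (bOf n s) h k).card)
    (by omega) ?_ ?_ ?_
  · refine (hfor.more ?_).mono ?_
    · simp only [Expr.cost, cost_var]
      omega
    · rintro c' s' ⟨⟨h1, h2, h3⟩, h8⟩
      refine ⟨h1, h2.toWork, h2.table, h2.refines, ?_⟩
      intro g hg x hx
      by_cases hgh : g = h
      · subst hgh
        refine h2.done x hx ?_
        rw [Instance.prio_eq hx]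
        exact List.idxOf_lt_length_of_mem hx
      · exact h2.others g hgh hg x hx
  · have hall : ∀ a ≤ 13, (((s₁.set 23 0 0).set 24 0 0).set 17 0 0) a = s a := by
      intro a ha
      rw [Memory.set_ne _ _ _ (by omega), Memory.set_ne _ _ _ (by omega),
        Memory.set_ne _ _ _ (by omega), hfr a ha]
    refine ⟨?_, hS0.congr hall, ?_, ?_, ?_, ?_, ?_⟩
    · rw [hpot (hall 13 (by omega)) (hall 10 (by omega)) (hall 11 (by omega))]
    all_goals simp [Memory.set_apply, hh1, h2, h3, Instance.reachBelow_zero]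
  · rintro k c s' hk ⟨h1, h2, h3, h4⟩ h8
    simp only [Expr.eval, eval_var, h3, h2.toReady.hosLen]
  · clear hfr hh1 h2 h3 h4 s₁ h1 hS0 hcl hT H hh hc
    rintro k c s' hk ⟨h1, h2, h3, h4, h5, h6, h7⟩ h8
    obtain ⟨r, hr⟩ : ∃ r, (I.hosPref h)[k] = r := ⟨_, rfl⟩
    have hmem : r ∈ I.hosPref h := hr ▸ List.getElem_mem hk
    have hb1 := Instance.card_reachBelow_succ (p := tOf n s) hk hr
    have hb2 := Instance.card_reachBelow_succ (p := bOf n s) hk hr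
    have hb3 := Instance.card_reachBelow_le (I := I) (p := tOf n s) (h := h) (k := k + 1)
    have hb4 := Instance.card_reachBelow_le (I := I) (p := bOf n s) (h := h) (k := k + 1)
    refine Runs.seq (runs_load hW h2.toReady h3 h8 hk hr (by omega) ?_)
    generalize hs2 : (s'.set 19 0 r).set 20 0 (I.rk r h) = s₂
    have hall : ∀ a, a ≠ 19 → a ≠ 20 → s₂ a = s' a := by
      intro a ha hb
      rw [← hs2, Memory.set_ne _ _ _ hb, Memory.set_ne _ _ _ ha]
    have H2 : Scanning I (tOf n s) (bOf n s) h k s₂ :=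
      h2.congr (fun a ha => hall a (by omega) (by omega))
    rw [← hpot (hall 13 (by omega) (by omega)) (hall 10 (by omega) (by omega))
      (hall 11 (by omega) (by omega))] at h1
    have g19 : s₂ 19 0 = r := by rw [← hs2]; simp [Memory.set_apply]
    have g20 : s₂ 20 0 = I.rk r h := by rw [← hs2]; simp [Memory.set_apply]
    rw [← hall 18 (by omega) (by omega)] at h3
    rw [← hall 21 (by omega) (by omega)] at h4
    rw [← hall 22 (by omega) (by omega)] at h5
    rw [← hall 23 (by omega) (by omega)] at h6
    rw [← hall 24 (by omega) (by omega)] at h7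
    rw [← hall 17 (by omega) (by omega)] at h8
    clear hs2 hall h2
    have hcr : rejectExpr.cost = 22 := rfl
    have hca : acceptExpr.cost = 29 := rfl
    -- the first conditional
    have step1 : Runs W (Prog.ite rejectExpr raiseProg skip) s₂ (c + 120 - 22) (fun c' s' =>
        pot n m A s' + e + 70 ≤ c' ∧ Scanning I (tOf n s) (bOf n s) h k s' ∧
        (I.rk r h = tOf n s' r → ¬ I.SurelyRejects (tOf n s') (bOf n s') h r) ∧
        ∀ a, a ≠ 10 → a ≠ 12 → a ≠ 13 → s' a = s₂ a) := by
      have hev : rejectExpr.eval s₂ ≠ 0 ↔ tOf n s₂ r = I.rk r h ∧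
          I.SurelyRejects (tOf n s₂) (bOf n s₂) h r := by
        unfold Instance.SurelyRejects
        rw [Instance.better_getElem hk hr, H2.reach_b]
        have : I.reachBelow (tOf n s₂) h k = I.reachBelow (tOf n s) h k := by
          unfold Instance.reachBelow
          rw [H2.reach_t]
        rw [this]
        simp only [rejectExpr, Expr.eval, eval_var, g19, g20, h3, h5, h6, H2.toReady.lower_eq,
          H2.toReady.upper_eq, show s₂ 10 r = tOf n s₂ r from rfl]
        split_ifs <;> simp <;> omega
      refine Runs.ite (by omega) (fun hb => ?_) (fun hb => ?_)
      · obtain ⟨he, hs⟩ := hev.1 hb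
        have ht : tOf n s₂ r ≤ m := by rw [he]; exact rk_le hmem
        refine (runs_raise (A := A) (e := e + 70) hW hm H2.toWork r g19 ht (by omega)).mono ?_
        rintro c' s₃ ⟨w1, w2, w3, w4, w5, w6⟩
        refine ⟨by omega, H2.raise hmem he hs w1 w3 (w6 11 (by omega) (by omega) (by omega)) w4 w5,
          ?_, w6⟩
        intro h'
        rw [w3] at h'
        simp at h'
        omega
      · refine Runs.skip (by omega) ⟨by omega, H2, ?_, fun _ _ _ _ => rfl⟩
        intro he hs
        exact hev.2 ⟨he.symm, hs⟩ hb
    refine Runs.seq (step1.mono ?_)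
    clear step1
    rintro c₃ s₃ ⟨v1, v2, v3, v4⟩
    rw [← v4 19 (by omega) (by omega) (by omega)] at g19
    rw [← v4 20 (by omega) (by omega) (by omega)] at g20
    rw [← v4 18 (by omega) (by omega) (by omega)] at h3
    rw [← v4 21 (by omega) (by omega) (by omega)] at h4
    rw [← v4 22 (by omega) (by omega) (by omega)] at h5
    rw [← v4 23 (by omega) (by omega) (by omega)] at h6
    rw [← v4 24 (by omega) (by omega) (by omega)] at h7
    rw [← v4 17 (by omega) (by omega) (by omega)] at h8
    clear v4 H2 s₂ h1
    have step2 : Runs W (Prog.ite acceptExpr (seq (assign 25 (var 20)) lowerProg) skip) s₃ c₃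
        (fun c' s' => pot n m A s' + e + 26 ≤ c' ∧ Scanning I (tOf n s) (bOf n s) h k s' ∧
        I.ClosedAt (tOf n s') (bOf n s') h r ∧
        ∀ a, a ≠ 11 → a ≠ 12 → a ≠ 13 → a ≠ 25 → s' a = s₃ a) := by
      have hev : acceptExpr.eval s₃ ≠ 0 ↔ I.rk r h < bOf n s₃ r ∧
          I.SurelyAccepts (tOf n s₃) (bOf n s₃) h r := by
        unfold Instance.SurelyAccepts
        rw [Instance.better_getElem hk hr, Instance.card_insert_reach hmem, v2.reach_t]
        have : I.reachBelow (bOf n s₃) h k = I.reachBelow (bOf n s) h k := by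
          unfold Instance.reachBelow
          rw [v2.reach_b]
        rw [this]
        simp only [acceptExpr, Expr.eval, eval_var, g19, g20, h3, h4, h7, v2.toReady.lower_eq,
          v2.toReady.upper_eq, show s₃ 10 r = tOf n s₃ r from rfl,
          show s₃ 11 r = bOf n s₃ r from rfl]
        split_ifs <;> simp <;> omega
      refine Runs.ite (by omega) (fun hb => ?_) (fun hb => ?_)
      · obtain ⟨hlt, hs⟩ := hev.1 hb
        have hrm := rk_le hmem
        refine Runs.seq (Runs.assign (by rw [eval_var, g20]; omega) (by rw [cost_var]; omega) ?_)
        rw [eval_var, g20, hca, cost_var]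
        generalize hs4 : s₃.set 25 0 (I.rk r h) = s₄
        have w0 : ∀ a, a ≠ 25 → s₄ a = s₃ a := by
          intro a ha
          rw [← hs4, Memory.set_ne _ _ _ ha]
        have w25 : s₄ 25 0 = I.rk r h := by rw [← hs4]; simp [Memory.set_apply]
        have H4 := v2.congr (fun a ha => w0 a (by omega))
        rw [← w0 19 (by omega)] at g19
        have et : tOf n s₄ = tOf n s₃ := tOf_congr (w0 10 (by omega))
        have eb : bOf n s₄ = bOf n s₃ := bOf_congr (w0 11 (by omega))
        rw [← hpot (w0 13 (by omega)) (w0 10 (by omega)) (w0 11 (by omega))] at v1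
        refine (runs_lower (A := A) (e := e + 26) hW hm H4.toWork r g19 (by omega)).mono ?_
        rintro c' s₅ ⟨w1, w2, w3, w4, w5, w6⟩
        rw [w25, eb, min_eq_right hlt.le] at w3
        rw [w25] at w5
        have et5 : tOf n s₅ = tOf n s₃ :=
          (tOf_congr (w6 10 (by omega) (by omega) (by omega))).trans et
        refine ⟨by omega, H4.lower hmem (by rw [eb]; exact hlt) (by rw [et, eb]; exact hs) w1
          (by rw [eb]; exact w3) (w6 10 (by omega) (by omega) (by omega)) w4 w5, ⟨?_, ?_⟩, ?_⟩
        -- Lowering to h leaves the residents reaching h as they were, so the test for rejection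
        -- made before it keeps its outcome.
        · intro h' hrej
          rw [et5] at h' hrej
          refine v3 h' ?_
          unfold Instance.SurelyRejects at hrej ⊢
          rwa [w3, Instance.reach_update (fun _ => by omega)] at hrej
        · intro h'
          rw [w3] at h'
          simp at h'
        · intro a a1 a2 a3 a4
          rw [w6 a a1 a2 a3, w0 a a4]
      · refine Runs.skip (by omega) ⟨by omega, v2, ⟨v3, ?_⟩, fun _ _ _ _ _ => rfl⟩
        intro he hs
        exact hev.2 ⟨he, hs⟩ hb
    refine Runs.seq (step2.mono ?_)
    clear step2
    rintro c₄ s₄ ⟨u1, u2, u3, u4⟩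
    rw [← u4 19 (by omega) (by omega) (by omega) (by omega)] at g19
    rw [← u4 20 (by omega) (by omega) (by omega) (by omega)] at g20
    rw [← u4 18 (by omega) (by omega) (by omega) (by omega)] at h3
    rw [← u4 21 (by omega) (by omega) (by omega) (by omega)] at h4
    rw [← u4 22 (by omega) (by omega) (by omega) (by omega)] at h5
    rw [← u4 23 (by omega) (by omega) (by omega) (by omega)] at h6
    rw [← u4 24 (by omega) (by omega) (by omega) (by omega)] at h7
    rw [← u4 17 (by omega) (by omega) (by omega) (by omega)] at h8
    have q1 : I.rk r h ≤ s₄ 10 r ↔ I.rk r h ≤ tOf n s r := by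
      have e1 : r ∈ I.reach (tOf n s₄) h ↔ r ∈ I.reach (tOf n s) h := by rw [u2.reach_t]
      simp only [Instance.mem_reach, hmem, true_and] at e1
      exact e1
    have q2 : I.rk r h ≤ s₄ 11 r ↔ I.rk r h ≤ bOf n s r := by
      have e1 : r ∈ I.reach (bOf n s₄) h ↔ r ∈ I.reach (bOf n s) h := by rw [u2.reach_b]
      simp only [Instance.mem_reach, hmem, true_and] at e1
      exact e1
    have hw10 : (add (var 23) (within 10)).eval s₄ =
        (I.reachBelow (tOf n s) h (k + 1)).card := by
      simp only [within, Expr.eval, eval_var, g19, g20, h6, hb1, Order.lt_add_one_iff, q1]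
    have hw11 : ∀ x, (add (var 24) (within 11)).eval (s₄.set 23 0 x) =
        (I.reachBelow (bOf n s) h (k + 1)).card := by
      intro x
      simp only [within, Expr.eval, eval_var, Memory.set_apply]
      simp [g19, g20, h7, hb2, Order.lt_add_one_iff, q2]
    refine Runs.seq (Runs.assign (by rw [hw10]; omega)
      (by simp only [within, Expr.cost, cost_var]; omega) ?_)
    refine Runs.assign (by rw [hw11]; omega) (by simp only [within, Expr.cost, cost_var]; omega) ?_
    rw [hw10, hw11]
    generalize hs5 : ((s₄.set 23 0 (I.reachBelow (tOf n s) h (k + 1)).card).set 24 0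
      (I.reachBelow (bOf n s) h (k + 1)).card) = s₅
    have p0 : ∀ a, a ≠ 23 → a ≠ 24 → a ≠ 17 → (s₅.set 17 0 (k + 1)) a = s₄ a := by
      intro a ha1 ha2 ha3
      rw [Memory.set_ne _ _ _ ha3, ← hs5, Memory.set_ne _ _ _ ha2, Memory.set_ne _ _ _ ha1]
    have H5 := u2.congr (fun a ha => p0 a (by omega) (by omega) (by omega))
    have et5 : tOf n (s₅.set 17 0 (k + 1)) = tOf n s₄ :=
      tOf_congr (p0 10 (by omega) (by omega) (by omega))
    have eb5 : bOf n (s₅.set 17 0 (k + 1)) = bOf n s₄ :=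
      bOf_congr (p0 11 (by omega) (by omega) (by omega))
    refine ⟨?_, ?_, ⟨H5.toWork, H5.table, H5.refines, H5.reach_t, H5.reach_b, ?_, H5.others⟩,
      ?_, ?_, ?_, ?_, ?_⟩
    · rw [← hs5]
      simp [Memory.set_apply, h8]
    · rw [hpot (p0 13 (by omega) (by omega) (by omega)) (p0 10 (by omega) (by omega) (by omega))
        (p0 11 (by omega) (by omega) (by omega))]
      simp only [within, Expr.cost, cost_var]
      omega
    · intro x hx hxk
      by_cases hxr : x = r
      · rw [et5, eb5, hxr]
        exact u3
      · refine H5.done x hx ?_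
        have : I.prio h x ≠ k := by
          intro h'
          rw [← Instance.prio_getElem hk, hr] at h'
          exact hxr (Instance.prio_inj h')
        omega
    · rw [p0 18 (by omega) (by omega) (by omega), h3]
    · rw [p0 21 (by omega) (by omega) (by omega), h4]
    · rw [p0 22 (by omega) (by omega) (by omega), h5]
    · rw [← hs5]; simp [Memory.set_apply]
    · rw [← hs5]; simp [Memory.set_apply]

/-- Taking a hospital off the stack releases 240(n + 1) credits, which cover the 220(n + 1) for its
scan and the overhead of the loop. When the stack is empty, no hospital permits an improvement. -/
theorem runs_improve (hW : cap n m ≤ W) (H : Improving I t b s) {e : ℕ}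
    (hc : pot n m (240 * (n + 1)) s + 10 + e ≤ c) :
    Runs W improveProg s c (fun c' s' => (pot n m (240 * (n + 1)) s' + e ≤ c' ∧
      Improving I t b s' ∧ s' 13 0 = 0) ∧ ∀ a, a ∉ improveProg.writes → s' a = s a) := by
  apply Runs.frame
  refine Runs.loop (fun c' s' => pot n m (240 * (n + 1)) s' + 10 + e ≤ c' ∧ Improving I t b s')
    ?_ ⟨hc, H⟩
  rintro c' s' ⟨h1, h2⟩
  simp only [Expr.eval, Expr.cost, eval_var, cost_var]
  refine ⟨by omega, ?_, ?_⟩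
  · intro hb
    have hsp : 0 < s' 13 0 := by
      by_contra h
      simp [h] at hb
    have hbound := h2.bound
    have hlt := h2.stack (s' 13 0 - 1) (by omega)
    have hc1 := le_cap_m (n := n) (m := m)
    obtain ⟨h, hh⟩ : ∃ h : Fin m, s' 12 (s' 13 0 - 1) = h := ⟨⟨_, hlt⟩, rfl⟩
    have hpot0 : pot n m (240 * (n + 1)) s' = 240 * (n + 1) * (s' 13 0 - 1) +
        (240 * (n + 1) + 100) * movesOf n m s' + 240 * (n + 1) := by
      unfold pot
      obtain ⟨x, hx⟩ : ∃ x, s' 13 0 = x + 1 := ⟨s' 13 0 - 1, by omega⟩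
      rw [hx, Nat.add_sub_cancel]
      ring
    refine Runs.seq (Runs.assign (by simp only [Expr.eval, eval_var]; omega)
      (by simp only [Expr.cost, cost_var]; omega) ?_)
    have e1 : (get 12 (var 13)).eval (s'.set 13 0 (s' 13 0 - 1)) = h := by
      simp only [Expr.eval, eval_var, Memory.set_apply]
      simpa using hh
    simp only [Expr.eval, eval_var]
    refine Runs.seq (Runs.assign (by rw [e1]; omega)
      (by simp only [Expr.cost, cost_var]; omega) ?_)
    rw [e1]
    generalize hs1 : (s'.set 13 0 (s' 13 0 - 1)).set 18 0 h = s₁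
    have hall : ∀ a, a ≠ 13 → a ≠ 18 → s₁ a = s' a := by
      intro a ha hb
      rw [← hs1, Memory.set_ne _ _ _ hb, Memory.set_ne _ _ _ ha]
    have g13 : s₁ 13 0 = s' 13 0 - 1 := by rw [← hs1]; simp [Memory.set_apply]
    have g18 : s₁ 18 0 = h := by rw [← hs1]; simp [Memory.set_apply]
    have et : tOf n s₁ = tOf n s' := tOf_congr (hall 10 (by omega) (by omega))
    have eb : bOf n s₁ = bOf n s' := bOf_congr (hall 11 (by omega) (by omega))
    have em : movesOf n m s₁ = movesOf n m s' := by unfold movesOf; rw [et, eb]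
    have hW1 : Work I s₁ := by
      refine ⟨h2.toReady.congr (fun a ha => hall a (by omega) (by omega))
        (hall 9 (by omega) (by omega)), ?_, by omega⟩
      intro i hi
      rw [hall 12 (by omega) (by omega)]
      exact h2.stack i (by omega)
    have hon : ∀ g, OnStack s' g → g ≠ h → OnStack s₁ g := by
      rintro g ⟨i, hi, hg⟩ hgh
      have hi' : i ≠ s' 13 0 - 1 := by
        rintro rfl
        exact hgh (hg.symm.trans hh)
      refine ⟨i, by omega, ?_⟩
      rw [hall 12 (by omega) (by omega), hg]
    refine (runs_scan (A := 240 * (n + 1)) (e := 10 + e) hW hW1 g18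
      (by rw [et, eb]; exact h2.table) ?_ ?_).mono ?_
    · intro g hg hgs x hx
      rw [et, eb]
      exact h2.closed g (fun h' => hgs (hon g h' (fun h' => hg (Fin.ext h')))) x hx
    · unfold pot
      rw [g13, em]
      simp only [Expr.cost, cost_var]
      omega
    · rintro c₂ s₂ ⟨h3, h4⟩
      refine ⟨by omega, h4.toWork, h4.table, ?_, h4.closed⟩
      have := h4.refines
      rw [et, eb] at this
      exact h2.refines.trans this
  · intro hb
    have hsp : s' 13 0 = 0 := by
      by_contra h
      simp [show 0 < s' 13 0 by omega] at hb
    exact ⟨pot n m (240 * (n + 1)) s' + e, by omega, le_rfl, h2, hsp⟩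

end

/-! ### Closing and opening a half-open hospital -/

namespace Instance

variable {I : Instance n m} {t b t' b' : Fin n → ℕ} {r : Fin n} {h : Fin m} {k : ℕ}

theorem exists_rk (h1 : 1 ≤ k) (h2 : k ≤ (I.resPref r).length) :
    ∃ h, r ∈ I.hosPref h ∧ I.rk r h = k ∧ (I.resPref r)[k - 1]? = some h := by
  have h3 : k - 1 < (I.resPref r).length := by omega
  refine ⟨(I.resPref r)[k - 1], (I.mem_iff _ _).1 (List.getElem_mem h3), ?_,
    List.getElem?_eq_getElem h3⟩
  unfold rk
  rw [(I.resPref_nodup r).idxOf_getElem]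
  omega

theorem HalfOpen.not_mem_reach (H : I.HalfOpen t r h) {x : Fin n} (hx : x ≠ r) :
    x ∉ I.reach t h := by
  intro h'
  obtain ⟨y, hy⟩ := Finset.card_eq_one.1 H.alone
  have hr : r ∈ I.reach t h := mem_reach.2 ⟨H.mem, H.first.ge⟩
  rw [hy, Finset.mem_singleton] at h' hr
  exact hx (h'.trans hr.symm)

/-- The bounds on the positions when `h` is closed, at which `r` is alone. -/
structure Closing (I : Instance n m) (t b : Fin n → ℕ) (r : Fin n) (h : Fin m)
    (t' b' : Fin n → ℕ) : Prop where
  t_self : t' r = t r + 1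
  t_ne : ∀ x, x ≠ r → t' x = t x
  b_self : b' r = b r
  b_mem : ∀ x, x ≠ r → x ∈ I.hosPref h → b' x = min (b x) (I.rk x h - 1)
  b_ne : ∀ x, x ∉ I.hosPref h → b' x = b x

namespace Closing

variable (C : I.Closing t b r h t' b')
include C

theorem t_le (x : Fin n) : t x ≤ t' x := by
  by_cases hx : x = r
  · subst hx
    rw [C.t_self]
    omega
  · rw [C.t_ne x hx]

theorem b_le (x : Fin n) : b' x ≤ b x := by
  by_cases hx : x = r
  · subst hx
    rw [C.b_self]
  · by_cases hm : x ∈ I.hosPref h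
    · rw [C.b_mem x hx hm]
      exact min_le_left _ _
    · rw [C.b_ne x hm]

theorem card_reach_le : (I.reach b' h).card ≤ 1 := by
  have : I.reach b' h ⊆ {r} := by
    intro x hx
    rw [mem_reach] at hx
    rw [Finset.mem_singleton]
    by_contra hne
    have := one_le_rk (I := I) (r := x) (h := h)
    rw [C.b_mem x hne hx.1] at hx
    omega
  simpa using Finset.card_le_card this

/-- After the bounds of the others are cut off above h, at most r can reach it, which is fewer than
two. So the step of r past h is justified afterwards. -/
theorem isTable (H : I.IsTable t b) (hr : I.HalfOpen t r h) : I.IsTable t' b' := by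
  refine H.mono C.t_le C.b_le (fun x => ?_) (fun g x hx h1 h2 => ?_)
  · by_cases hx : x = r
    · subst hx
      have := rk_le_length hr.mem
      rw [C.t_self, hr.first]
      omega
    · rw [C.t_ne x hx]
      exact H.le x
  · by_cases hxr : x = r
    · subst hxr
      have h3 := C.t_self
      have h4 := hr.first
      obtain rfl := rk_inj hx (show I.rk x g = I.rk x h by omega)
      left
      have := C.card_reach_le
      rw [hr.lower]
      omega
    · rw [C.t_ne x hxr] at h2
      omega

/-- Closing h makes no improvement at h possible: r alone does not meet the lower quota, and for the
others h lies outside the bounds. So h itself need not be put on the stack. -/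
theorem closedAt (hr : I.HalfOpen t r h) {x : Fin n} (hx : x ∈ I.hosPref h) :
    I.ClosedAt t' b' h x := by
  by_cases hxr : x = r
  · subst hxr
    have h1 := C.t_self
    have h2 := hr.first
    refine ⟨fun h' => by omega, fun _ hs => ?_⟩
    have h3 := hs.1
    have h4 : insert x (I.reach t' h) ⊆ {x} := by
      intro y hy
      rw [Finset.mem_singleton]
      by_contra hne
      rw [Finset.mem_insert] at hy
      have h5 := hr.not_mem_reach hne
      rw [mem_reach, ← C.t_ne y hne, ← mem_reach] at h5
      exact hy.elim hne h5
    have h6 := Finset.card_le_card h4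
    rw [Finset.card_singleton] at h6
    have h7 := hr.lower
    omega
  · have h1 := hr.not_mem_reach hxr
    rw [mem_reach] at h1
    refine ⟨fun h' => ?_, fun h' => ?_⟩
    · rw [C.t_ne x hxr] at h'
      exact absurd ⟨hx, h'.le⟩ h1
    · rw [C.b_mem x hxr hx] at h'
      have := one_le_rk (I := I) (r := x) (h := h)
      omega

end Closing

end Instance

/-- Test whether the bounds are consistent. -/
def checkProg : Prog :=
  seq (assign 26 (const 1)) (forLess 16 (get 0 (const 0))
    (assign 26 (mul (var 26) (lt (get 10 (var 16)) (add (get 11 (var 16)) (const 1))))))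

/-- Look for a half-open hospital, and put the successor of the resident there into variable `27`,
or else `0`. -/
def findProg : Prog :=
  seq (assign 27 (const 0)) (forLess 16 (get 0 (const 0))
    (ite (lt (get 10 (var 16)) (add (get 3 (var 16)) (const 1)))
      (seq (assign 18 (entry 16 (get 10 (var 16)))) (seq countProg
        (ite (mul (eq (get 1 (var 18)) (const 2)) (eq (var 21) (const 1)))
          (assign 27 (add (var 16) (const 1))) skip))) skip))

/-- Copy the first cells of array `a` to array `a'`. -/
def copyProg (a a' : ℕ) : Prog :=
  forLess 16 (get 0 (const 0)) (store a' (var 16) (get a (var 16)))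

/-- Assign the resident in variable `27` to the first hospital that it reaches. -/
def openProg : Prog :=
  seq (assign 19 (sub (var 27) (const 1))) (seq (assign 25 (get 10 (var 19))) lowerProg)

/-- Close the first hospital that the resident in variable `27` reaches. -/
def closeProg : Prog :=
  seq (assign 16 (sub (var 27) (const 1))) (seq (assign 18 (entry 16 (get 10 (var 16))))
    (forLess 17 (get 5 (var 18)) (seq loadProg
      (ite (eq (var 19) (var 16)) raiseProg
        (seq (assign 25 (sub (var 20) (const 1))) lowerProg)))))

/-- Write the assignment for the lower bounds into the output. -/
def outputProg : Prog :=
  seq (assign 7 (const 1)) (forLess 16 (get 0 (const 0))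
    (ite (lt (get 10 (var 16)) (add (get 3 (var 16)) (const 1)))
      (store 8 (var 16) (add (entry 16 (get 10 (var 16))) (const 1)))
      (store 8 (var 16) (const 0))))

section

variable {I : Instance n m} {W A : ℕ} {s : Memory} {r : Fin n} {h : Fin m} {c e : ℕ}

theorem Ready.entry_eq (H : Ready I s) (hr : r ∈ I.hosPref h) :
    s 4 (r * m + (I.rk r h - 1)) = h := by
  have hmem := (I.mem_iff r h).2 hr
  unfold Instance.rk
  rw [Nat.add_sub_cancel, H.resList r (List.idxOf_lt_length_of_mem hmem)]
  simp

theorem runs_check (hW : cap n m ≤ W) (H : Ready I s) (hc : 40 * (n + 1) + e ≤ c) :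
    Runs W checkProg s c (fun c' s' => (e ≤ c' ∧ s' 26 0 ≤ 1 ∧
      (s' 26 0 ≠ 0 ↔ ∀ r, tOf n s r ≤ bOf n s r)) ∧
      ∀ a, a ∉ checkProg.writes → s' a = s a) := by
  apply Runs.frame
  have hc2 := le_cap_n (n := n) (m := m)
  refine Runs.seq (Runs.assign (by simp [Expr.eval]; omega) (by simp only [Expr.cost]; omega) ?_)
  simp only [Expr.eval, Expr.cost]
  have hfor := Runs.forLess (W := W) (x := 16) (K := n) (D := 14) (c := e)
    (e := get 0 (const 0)) (s := s.set 26 0 1)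
    (p := assign 26 (mul (var 26) (lt (get 10 (var 16)) (add (get 11 (var 16)) (const 1)))))
    (fun k c s' => e ≤ c ∧ Ready I s' ∧ s' 10 = s 10 ∧ s' 11 = s 11 ∧ s' 26 0 ≤ 1 ∧
      (s' 26 0 ≠ 0 ↔ ∀ r : Fin n, (r : ℕ) < k → tOf n s r ≤ bOf n s r))
    (by omega) ?_ ?_ ?_
  · refine (hfor.more ?_).mono ?_
    · simp only [Expr.cost, cost_var]
      omega
    · rintro c' s' ⟨⟨h1, h2, h3, h4, h5, h6⟩, h7⟩
      refine ⟨h1, h5, h6.trans ⟨fun h' r => h' r r.2, fun h' r _ => h' r⟩⟩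
  · refine ⟨le_rfl, H.congr (fun a ha => ?_) ?_, ?_, ?_, ?_, ?_⟩
    · rw [Memory.set_ne _ _ _ (by omega), Memory.set_ne _ _ _ (by omega)]
    all_goals simp [Memory.set_ne, Memory.set_apply]
  · rintro k c s' hk ⟨h1, h2, h3⟩ h8
    simp only [Expr.eval, h2.res_count]
  · rintro k c s' hk ⟨h1, h2, h3, h4, h5, h6⟩ h7
    have et : s' 10 k = tOf n s ⟨k, hk⟩ := by rw [h3]; rfl
    have eb : s' 11 k = bOf n s ⟨k, hk⟩ := by rw [h4]; rfl
    have hev : (mul (var 26) (lt (get 10 (var 16)) (add (get 11 (var 16)) (const 1)))).eval s' =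
        s' 26 0 * if tOf n s ⟨k, hk⟩ < bOf n s ⟨k, hk⟩ + 1 then 1 else 0 := by
      simp only [Expr.eval, eval_var, h7, et, eb]
    have hle : (s' 26 0 * if tOf n s ⟨k, hk⟩ < bOf n s ⟨k, hk⟩ + 1 then 1 else 0) ≤ 1 := by
      split_ifs <;> omega
    refine Runs.assign (by rw [hev]; omega) (by simp only [Expr.cost, cost_var]; omega) ?_
    rw [hev]
    refine ⟨?_, ?_, h2.congr (fun a ha => ?_) ?_, ?_, ?_, ?_, ?_⟩
    · simp [Memory.set_apply, h7]
    · simp only [Expr.cost, cost_var]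
      omega
    · rw [Memory.set_ne _ _ _ (by omega), Memory.set_ne _ _ _ (by omega)]
    · simp [Memory.set_ne]
    · simp [Memory.set_ne, h3]
    · simp [Memory.set_ne, h4]
    · simpa [Memory.set_apply] using hle
    · simp only [Memory.set_apply]
      simp only [show (26 = 16) = False by simp, false_and, if_false, and_self, if_true,
        mul_ne_zero_iff, h6]
      constructor
      · rintro ⟨h8, h9⟩ r hr
        by_cases hrk : (r : ℕ) = k
        · have : r = ⟨k, hk⟩ := Fin.ext hrk
          subst this
          by_contra h10
          exact h9 (if_neg (by omega))
        · exact h8 r (by omega)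
      · intro h8
        refine ⟨fun r hr => h8 r (by omega), ?_⟩
        have := h8 ⟨k, hk⟩ (Nat.lt_succ_self k)
        rw [if_pos (by omega)]
        omega

theorem runs_copy {a a' : ℕ} (hW : cap n m ≤ W) (H : Ready I s) (ha : 9 < a')
    (hne : a ≠ a') (ha16 : a ≠ 16) (ha16' : a' ≠ 16) (hv : ∀ r : Fin n, s a r ≤ W)
    (hc : 20 * (n + 1) + e ≤ c) :
    Runs W (copyProg a a') s c (fun c' s' => (e ≤ c' ∧ ∀ r : Fin n, s' a' r = s a r) ∧
      ∀ x, x ∉ (copyProg a a').writes → s' x = s x) := by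
  apply Runs.frame
  have hc2 := le_cap_n (n := n) (m := m)
  have hfor := Runs.forLess (W := W) (x := 16) (K := n) (D := 6) (c := e)
    (e := get 0 (const 0)) (s := s) (p := store a' (var 16) (get a (var 16)))
    (fun k c s' => e ≤ c ∧ Ready I s' ∧ s' a = s a ∧
      ∀ r : Fin n, (r : ℕ) < k → s' a' r = s a r)
    (by omega) ?_ ?_ ?_
  · refine (hfor.more ?_).mono ?_
    · simp only [Expr.cost, cost_var]
      omega
    · rintro c' s' ⟨⟨h1, h2, h3, h4⟩, h7⟩
      exact ⟨h1, fun r => h4 r r.2⟩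
  · refine ⟨le_rfl, H.congr (fun a ha => ?_) ?_, ?_, fun r h' => absurd h' (by omega)⟩
    · rw [Memory.set_ne _ _ _ (by omega)]
    · simp [Memory.set_ne]
    · rw [Memory.set_ne _ _ _ ha16]
  · rintro k c s' hk ⟨h1, h2, h3⟩ h8
    simp only [Expr.eval, h2.res_count]
  · rintro k c s' hk ⟨h1, h2, h3, h4⟩ h7
    have hvk := hv ⟨k, hk⟩
    refine Runs.store (by rw [eval_var, h7]; omega)
      (by simpa only [Expr.eval, eval_var, h7, h3] using hvk)
      (by simp only [Expr.cost, cost_var]; omega) ?_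
    simp only [Expr.eval, eval_var, h7, h3]
    refine ⟨?_, ?_, h2.congr (fun x hx => ?_) ?_, ?_, ?_⟩
    · rw [Memory.set_ne _ _ _ ha16'.symm, h7]
    · simp only [Expr.cost, cost_var]
      omega
    · rw [Memory.set_ne _ _ _ (by omega), Memory.set_ne _ _ _ (by omega)]
    · rw [Memory.set_ne _ _ _ (by omega), Memory.set_ne _ _ _ (by omega)]
    · rw [Memory.set_ne _ _ _ ha16, Memory.set_ne _ _ _ hne, h3]
    · intro r hr
      rw [Memory.set_ne _ _ _ ha16', Memory.set_apply]
      by_cases hrk : (r : ℕ) = k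
      · simp [hrk]
      · simp [hrk, h4 r (by omega)]

/-- Only the hospital at the lower bound of a resident can be half-open with it, so one linear count
per resident suffices. -/
theorem runs_find (hW : cap n m ≤ W) (H : Ready I s) (h1 : ∀ r, 1 ≤ tOf n s r)
    (hc : 150 * (n + 1) * (n + 1) + e ≤ c) :
    Runs W findProg s c (fun c' s' => (e ≤ c' ∧
      ((s' 27 0 = 0 ∧ ∀ r h, ¬ I.HalfOpen (tOf n s) r h) ∨
        ∃ r h, I.HalfOpen (tOf n s) r h ∧ s' 27 0 = r + 1)) ∧
      ∀ a, a ∉ findProg.writes → s' a = s a) := by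
  apply Runs.frame
  have hc1 := le_cap_m (n := n) (m := m)
  have hc2 := le_cap_n (n := n) (m := m)
  have hc3 : 150 * (n + 1) ≤ 150 * (n + 1) * (n + 1) := Nat.le_mul_of_pos_right _ (by omega)
  refine Runs.seq (Runs.assign (by simp [Expr.eval]) (by simp only [Expr.cost]; omega) ?_)
  simp only [Expr.eval, Expr.cost]
  have hfor := Runs.forLess (W := W) (x := 16) (K := n) (D := 120 * (n + 1)) (c := e)
    (e := get 0 (const 0)) (s := s.set 27 0 0)
    (p := (ite (lt (get 10 (var 16)) (add (get 3 (var 16)) (const 1)))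
      (seq (assign 18 (entry 16 (get 10 (var 16)))) (seq countProg
        (ite (mul (eq (get 1 (var 18)) (const 2)) (eq (var 21) (const 1)))
          (assign 27 (add (var 16) (const 1))) skip))) skip))
    (fun k c s' => e ≤ c ∧ Ready I s' ∧ s' 10 = s 10 ∧ 
      ((s' 27 0 = 0 ∧ ∀ r : Fin n, (r : ℕ) < k → ∀ h, ¬ I.HalfOpen (tOf n s) r h) ∨
        ∃ r h, I.HalfOpen (tOf n s) r h ∧ s' 27 0 = r + 1))
    (by omega) ?_ ?_ ?_
  · refine (hfor.more ?_).mono ?_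
    · simp only [Expr.cost, cost_var]
      ring_nf at hc ⊢
      omega
    · rintro c' s' ⟨⟨h1, h2, h3, h4⟩, h7⟩
      refine ⟨h1, h4.imp_left (fun h' => ⟨h'.1, fun r => h'.2 r r.2⟩)⟩
  · refine ⟨le_rfl, H.congr (fun a ha => ?_) ?_, ?_, Or.inl ⟨?_, fun r h' => absurd h' (by omega)⟩⟩
    · rw [Memory.set_ne _ _ _ (by omega), Memory.set_ne _ _ _ (by omega)]
    all_goals simp [Memory.set_ne, Memory.set_apply]
  · rintro k c s' hk ⟨h1, h2, h3⟩ h8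
    simp only [Expr.eval, h2.res_count]
  · rintro k c s' hk ⟨h2, h3, h4, h5⟩ h6
    obtain ⟨r, hr⟩ : ∃ r : Fin n, (r : ℕ) = k := ⟨⟨k, hk⟩, rfl⟩
    have et : s' 10 k = tOf n s r := by rw [h4, ← hr]; rfl
    have el : s' 3 k = (I.resPref r).length := by rw [← hr, h3.resLen]
    have hnext : ∀ {c'} {s'' : Memory}, e ≤ c' → (∀ a, a ≤ 16 → s'' a = s' a) →
        ((s'' 27 0 = s' 27 0 ∧ ∀ h, ¬ I.HalfOpen (tOf n s) r h) ∨
        ∃ h, I.HalfOpen (tOf n s) r h ∧ s'' 27 0 = r + 1) →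
        s'' 16 0 = k ∧ e ≤ c' ∧ Ready I (s''.set 16 0 (k + 1)) ∧ (s''.set 16 0 (k + 1)) 10 = s 10 ∧
      (((s''.set 16 0 (k + 1)) 27 0 = 0 ∧
        ∀ r : Fin n, (r : ℕ) < k + 1 → ∀ h, ¬ I.HalfOpen (tOf n s) r h) ∨
        ∃ r h, I.HalfOpen (tOf n s) r h ∧ (s''.set 16 0 (k + 1)) 27 0 = r + 1) := by
      intro c' s'' g1 g2 g3
      refine ⟨by rw [g2 16 le_rfl, h6], g1, h3.congr (fun a ha => ?_) ?_, ?_, ?_⟩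
      · rw [Memory.set_ne _ _ _ (by omega), g2 a (by omega)]
      · rw [Memory.set_ne _ _ _ (by omega), g2 9 (by omega)]
      · rw [Memory.set_ne _ _ _ (by omega), g2 10 (by omega), h4]
      · rw [Memory.set_ne _ _ _ (by omega)]
        rcases g3 with ⟨g3, g4⟩ | ⟨h, g3, g4⟩
        · rw [g3]
          refine h5.imp_left (fun h' => ⟨h'.1, fun x hx => ?_⟩)
          by_cases hxr : x = r
          · rwa [hxr]
          · exact h'.2 x (by have := Fin.val_ne_of_ne hxr; omega)
        · exact Or.inr ⟨r, h, g3, g4⟩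
    refine Runs.ite (by simp only [Expr.cost, cost_var]; omega) (fun hb => ?_) (fun hb => ?_)
    · simp only [Expr.eval, eval_var, h6, et, el] at hb
      have hlt : tOf n s r < (I.resPref r).length + 1 := by
        by_contra h'
        exact hb (if_neg h')
      obtain ⟨h, q1, q2, q3⟩ := Instance.exists_rk (I := I) (r := r) (h1 r) (by omega)
      have e0 : (entry 16 (get 10 (var 16))).eval s' = h := by
        simp only [eval_entry, Expr.eval, eval_var, h6, et, h3.hos_count]
        rw [← q2, ← hr, h3.entry_eq q1]
      refine Runs.seq (Runs.assign (by rw [e0]; omega)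
        (by simp only [cost_entry, Expr.cost, cost_var]; omega) ?_)
      rw [e0]
      have hR : Ready I (s'.set 18 0 h) := h3.congr
        (fun a ha => by rw [Memory.set_ne _ _ _ (by omega)]) (by rw [Memory.set_ne _ _ _ (by omega)])
      refine Runs.seq ((runs_count (h := h) (e := e + 18) hW hR (by simp [Memory.set_apply])
        (by simp only [cost_entry, Expr.cost, cost_var]; omega)).mono ?_)
      rintro c₁ s₁ ⟨⟨g1, g2, -⟩, g3⟩
      rw [show tOf n (s'.set 18 0 h) = tOf n s from
        tOf_congr (by rw [Memory.set_ne _ _ _ (by omega), h4])] at g2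
      have hwr : countProg.writes = [21, 22, 17, 19, 20, 21, 22, 17] := rfl
      rw [hwr] at g3
      have g5 : s₁ 18 0 = h := by
        rw [g3 18 (by simp)]
        simp [Memory.set_apply]
      have g6 : s₁ 1 h = I.lower h := by
        rw [g3 1 (by simp), hR.lower_eq]
      have g7 : s₁ 16 0 = k := by
        rw [g3 16 (by simp), Memory.set_ne _ _ _ (by omega), h6]
      have g8 : ∀ a ≤ 16, s₁ a = s' a := by
        intro a ha
        rw [g3 a (by simp; omega), Memory.set_ne _ _ _ (by omega)]
      refine Runs.ite (by simp only [Expr.cost, cost_var]; omega) (fun hb' => ?_) (fun hb' => ?_)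
      · simp only [Expr.eval, eval_var, g5, g6, g2, mul_ne_zero_iff, ite_ne_right_iff] at hb'
        refine Runs.assign (by simp only [Expr.eval, eval_var, g7]; omega)
          (by simp only [Expr.cost, cost_var]; omega) ?_
        simp only [Expr.cost, cost_var, Expr.eval, eval_var, g7]
        refine hnext (by omega) (fun a ha => ?_) (Or.inr ⟨h, ⟨q1, q2.symm, hb'.1.1, hb'.2.1⟩, ?_⟩)
        · rw [Memory.set_ne _ _ _ (by omega), g8 a ha]
        · simp [Memory.set_apply, hr]
      · simp only [Expr.eval, eval_var, g5, g6, g2] at hb'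
        refine Runs.skip (by simp only [Expr.cost, cost_var]; omega) ?_
        refine hnext (by simp only [Expr.cost, cost_var]; omega) g8 (Or.inl ⟨?_, ?_⟩)
        · rw [g3 27 (by simp), Memory.set_ne _ _ _ (by omega)]
        · intro g hg
          obtain rfl := Instance.rk_inj q1 (q2.trans hg.first)
          rw [hg.lower, hg.alone] at hb'
          simp at hb'
    · simp only [Expr.eval, eval_var, h6, et, el] at hb
      have hge : ¬ tOf n s r < (I.resPref r).length + 1 := by
        intro h'
        simp [h'] at hb
      refine Runs.skip (by simp only [Expr.cost, cost_var]; omega) ?_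
      refine hnext (by simp only [Expr.cost, cost_var]; omega) (fun _ _ => rfl)
        (Or.inl ⟨rfl, fun h hh => hge ?_⟩)
      have := Instance.rk_le_length hh.mem
      rw [hh.first]
      omega

end

/-! ### Opening, closing, output and initialization -/

/-- Enter the positions of the hospitals, the trivial bounds, and all hospitals on the stack. -/
def initProg : Prog :=
  seq (forLess 16 (get 0 (const 0))
    (seq (forLess 17 (get 3 (var 16))
      (store 9 (add (mul (var 16) (get 0 (const 1)))
        (get 4 (add (mul (var 16) (get 0 (const 1))) (var 17)))) (add (var 17) (const 1))))
    (seq (store 10 (var 16) (const 1)) (store 11 (var 16) (add (get 3 (var 16)) (const 1))))))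
  (seq (forLess 16 (get 0 (const 1)) (store 12 (var 16) (var 16)))
    (assign 13 (get 0 (const 1))))

section

variable {I : Instance n m} {W A : ℕ} {s : Memory} {r : Fin n} {h : Fin m} {c e : ℕ}

theorem pot_congr {s s' : Memory} (h10 : s' 10 = s 10) (h11 : s' 11 = s 11) (h13 : s' 13 = s 13) :
    pot n m A s' = pot n m A s := by
  unfold pot movesOf
  rw [h13, tOf_congr h10, bOf_congr h11]

/-- Lowering an upper bound needs no justification in a table, and the hospitals at which it matters
are on the stack. So the improvement can resume from here. -/
theorem runs_open (hW : cap n m ≤ W) (H : Work I s) (T : I.IsStableTable (tOf n s) (bOf n s))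
    (hm : 0 < m) (hr : s 27 0 = r + 1) (hc : pot n m A s + 30 + e ≤ c) :
    Runs W openProg s c (fun c' s' => pot n m A s' + e ≤ c' ∧
      Improving I (tOf n s) (Function.update (bOf n s) r (min (bOf n s r) (tOf n s r))) s') := by
  have hc2 := le_cap_n (n := n) (m := m)
  have hc1 := le_cap_m (n := n) (m := m)
  have ht : s 10 r = tOf n s r := rfl
  have htm : tOf n s r ≤ m + 1 :=
    (T.le r).trans (Nat.succ_le_succ (length_resPref_le I r))
  refine Runs.seq (Runs.assign (by simp only [Expr.eval, eval_var, hr]; omega)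
    (by simp only [Expr.cost, cost_var]; omega) ?_)
  simp only [Expr.eval, eval_var, hr, Nat.add_sub_cancel]
  have e0 : (get 10 (var 19)).eval (s.set 19 0 r) = tOf n s r := by
    simp [Expr.eval, eval_var, Memory.set_apply, ht]
  refine Runs.seq (Runs.assign (by rw [e0]; omega) (by simp only [Expr.cost, cost_var]; omega) ?_)
  rw [e0]
  generalize hs1 : (s.set 19 0 r).set 25 0 (tOf n s r) = s₁
  have hall : ∀ a, a ≠ 19 → a ≠ 25 → s₁ a = s a := by
    intro a ha hb
    rw [← hs1, Memory.set_ne _ _ _ hb, Memory.set_ne _ _ _ ha]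
  have g19 : s₁ 19 0 = r := by rw [← hs1]; simp [Memory.set_apply]
  have g25 : s₁ 25 0 = tOf n s r := by rw [← hs1]; simp [Memory.set_apply]
  have et : tOf n s₁ = tOf n s := tOf_congr (hall 10 (by omega) (by omega))
  have eb : bOf n s₁ = bOf n s := bOf_congr (hall 11 (by omega) (by omega))
  have ep := pot_congr (n := n) (m := m) (A := A) (hall 10 (by omega) (by omega))
    (hall 11 (by omega) (by omega)) (hall 13 (by omega) (by omega))
  refine (runs_lower (A := A) (e := e) hW hm (H.congr (s' := s₁)
    (fun a ha _ _ => hall a (by omega) (by omega))) r g19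
    (by rw [ep]; simp only [Expr.cost, cost_var]; omega)).mono ?_
  rintro c' s' ⟨w1, w2, w3, w4, w5, w6⟩
  rw [eb, g25] at w3
  have et' : tOf n s' = tOf n s := (tOf_congr (w6 10 (by omega) (by omega) (by omega))).trans et
  refine ⟨w2, w1, ?_, ?_, ?_⟩
  all_goals rw [et', w3]
  · exact T.toIsTable.lower (min_le_left _ _)
  · exact Instance.Refines.refl
  · intro g hg x hx
    refine (T.closed g x hx).lower (min_le_left _ _) (fun hrg h' => ?_)
    by_contra h''
    refine hg (w5 g hrg ?_ (by rw [eb]; omega))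
    rw [g25]
    omega

/-- In the middle of the pass the bounds need not form a table, since the step of r past h is
justified only at the end. The invariant therefore describes them entry by entry, and
`Closing.isTable` is applied after the loop. -/
theorem runs_close (hW : cap n m ≤ W) (H : Work I s) (T : I.IsStableTable (tOf n s) (bOf n s))
    (hr : s 27 0 = r + 1) (hh : I.HalfOpen (tOf n s) r h)
    (hc : pot n m A s + 100 * (n + 1) + e ≤ c) :
    Runs W closeProg s c (fun c' s' => pot n m A s' + e ≤ c' ∧
      I.Closing (tOf n s) (bOf n s) r h (tOf n s') (bOf n s') ∧
      Improving I (tOf n s') (bOf n s') s') := by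
  have hm : 0 < m := h.pos
  have hc2 := le_cap_n (n := n) (m := m)
  have hc1 := le_cap_m (n := n) (m := m)
  have ht : s 10 r = tOf n s r := rfl
  have hrh := hh.mem
  have hlen := length_hosPref_le I h
  refine Runs.seq (Runs.assign (by simp only [Expr.eval, eval_var, hr]; omega)
    (by simp only [Expr.cost, cost_var]; omega) ?_)
  simp only [Expr.eval, eval_var, hr, Nat.add_sub_cancel]
  have e0 : (entry 16 (get 10 (var 16))).eval (s.set 16 0 r) = h := by
    simp only [eval_entry, Expr.eval, eval_var, Memory.set_apply]
    simp [ht, H.toReady.hos_count, hh.first, H.toReady.entry_eq hrh]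
  refine Runs.seq (Runs.assign (by rw [e0]; omega)
    (by simp only [cost_entry, Expr.cost, cost_var]; omega) ?_)
  rw [e0]
  have hfor := Runs.forLess (W := W) (x := 17) (K := (I.hosPref h).length) (D := 50)
    (c := pot n m A s + e) (e := get 5 (var 18)) (s := (s.set 16 0 r).set 18 0 h)
    (p := (seq loadProg
      (ite (eq (var 19) (var 16)) raiseProg
        (seq (assign 25 (sub (var 20) (const 1))) lowerProg))))
    (fun k c s' => pot n m A s' + e ≤ c ∧ Work I s' ∧ s' 18 0 = h ∧ s' 16 0 = r ∧
      (∀ x, tOf n s' x = if x = r ∧ I.prio h x < k then tOf n s x + 1 else tOf n s x) ∧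
      (∀ x, bOf n s' x = if x ∈ I.hosPref h ∧ x ≠ r ∧ I.prio h x < k then
        min (bOf n s x) (I.rk x h - 1) else bOf n s x) ∧
      ∀ g : Fin m, g ≠ h → ¬ OnStack s' g →
        ∀ x ∈ I.hosPref g, I.ClosedAt (tOf n s') (bOf n s') g x)
    (by omega) ?_ ?_ ?_
  · refine (hfor.more ?_).mono ?_
    · simp only [cost_entry, Expr.cost, cost_var]
      omega
    · rintro c' s' ⟨⟨h1, h2, h3, h4, h5, h6, h7⟩, h8⟩
      have hp : ∀ x ∈ I.hosPref h, I.prio h x < (I.hosPref h).length := by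
        intro x hx
        rw [Instance.prio_eq hx]
        exact List.idxOf_lt_length_of_mem hx
      have C : I.Closing (tOf n s) (bOf n s) r h (tOf n s') (bOf n s') := by
        refine ⟨?_, ?_, ?_, ?_, ?_⟩
        · rw [h5, if_pos ⟨rfl, hp r hrh⟩]
        · intro x hx
          rw [h5, if_neg (fun h' => hx h'.1)]
        · rw [h6, if_neg (fun h' => h'.2.1 rfl)]
        · intro x hx hm'
          rw [h6, if_pos ⟨hm', hx, hp x hm'⟩]
        · intro x hx
          rw [h6, if_neg (fun h' => hx h'.1)]
      refine ⟨h1, C, h2, C.isTable T.toIsTable hh, Instance.Refines.refl, ?_⟩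
      intro g hg x hx
      by_cases hgh : g = h
      · subst hgh
        exact C.closedAt hh hx
      · exact h7 g hgh hg x hx
  · have hall : ∀ a ≤ 13, (((s.set 16 0 r).set 18 0 h).set 17 0 0) a = s a := by
      intro a ha
      rw [Memory.set_ne _ _ _ (by omega), Memory.set_ne _ _ _ (by omega),
        Memory.set_ne _ _ _ (by omega)]
    have et : tOf n (((s.set 16 0 r).set 18 0 h).set 17 0 0) = tOf n s :=
      tOf_congr (hall 10 (by omega))
    have eb : bOf n (((s.set 16 0 r).set 18 0 h).set 17 0 0) = bOf n s :=
      bOf_congr (hall 11 (by omega))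
    refine ⟨?_, H.congr (fun a ha _ _ => hall a ha), ?_, ?_, ?_, ?_, ?_⟩
    · rw [pot_congr (hall 10 (by omega)) (hall 11 (by omega)) (hall 13 (by omega))]
    · simp [Memory.set_apply]
    · simp [Memory.set_apply]
    · simp [et]
    · simp [eb]
    · intro g _ _ x hx
      rw [et, eb]
      exact T.closed g x hx
  · rintro k c s' hk ⟨h1, h2, h3, h4⟩ h8
    simp only [Expr.eval, eval_var, h3, h2.toReady.hosLen]
  · clear hc
    rintro k c s' hk ⟨h1, h2, h3, h4, h5, h6, h7⟩ h8
    obtain ⟨x, hx⟩ : ∃ x, (I.hosPref h)[k] = x := ⟨_, rfl⟩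
    have hmem : x ∈ I.hosPref h := hx ▸ List.getElem_mem hk
    have hpx : I.prio h x = k := by rw [← hx, Instance.prio_getElem]
    have hne : ∀ y, y ≠ x → (I.prio h y < k + 1 ↔ I.prio h y < k) := by
      intro y hy
      have : I.prio h y ≠ k := by
        intro h'
        rw [← hpx] at h'
        exact hy (Instance.prio_inj h')
      omega
    refine Runs.seq (runs_load hW h2.toReady h3 h8 hk hx (by omega) ?_)
    generalize hs2 : (s'.set 19 0 x).set 20 0 (I.rk x h) = s₂
    have hall : ∀ a, a ≠ 19 → a ≠ 20 → s₂ a = s' a := by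
      intro a ha hb
      rw [← hs2, Memory.set_ne _ _ _ hb, Memory.set_ne _ _ _ ha]
    have H2 : Work I s₂ := h2.congr (fun a ha _ _ => hall a (by omega) (by omega))
    rw [← pot_congr (hall 10 (by omega) (by omega)) (hall 11 (by omega) (by omega))
      (hall 13 (by omega) (by omega))] at h1
    have g19 : s₂ 19 0 = x := by rw [← hs2]; simp [Memory.set_apply]
    have g20 : s₂ 20 0 = I.rk x h := by rw [← hs2]; simp [Memory.set_apply]
    rw [← hall 18 (by omega) (by omega)] at h3
    rw [← hall 16 (by omega) (by omega)] at h4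
    rw [← hall 17 (by omega) (by omega)] at h8
    have hon : ∀ g, OnStack s₂ g ↔ OnStack s' g := by
      intro g
      unfold OnStack
      rw [hall 12 (by omega) (by omega), hall 13 (by omega) (by omega)]
    simp only [← hon] at h7
    rw [← show tOf n s₂ = tOf n s' from tOf_congr (hall 10 (by omega) (by omega))] at h5 h7
    rw [← show bOf n s₂ = bOf n s' from bOf_congr (hall 11 (by omega) (by omega))] at h6 h7
    clear hs2 hall h2 hon
    have hfin : ∀ {c'} {s₃ : Memory}, Work I s₃ → pot n m A s₃ + e ≤ c' →
        (∀ a, a ≠ 10 → a ≠ 11 → a ≠ 12 → a ≠ 13 → a ≠ 25 → s₃ a = s₂ a) →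
        (∀ x, tOf n s₃ x = if x = r ∧ I.prio h x < k + 1 then tOf n s x + 1 else tOf n s x) →
        (∀ x, bOf n s₃ x = if x ∈ I.hosPref h ∧ x ≠ r ∧ I.prio h x < k + 1 then
          min (bOf n s x) (I.rk x h - 1) else bOf n s x) →
        (∀ g : Fin m, g ≠ h → ¬ OnStack s₃ g →
          ∀ x ∈ I.hosPref g, I.ClosedAt (tOf n s₃) (bOf n s₃) g x) →
        s₃ 17 0 = k ∧ (pot n m A (s₃.set 17 0 (k + 1)) + e ≤ c' ∧ Work I (s₃.set 17 0 (k + 1)) ∧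
          (s₃.set 17 0 (k + 1)) 18 0 = h ∧ (s₃.set 17 0 (k + 1)) 16 0 = r ∧
          (∀ x, tOf n (s₃.set 17 0 (k + 1)) x =
            if x = r ∧ I.prio h x < k + 1 then tOf n s x + 1 else tOf n s x) ∧
          (∀ x, bOf n (s₃.set 17 0 (k + 1)) x =
            if x ∈ I.hosPref h ∧ x ≠ r ∧ I.prio h x < k + 1 then
            min (bOf n s x) (I.rk x h - 1) else bOf n s x) ∧
          ∀ g : Fin m, g ≠ h → ¬ OnStack (s₃.set 17 0 (k + 1)) g → ∀ x ∈ I.hosPref g,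
            I.ClosedAt (tOf n (s₃.set 17 0 (k + 1))) (bOf n (s₃.set 17 0 (k + 1))) g x) := by
      intro c' s₃ w1 w2 w3 w4 w5 w6
      have p0 : ∀ a, a ≠ 17 → (s₃.set 17 0 (k + 1)) a = s₃ a := by
        intro a ha
        rw [Memory.set_ne _ _ _ ha]
      have et : tOf n (s₃.set 17 0 (k + 1)) = tOf n s₃ := tOf_congr (p0 10 (by omega))
      have eb : bOf n (s₃.set 17 0 (k + 1)) = bOf n s₃ := bOf_congr (p0 11 (by omega))
      refine ⟨by rw [w3 17 (by omega) (by omega) (by omega) (by omega) (by omega), h8], ?_,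
        w1.congr (fun a ha _ _ => p0 a (by omega)), ?_, ?_, ?_, ?_, ?_⟩
      · rw [pot_congr (p0 10 (by omega)) (p0 11 (by omega)) (p0 13 (by omega))]
        exact w2
      · rw [p0 18 (by omega), w3 18 (by omega) (by omega) (by omega) (by omega) (by omega), h3]
      · rw [p0 16 (by omega), w3 16 (by omega) (by omega) (by omega) (by omega) (by omega), h4]
      · rw [et]; exact w4
      · rw [eb]; exact w5
      · rw [et, eb]
        intro g hg hgs
        refine w6 g hg ?_
        unfold OnStack at hgs ⊢
        rwa [p0 12 (by omega), p0 13 (by omega)] at hgs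
    refine Runs.ite (by simp only [Expr.cost, cost_var]; omega) (fun hb => ?_) (fun hb => ?_)
    · have hxr : x = r := by
        simp only [Expr.eval, eval_var, g19, h4] at hb
        by_contra h'
        exact hb (if_neg (fun h'' => h' (Fin.ext h'')))
      subst hxr
      have htx : tOf n s₂ x = tOf n s x := by
        rw [h5, if_neg (by omega)]
      have htm : tOf n s₂ x ≤ m := by
        rw [htx, hh.first]
        exact rk_le hmem
      refine (runs_raise (A := A) (e := e) hW hm H2 x g19 htm
        (by simp only [Expr.cost, cost_var]; omega)).mono ?_
      rintro c' s₃ ⟨w1, w2, w3, w4, w5, w6⟩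
      have eb : bOf n s₃ = bOf n s₂ := bOf_congr (w6 11 (by omega) (by omega) (by omega))
      refine hfin w1 w2 (fun a a1 a2 a3 a4 a5 => w6 a a1 a3 a4) ?_ ?_ ?_
      · intro y
        rw [w3]
        by_cases hy : y = x
        · subst hy
          rw [if_pos ⟨rfl, by omega⟩]
          simp [htx]
        · simp [hy, h5]
      · intro y
        rw [eb, h6]
        by_cases hy : y = x
        · simp [hy]
        · simp only [hne y hy]
      · intro g hg hgs y hy
        rw [eb, w3]
        exact (h7 g hg (fun h' => hgs (w4 g h')) y hy).raise hy (fun hrg h' => hgs (w5 g hrg h'))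
    · have hxr : x ≠ r := by
        simp only [Expr.eval, eval_var, g19, h4] at hb
        rintro rfl
        simp at hb
      have hrm := rk_le hmem
      refine Runs.seq (Runs.assign (by simp only [Expr.eval, eval_var, g20]; omega)
        (by simp only [Expr.cost, cost_var]; omega) ?_)
      simp only [Expr.eval, eval_var, g20]
      generalize hs4 : s₂.set 25 0 (I.rk x h - 1) = s₄
      have w0 : ∀ a, a ≠ 25 → s₄ a = s₂ a := by
        intro a ha
        rw [← hs4, Memory.set_ne _ _ _ ha]
      have w25 : s₄ 25 0 = I.rk x h - 1 := by rw [← hs4]; simp [Memory.set_apply]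
      rw [← pot_congr (w0 10 (by omega)) (w0 11 (by omega)) (w0 13 (by omega))] at h1
      rw [← w0 19 (by omega)] at g19
      have et : tOf n s₄ = tOf n s₂ := tOf_congr (w0 10 (by omega))
      have eb : bOf n s₄ = bOf n s₂ := bOf_congr (w0 11 (by omega))
      refine (runs_lower (A := A) (e := e) hW hm
        (H2.congr (fun a ha _ _ => w0 a (by omega))) x g19
        (by simp only [Expr.cost, cost_var]; omega)).mono ?_
      rintro c' s₃ ⟨w1, w2, w3, w4, w5, w6⟩
      rw [w25, eb] at w3
      rw [w25, eb] at w5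
      have hon : ∀ g, OnStack s₄ g ↔ OnStack s₂ g := by
        intro g
        unfold OnStack
        rw [w0 12 (by omega), w0 13 (by omega)]
      have et3 : tOf n s₃ = tOf n s₂ :=
        (tOf_congr (w6 10 (by omega) (by omega) (by omega))).trans et
      have hbx : bOf n s₂ x = bOf n s x := by
        rw [h6, if_neg (by omega)]
      refine hfin w1 w2 (fun a a1 a2 a3 a4 a5 => by rw [w6 a a2 a3 a4, w0 a a5]) ?_ ?_ ?_
      · intro y
        rw [et3, h5]
        by_cases hy : y = x
        · simp [hy, hxr]
        · simp only [hne y hy]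
      · intro y
        rw [w3]
        by_cases hy : y = x
        · subst hy
          rw [if_pos ⟨hmem, hxr, by omega⟩]
          simp [hbx]
        · simp [hy, h6, hne y hy]
      · intro g hg hgs y hy
        rw [et3, w3]
        refine (h7 g hg (fun h' => hgs (w4 g ((hon g).2 h'))) y hy).lower (min_le_left _ _)
          (fun hrg h' => ?_)
        by_contra h''
        exact hgs (w5 g hrg (by omega) (by omega))

theorem runs_output (hW : cap n m ≤ W) (H : Ready I s) (h1 : ∀ r, 1 ≤ tOf n s r)
    (hc : 60 * (n + 1) + e ≤ c) :
    Runs W outputProg s c (fun c' s' => (e ≤ c' ∧ s' 7 0 = 1 ∧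
      ∀ r : Fin n, s' 8 r = code (I.ofPos (tOf n s) r)) ∧
      ∀ a, a ∉ outputProg.writes → s' a = s a) := by
  apply Runs.frame
  have hc1 := le_cap_m (n := n) (m := m)
  have hc2 := le_cap_n (n := n) (m := m)
  refine Runs.seq (Runs.assign (by simp [Expr.eval]; omega) (by simp only [Expr.cost]; omega) ?_)
  simp only [Expr.eval, Expr.cost]
  have hfor := Runs.forLess (W := W) (x := 16) (K := n) (D := 40) (c := e)
    (e := get 0 (const 0)) (s := s.set 7 0 1)
    (p := (ite (lt (get 10 (var 16)) (add (get 3 (var 16)) (const 1)))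
      (store 8 (var 16) (add (entry 16 (get 10 (var 16))) (const 1)))
      (store 8 (var 16) (const 0))))
    (fun k c s' => e ≤ c ∧ Ready I s' ∧ s' 10 = s 10 ∧ s' 7 0 = 1 ∧
      ∀ r : Fin n, (r : ℕ) < k → s' 8 r = code (I.ofPos (tOf n s) r))
    (by omega) ?_ ?_ ?_
  · refine (hfor.more ?_).mono ?_
    · simp only [Expr.cost, cost_var]
      omega
    · rintro c' s' ⟨⟨h1, h2, h3, h4, h5⟩, h7⟩
      exact ⟨h1, h4, fun r => h5 r r.2⟩
  · refine ⟨le_rfl, H.congr (fun a ha => ?_) ?_, ?_, ?_, fun r h' => absurd h' (by omega)⟩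
    · rw [Memory.set_ne _ _ _ (by omega), Memory.set_ne _ _ _ (by omega)]
    all_goals simp [Memory.set_ne, Memory.set_apply]
  · rintro k c s' hk ⟨h1, h2, h3⟩ h8
    simp only [Expr.eval, h2.res_count]
  · rintro k c s' hk ⟨h2, h3, h4, h5, h6⟩ h7
    obtain ⟨r, hr⟩ : ∃ r : Fin n, (r : ℕ) = k := ⟨⟨k, hk⟩, rfl⟩
    have et : s' 10 k = tOf n s r := by rw [h4, ← hr]; rfl
    have el : s' 3 k = (I.resPref r).length := by rw [← hr, h3.resLen]
    have hnext : ∀ {c'}, e ≤ c' → 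
        (s'.set 8 k (code (I.ofPos (tOf n s) r))) 16 0 = k ∧ e ≤ c' ∧
        Ready I ((s'.set 8 k (code (I.ofPos (tOf n s) r))).set 16 0 (k + 1)) ∧
        ((s'.set 8 k (code (I.ofPos (tOf n s) r))).set 16 0 (k + 1)) 10 = s 10 ∧
        ((s'.set 8 k (code (I.ofPos (tOf n s) r))).set 16 0 (k + 1)) 7 0 = 1 ∧
        ∀ x : Fin n, (x : ℕ) < k + 1 →
          ((s'.set 8 k (code (I.ofPos (tOf n s) r))).set 16 0 (k + 1)) 8 x =
            code (I.ofPos (tOf n s) x) := by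
      intro c' g1
      refine ⟨by rw [Memory.set_ne _ _ _ (by omega), h7], g1, h3.congr (fun a ha => ?_) ?_, ?_,
        ?_, ?_⟩
      · rw [Memory.set_ne _ _ _ (by omega), Memory.set_ne _ _ _ (by omega)]
      · rw [Memory.set_ne _ _ _ (by omega), Memory.set_ne _ _ _ (by omega)]
      · rw [Memory.set_ne _ _ _ (by omega), Memory.set_ne _ _ _ (by omega), h4]
      · rw [Memory.set_ne _ _ _ (by omega), Memory.set_ne _ _ _ (by omega), h5]
      · intro x hx
        rw [Memory.set_ne _ _ _ (by omega), Memory.set_apply]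
        by_cases hxr : x = r
        · simp [hxr, hr]
        · have := Fin.val_ne_of_ne hxr
          rw [if_neg (by omega), h6 x (by omega)]
    refine Runs.ite (by simp only [Expr.cost, cost_var]; omega) (fun hb => ?_) (fun hb => ?_)
    · simp only [Expr.eval, eval_var, h7, et, el] at hb
      have hlt : tOf n s r < (I.resPref r).length + 1 := by
        by_contra h'
        exact hb (if_neg h')
      obtain ⟨h, q1, q2, q3⟩ := Instance.exists_rk (I := I) (r := r) (h1 r) (by omega)
      have e0 : (add (entry 16 (get 10 (var 16))) (const 1)).eval s' =
          code (I.ofPos (tOf n s) r) := by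
        simp only [eval_entry, Expr.eval, eval_var, h7, et, h3.hos_count]
        rw [← hr]
        conv_lhs => rw [← q2, h3.entry_eq q1]
        unfold Instance.ofPos
        rw [q3]
        rfl
      have e1 : code (I.ofPos (tOf n s) r) = h + 1 := by
        unfold Instance.ofPos
        rw [q3]
        rfl
      refine Runs.store (by rw [eval_var, h7]; omega) (by rw [e0, e1]; omega)
        (by simp only [cost_entry, Expr.cost, cost_var]; omega) ?_
      rw [e0, eval_var, h7]
      exact hnext (by simp only [cost_entry, Expr.cost, cost_var]; omega)
    · simp only [Expr.eval, eval_var, h7, et, el] at hb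
      have hge : ¬ tOf n s r < (I.resPref r).length + 1 := by
        intro h'
        simp [h'] at hb
      have e1 : code (I.ofPos (tOf n s) r) = 0 := by
        unfold Instance.ofPos
        rw [List.getElem?_eq_none (by omega)]
        rfl
      refine Runs.store (by rw [eval_var, h7]; omega) (by simp [Expr.eval])
        (by simp only [Expr.cost, cost_var]; omega) ?_
      rw [eval_var, h7]
      simp only [Expr.eval]
      have := hnext (c' := c + 40 - ((lt (get 10 (var 16)) (add (get 3 (var 16)) (const 1))).cost + 1) -
        ((var 16).cost + (const 0).cost + 1)) (by simp only [Expr.cost, cost_var]; omega)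
      rwa [e1] at this

end

theorem mul_add_inj {a b x y : ℕ} (hx : x < m) (hy : y < m) (e : a * m + x = b * m + y) :
    a = b ∧ x = y := by
  have h1 : (a * m + x) / m = (b * m + y) / m := by rw [e]
  have h2 : (a * m + x) % m = (b * m + y) % m := by rw [e]
  rw [Nat.mul_comm, Nat.mul_comm b] at h1 h2
  rw [Nat.mul_add_div (by omega), Nat.mul_add_div (by omega), Nat.div_eq_of_lt hx,
    Nat.div_eq_of_lt hy] at h1
  rw [Nat.mul_add_mod, Nat.mul_add_mod, Nat.mod_eq_of_lt hx, Nat.mod_eq_of_lt hy] at h2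
  exact ⟨h1, h2⟩

theorem mul_add_lt_cap {a x : ℕ} (ha : a < n) (hx : x < m) : a * m + x ≤ cap n m := by
  have h1 : (a + 1) * m ≤ n * m := Nat.mul_le_mul_right m ha
  have h2 : n * m ≤ cap n m := by unfold cap; nlinarith
  rw [Nat.succ_mul] at h1
  omega

section

variable {I : Instance n m} {W : ℕ} {s : Memory} {c e : ℕ}

theorem encode_resLen (I : Instance n m) (r : Fin n) : I.encode 3 r = (I.resPref r).length := by
  simp [Instance.encode]

theorem runs_init_ranks (hW : cap n m ≤ W) (hs : ∀ a ≤ 6, s a = I.encode a) {r : Fin n}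
    (hr : s 16 0 = r) (hc : 33 * m + 10 + e ≤ c) :
    Runs W (forLess 17 (get 3 (var 16))
      (store 9 (add (mul (var 16) (get 0 (const 1)))
        (get 4 (add (mul (var 16) (get 0 (const 1))) (var 17)))) (add (var 17) (const 1))))
      s c (fun c' s' => e ≤ c' ∧ (∀ a, a ≠ 9 → a ≠ 17 → s' a = s a) ∧
        (∀ h, r ∈ I.hosPref h → s' 9 (r * m + h) = I.rk r h) ∧
        ∀ (x : Fin n) (h : Fin m), x ≠ r → s' 9 (x * m + h) = s 9 (x * m + h)) := by
  have hc1 := le_cap_m (n := n) (m := m)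
  have hlen := length_resPref_le I r
  have hfor := Runs.forLess (W := W) (x := 17) (K := (I.resPref r).length) (D := 20) (c := e)
    (e := get 3 (var 16)) (s := s)
    (p := (store 9 (add (mul (var 16) (get 0 (const 1)))
        (get 4 (add (mul (var 16) (get 0 (const 1))) (var 17)))) (add (var 17) (const 1))))
    (fun k c s' => e ≤ c ∧ (∀ a, a ≠ 9 → a ≠ 17 → s' a = s a) ∧
        (∀ h, r ∈ I.hosPref h → I.rk r h ≤ k → s' 9 (r * m + h) = I.rk r h) ∧
        ∀ (x : Fin n) (h : Fin m), x ≠ r → s' 9 (x * m + h) = s 9 (x * m + h))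
    (by omega) ?_ ?_ ?_
  · refine (hfor.more ?_).mono ?_
    · simp only [Expr.cost, cost_var]
      omega
    · rintro c' s' ⟨⟨h1, h2, h3, h4⟩, h7⟩
      exact ⟨h1, h2, fun h hh => h3 h hh (Instance.rk_le_length hh), h4⟩
  · refine ⟨le_rfl, fun a _ ha => Memory.set_ne _ _ _ ha, fun h _ h1 => ?_, fun x h _ => ?_⟩
    · have := Instance.one_le_rk (I := I) (r := r) (h := h)
      omega
    · rw [Memory.set_ne _ _ _ (by omega)]
  · rintro k c s' hk ⟨h1, h2, h3⟩ h8
    simp only [Expr.eval, eval_var]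
    rw [h2 16 (by omega) (by omega), hr, h2 3 (by omega) (by omega), hs 3 (by omega),
      encode_resLen]
  · rintro k c s' hk ⟨h1, h2, h3, h4⟩ h8
    have hkm : k < m := by omega
    obtain ⟨h, hh⟩ : ∃ h, (I.resPref r)[k] = h := ⟨_, rfl⟩
    have hrk : I.rk r h = k + 1 := by
      unfold Instance.rk
      rw [← hh, (I.resPref_nodup r).idxOf_getElem]
    have e01 : s' 0 1 = m := by
      rw [h2 0 (by omega) (by omega), hs 0 (by omega)]
      rfl
    have e16 : s' 16 0 = r := by rw [h2 16 (by omega) (by omega), hr]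
    have e0 : (add (mul (var 16) (get 0 (const 1)))
        (get 4 (add (mul (var 16) (get 0 (const 1))) (var 17)))).eval s' = r * m + h := by
      simp only [Expr.eval, eval_var, h8, e01, e16]
      rw [h2 4 (by omega) (by omega), hs 4 (by omega), I.encode_resList r hk, hh]
    have hcap := mul_add_lt_cap r.2 h.2
    refine Runs.store (by rw [e0]; omega) (by simp only [Expr.eval, eval_var, h8]; omega)
      (by simp only [Expr.cost, cost_var]; omega) ?_
    rw [e0]
    simp only [Expr.eval, eval_var, h8]
    refine ⟨by rw [Memory.set_ne _ _ _ (by omega), h8], by simp only [Expr.cost, cost_var]; omega,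
      ?_, ?_, ?_⟩
    · intro a a1 a2
      rw [Memory.set_ne _ _ _ a2, Memory.set_ne _ _ _ a1, h2 a a1 a2]
    · intro g hg hgk
      rw [Memory.set_ne _ _ _ (by omega), Memory.set_apply]
      by_cases hgh : g = h
      · subst hgh
        simp [hrk]
      · have h9 : I.rk r g ≠ k + 1 := by
          intro h'
          exact hgh (Instance.rk_inj hg (h'.trans hrk.symm))
        have h10 := Fin.val_ne_of_ne hgh
        rw [if_neg (by omega), h3 g hg (by omega)]
    · intro x g hx
      rw [Memory.set_ne _ _ _ (by omega), Memory.set_apply, if_neg, h4 x g hx]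
      rintro ⟨-, h'⟩
      exact hx (Fin.ext (mul_add_inj g.2 h.2 h').1)

/-- Initially all m hospitals are on the stack. As each push uses up a move, this also bounds the
stack for the rest of the run. -/
theorem moves_trivial_le (I : Instance n m) :
    m + Instance.moves m (fun _ => 1) (fun r => (I.resPref r).length + 1) ≤ cap n m := by
  have h1 : ∑ r : Fin n, ((I.resPref r).length + 1) ≤ ∑ _r : Fin n, (m + 1) :=
    Finset.sum_le_sum (fun r _ => Nat.succ_le_succ (length_resPref_le I r))
  unfold Instance.moves cap
  simp only [Nat.add_sub_cancel, Finset.sum_const, Finset.card_univ, Fintype.card_fin,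
    smul_eq_mul] at h1 ⊢
  nlinarith

theorem runs_init (hW : cap n m ≤ W) (hc : 100 * (n + 1) * (m + 1) + e ≤ c) :
    Runs W initProg I.encode c (fun c' s' => (e ≤ c' ∧
      Improving I (fun _ => 1) (fun r => (I.resPref r).length + 1) s' ∧
      (tOf n s' = fun _ => 1) ∧ (bOf n s' = fun r => (I.resPref r).length + 1) ∧ s' 13 0 = m) ∧
      ∀ a, a ∉ initProg.writes → s' a = I.encode a) := by
  apply Runs.frame
  have hc1 := le_cap_m (n := n) (m := m)
  have hc2 := le_cap_n (n := n) (m := m)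
  have hfor := Runs.forLess (W := W) (x := 16) (K := n) (D := 33 * m + 22)
    (c := e + 17 * m + 13)
    (e := get 0 (const 0)) (s := I.encode)
    (p := (seq (forLess 17 (get 3 (var 16))
      (store 9 (add (mul (var 16) (get 0 (const 1)))
        (get 4 (add (mul (var 16) (get 0 (const 1))) (var 17)))) (add (var 17) (const 1))))
      (seq (store 10 (var 16) (const 1)) (store 11 (var 16) (add (get 3 (var 16)) (const 1))))))
    (fun k c s' => e + 17 * m + 13 ≤ c ∧ (∀ a ≤ 6, s' a = I.encode a) ∧
      (∀ (x : Fin n) (h : Fin m), (x : ℕ) < k → x ∈ I.hosPref h → s' 9 (x * m + h) = I.rk x h) ∧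
      (∀ x : Fin n, (x : ℕ) < k → s' 10 x = 1) ∧
      (∀ x : Fin n, (x : ℕ) < k → s' 11 x = (I.resPref x).length + 1))
    (by omega) ?_ ?_ ?_
  · refine Runs.seq ((hfor.more ?_).mono ?_)
    · simp only [Expr.cost]
      ring_nf at hc ⊢
      omega
    · rintro c₁ s₁ ⟨⟨h1, h2, h3, h4, h5⟩, -⟩
      have hfor' := Runs.forLess (W := W) (x := 16) (K := m) (D := 5) (c := e + 4)
        (e := get 0 (const 1)) (s := s₁) (p := store 12 (var 16) (var 16))
        (fun k c s' => e + 4 ≤ c ∧ (∀ a, a ≠ 12 → a ≠ 16 → s' a = s₁ a) ∧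
          ∀ i < k, s' 12 i = i) (by omega) ?_ ?_ ?_
      · refine Runs.seq ((hfor'.more ?_).mono ?_)
        · simp only [Expr.cost]
          omega
        · rintro c₂ s₂ ⟨⟨g1, g2, g3⟩, -⟩
          have e01 : s₂ 0 1 = m := by
            rw [g2 0 (by omega) (by omega), h2 0 (by omega)]
            rfl
          refine Runs.assign (by simp only [Expr.eval, e01]; omega)
            (by simp only [Expr.cost]; omega) ?_
          simp only [Expr.eval, e01]
          have p0 : ∀ a, a ≠ 13 → (s₂.set 13 0 m) a = s₂ a := fun a ha => Memory.set_ne _ _ _ ha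
          have e13 : (s₂.set 13 0 m) 13 0 = m := by simp [Memory.set_apply]
          have et : tOf n (s₂.set 13 0 m) = fun _ => 1 := by
            ext x
            unfold tOf
            rw [p0 10 (by omega), g2 10 (by omega) (by omega), h4 x x.2]
          have eb : bOf n (s₂.set 13 0 m) = fun r => (I.resPref r).length + 1 := by
            ext x
            unfold bOf
            rw [p0 11 (by omega), g2 11 (by omega) (by omega), h5 x x.2]
          refine ⟨by simp only [Expr.cost]; omega, ⟨⟨⟨?_, ?_⟩, ?_, ?_⟩, ?_, ?_, ?_⟩, et, eb, e13⟩
          · intro a ha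
            rw [p0 a (by omega), g2 a (by omega) (by omega), h2 a ha]
          · intro x h hx
            rw [p0 9 (by omega), g2 9 (by omega) (by omega), h3 x h x.2 hx]
          · intro i hi
            rw [e13] at hi
            rw [p0 12 (by omega), g3 i hi]
            exact hi
          · unfold movesOf
            rw [e13, et, eb]
            exact moves_trivial_le I
          · rw [et, eb]
            refine ⟨fun _ => le_rfl, fun _ => by omega, fun _ => le_rfl, fun h x _ hlt => ?_⟩
            have := Instance.one_le_rk (I := I) (r := x) (h := h)
            omega
          · rw [et, eb]
            exact Instance.Refines.refl
          -- Every hospital is on the stack, so there is nothing to verify.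
          · intro g hg
            exact absurd ⟨g, by rw [e13]; exact g.2, by rw [p0 12 (by omega), g3 g g.2]⟩ hg
      · exact ⟨le_rfl, fun a _ ha => Memory.set_ne _ _ _ ha, fun i hi => absurd hi (by omega)⟩
      · rintro k c s' hk ⟨h1, g2, h3⟩ h8
        simp only [Expr.eval]
        rw [g2 0 (by omega) (by omega), h2 0 (by omega)]
        rfl
      · rintro k c s' hk ⟨g1, g2, g3⟩ h8
        refine Runs.store (by rw [eval_var, h8]; omega) (by rw [eval_var, h8]; omega)
          (by simp only [cost_var]; omega) ?_
        rw [eval_var, h8]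
        refine ⟨by rw [Memory.set_ne _ _ _ (by omega), h8], by simp only [cost_var]; omega, ?_, ?_⟩
        · intro a a1 a2
          rw [Memory.set_ne _ _ _ a2, Memory.set_ne _ _ _ a1, g2 a a1 a2]
        · intro i hi
          rw [Memory.set_ne _ _ _ (by omega), Memory.set_apply]
          by_cases hik : i = k
          · simp [hik]
          · simp [hik, g3 i (by omega)]
  · refine ⟨le_rfl, fun a ha => Memory.set_ne _ _ _ (by omega), ?_, ?_, ?_⟩
    all_goals intros; omega
  · rintro k c s' hk ⟨h1, h2, h3⟩ h8
    simp only [Expr.eval, h2 0 (by omega)]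
    rfl
  · rintro k c s' hk ⟨h1, h2, h3, h4, h5⟩ h8
    obtain ⟨r, hr⟩ : ∃ r : Fin n, (r : ℕ) = k := ⟨⟨k, hk⟩, rfl⟩
    have hlen := length_resPref_le I r
    refine Runs.seq ((runs_init_ranks (r := r) (e := c + 12) hW h2 (h8.trans hr.symm)
      (by omega)).mono ?_)
    rintro c₁ s₁ ⟨g1, g2, g3, g4⟩
    have e16 : s₁ 16 0 = k := by rw [g2 16 (by omega) (by omega), h8]
    have e3 : s₁ 3 k = (I.resPref r).length := by
      rw [g2 3 (by omega) (by omega), h2 3 (by omega), ← hr, encode_resLen]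
    refine Runs.seq (Runs.store (by rw [eval_var, e16]; omega) (by simp only [Expr.eval]; omega)
      (by simp only [Expr.cost, cost_var]; omega) ?_)
    simp only [Expr.eval, eval_var, e16]
    have q16 : (s₁.set 10 k 1) 16 0 = k := by rw [Memory.set_ne _ _ _ (by omega), e16]
    have q3 : (s₁.set 10 k 1) 3 k = (I.resPref r).length := by
      rw [Memory.set_ne _ _ _ (by omega), e3]
    refine Runs.store (by rw [eval_var, q16]; omega)
      (by simp only [Expr.eval, eval_var, q16, q3]; omega)
      (by simp only [Expr.cost, cost_var]; omega) ?_
    simp only [Expr.eval, eval_var, q16, q3]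
    generalize hs2 : (s₁.set 10 k 1).set 11 k ((I.resPref r).length + 1) = s₂
    have p0 : ∀ a, a ≠ 10 → a ≠ 11 → s₂ a = s₁ a := by
      intro a a1 a2
      rw [← hs2, Memory.set_ne _ _ _ a2, Memory.set_ne _ _ _ a1]
    refine ⟨by rw [p0 16 (by omega) (by omega), e16], by simp only [Expr.cost, cost_var]; omega,
      ?_, ?_, ?_, ?_⟩
    · intro a ha
      rw [Memory.set_ne _ _ _ (by omega), p0 a (by omega) (by omega), g2 a (by omega) (by omega),
        h2 a ha]
    · intro x h hx hxh
      rw [Memory.set_ne _ _ _ (by omega), p0 9 (by omega) (by omega)]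
      by_cases hxr : x = r
      · subst hxr
        exact g3 h hxh
      · have := Fin.val_ne_of_ne hxr
        rw [g4 x h hxr, h3 x h (by omega) hxh]
    · intro x hx
      rw [Memory.set_ne _ _ _ (by omega), ← hs2, Memory.set_ne _ _ _ (by omega), Memory.set_apply]
      by_cases hxk : (x : ℕ) = k
      · simp [hxk]
      · rw [if_neg (by omega), g2 10 (by omega) (by omega), h4 x (by omega)]
    · intro x hx
      rw [Memory.set_ne _ _ _ (by omega), ← hs2, Memory.set_apply]
      by_cases hxr : x = r
      · subst hxr
        simp [hr]
      · have := Fin.val_ne_of_ne hxr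
        rw [if_neg (by omega), Memory.set_ne _ _ _ (by omega), g2 11 (by omega) (by omega),
          h5 x (by omega)]

end

/-! ### The complete algorithm and its running time -/

/-- Make all possible improvements, and test whether the bounds remain consistent. -/
def settleProg : Prog := seq improveProg checkProg

/-- Close the half-open hospital that was found, or else open it. -/
def attemptProg : Prog :=
  seq (copyProg 10 14) (seq (copyProg 11 15) (seq closeProg (seq settleProg
    (ite (var 26) skip
      (seq (copyProg 14 10) (seq (copyProg 15 11) (seq openProg (seq settleProg
        (assign 28 (var 26))))))))))

/-- Decide about one half-open hospital, or output the matching if there is none. -/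
def roundProg : Prog :=
  seq findProg (ite (var 27) attemptProg (seq outputProg (assign 28 (const 0))))

/-- Find a stable matching. -/
def stableProg : Prog :=
  ite (mul (get 0 (const 0)) (get 0 (const 1)))
    (seq initProg (seq settleProg (seq (assign 28 (var 26)) (loop (var 28) roundProg))))
    (assign 7 (const 1))

/-- The memory at the start of a round. -/
structure Settled (I : Instance n m) (s : Memory) : Prop extends Work I s where
  table : I.IsStableTable (tOf n s) (bOf n s)
  empty : s 13 0 = 0
  flag : s 7 0 = 0

/-- The number of residents whose position is not determined. -/
def gap (n : ℕ) (s : Memory) : ℕ := (Finset.univ.filter (fun r => tOf n s r < bOf n s r)).card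

/-- The credit that pays for all rounds. -/
def budget (n m : ℕ) (s : Memory) : ℕ :=
  pot n m (240 * (n + 1)) s + 600 * (n + 1) * (n + 1) * movesOf n m s +
    ((240 * (n + 1) + 100) * cap n m + 600 * (n + 1) * (n + 1)) * gap n s +
    600 * (n + 1) * (n + 1)

/-- The state between two rounds. -/
def BetweenRounds (I : Instance n m) (c : ℕ) (s : Memory) : Prop :=
  3 ≤ c ∧ (s 28 0 ≠ 0 → Settled I s ∧ budget n m s ≤ c) ∧ (s 28 0 = 0 → I.CorrectOutput s)

section

variable {I : Instance n m} {W : ℕ} {s s' : Memory} {t b t' b' : Fin n → ℕ} {r : Fin n}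
  {h : Fin m} {c e : ℕ}

theorem Instance.moves_mono (ht : ∀ r, t r ≤ t' r) (hb : ∀ r, b' r ≤ b r) :
    Instance.moves m t' b' ≤ Instance.moves m t b :=
  Nat.add_le_add (Finset.sum_le_sum fun r _ => Nat.sub_le_sub_left (ht r) _)
    (Finset.sum_le_sum fun r _ => hb r)

/-- Closing raises the bound of r, so a successful closing uses up a move, which pays for the round.
-/
theorem Instance.Closing.moves_lt (C : I.Closing t b r h t' b') (ht : t r ≤ m) :
    Instance.moves m t' b' < Instance.moves m t b := by
  refine Nat.add_lt_add_of_lt_of_le (Finset.sum_lt_sum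
    (fun x _ => Nat.sub_le_sub_left (C.t_le x) _) ⟨r, Finset.mem_univ r, ?_⟩)
    (Finset.sum_le_sum fun x _ => C.b_le x)
  rw [C.t_self]
  omega

theorem gap_le (s : Memory) : gap n s ≤ n := (Finset.card_le_univ _).trans (by simp)

theorem gap_mono (ht : ∀ r, tOf n s r ≤ tOf n s' r) (hb : ∀ r, bOf n s' r ≤ bOf n s r) :
    gap n s' ≤ gap n s := by
  refine Finset.card_le_card fun r hr => ?_
  simp only [Finset.mem_filter, Finset.mem_univ, true_and] at hr ⊢
  exact (ht r).trans_lt (hr.trans_le (hb r))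

theorem gap_lt (ht : ∀ r, tOf n s r ≤ tOf n s' r) (hb : ∀ r, bOf n s' r ≤ bOf n s r)
    (hr : tOf n s r < bOf n s r) (hr' : bOf n s' r ≤ tOf n s' r) : gap n s' < gap n s := by
  refine Finset.card_lt_card ((Finset.ssubset_iff_of_subset fun x hx => ?_).2 ⟨r, ?_, ?_⟩)
  · simp only [Finset.mem_filter, Finset.mem_univ, true_and] at hx ⊢
    exact (ht x).trans_lt (hx.trans_le (hb x))
  · simpa using hr
  · simpa using hr'

/-- An empty stack together with consistent bounds is a stable table. Inconsistent bounds leave no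
room for a stable matching, and the improvements have lost none within t and b. -/
theorem runs_settle (hW : cap n m ≤ W) (H : Improving I t b s) (h7 : s 7 0 = 0)
    (hc : pot n m (240 * (n + 1)) s + 40 * (n + 1) + 10 + e ≤ c) :
    Runs W settleProg s c (fun c' s' => (pot n m (240 * (n + 1)) s' + e ≤ c' ∧ Work I s' ∧
      s' 13 0 = 0 ∧ s' 26 0 ≤ 1 ∧ I.Refines t b (tOf n s') (bOf n s') ∧
      (s' 26 0 ≠ 0 → Settled I s') ∧
      (s' 26 0 = 0 → ∀ q, I.StablePos q → (∀ r, t r ≤ q r) → ¬ ∀ r, q r ≤ b r)) ∧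
      ∀ a, a ∉ settleProg.writes → s' a = s a) := by
  apply Runs.frame
  refine Runs.seq ((runs_improve (e := 40 * (n + 1) + e) hW H (by omega)).mono ?_)
  rintro c₁ s₁ ⟨⟨h1, h2, h3⟩, h4⟩
  refine (runs_check (e := pot n m (240 * (n + 1)) s₁ + e) hW h2.toReady (by omega)).mono ?_
  rintro c₂ s₂ ⟨⟨g1, g2, g3⟩, g4⟩
  rw [show checkProg.writes = [26, 16, 26, 16] from rfl] at g4
  rw [show improveProg.writes = [13, 18, 21, 22, 17, 19, 20, 21, 22, 17, 23, 24, 17, 19, 20, 10,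
    12, 13, 25, 12, 13, 11, 23, 24, 17] from rfl] at h4
  have hall : ∀ a ≤ 13, s₂ a = s₁ a := by
    intro a ha
    refine g4 a ?_
    simp
    omega
  have et : tOf n s₂ = tOf n s₁ := tOf_congr (hall 10 (by omega))
  have eb : bOf n s₂ = bOf n s₁ := bOf_congr (hall 11 (by omega))
  have hw : Work I s₂ := h2.toWork.congr (fun a ha _ _ => hall a ha)
  have h13 : s₂ 13 0 = 0 := by rw [hall 13 (by omega), h3]
  refine ⟨?_, hw, h13, g2, by rw [et, eb]; exact h2.refines, fun h26 => ⟨hw, ?_, h13, ?_⟩, ?_⟩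
  · rw [pot_congr (hall 10 (by omega)) (hall 11 (by omega)) (hall 13 (by omega))]
    exact g1
  · rw [et, eb]
    refine ⟨h2.table, g3.1 h26, fun g => h2.closed g ?_⟩
    rintro ⟨i, hi, -⟩
    omega
  · rw [hall 7 (by omega), h4 7 (by simp), h7]
  · intro h26 q hq hq1 hq2
    have := h2.refines.keep q hq hq1 hq2
    exact g3.2 (fun x => (this.1 x).trans (this.2 x)) h26

/-- If closing and opening a half-open hospital both fail, then there is no stable matching. -/
theorem Instance.IsStableTable.not_exists (T : I.IsStableTable t b) (hl : ∀ h, I.lower h ≤ 2)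
    (hh : I.HalfOpen t r h) (C : I.Closing t b r h t' b')
    (hcl : ∀ q, I.StablePos q → (∀ r, t' r ≤ q r) → ¬ ∀ r, q r ≤ b' r)
    (hop : ∀ q, I.StablePos q → (∀ r, t r ≤ q r) →
      ¬ ∀ x, q x ≤ Function.update b r (min (b r) (t r)) x) :
    ¬ ∃ M, I.IsStable M := by
  rw [Instance.exists_stable_iff]
  rintro ⟨q₀, hq₀⟩
  -- The given stable matching may lie anywhere; its median with t and b is a stable one inside the
  -- table, which must survive closing or opening.
  obtain ⟨q, hq⟩ : ∃ q, q = fun r => max (t r) (min (q₀ r) (b r)) := ⟨_, rfl⟩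
  have hst : I.StablePos q := hq ▸ T.clamp hl hq₀
  have h1 : ∀ x, t x ≤ q x := fun x => by rw [hq]; exact le_max_left _ _
  have h2 : ∀ x, q x ≤ b x := fun x => by
    rw [hq]
    exact max_le (T.t_le_b x) (min_le_right _ _)
  by_cases hlt : t r < q r
  · refine hcl q hst (fun x => ?_) (fun x => ?_)
    · by_cases hx : x = r
      · subst hx
        rw [C.t_self]
        exact hlt
      · rw [C.t_ne x hx]
        exact h1 x
    · by_cases hx : x = r
      · subst hx
        rw [C.b_self]
        exact h2 x
      · by_cases hm : x ∈ I.hosPref h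
        · rw [C.b_mem x hx hm]
          have := hst.lt_of_halfOpen T hl hh h2 hlt hm hx
          have := h2 x
          omega
        · rw [C.b_ne x hm]
          exact h2 x
  · refine hop q hst h1 (fun x => ?_)
    by_cases hx : x = r
    · subst hx
      simp only [Function.update_self]
      have := h2 x
      omega
    · simpa [hx] using h2 x

/-- A successful closing is paid for by the move that it uses up. If it fails, the saved bounds are
restored and opening fixes the position of r. The decrease of `gap` then releases the credit that
replaces the spent potential. -/
theorem runs_attempt (hW : cap n m ≤ W) (hl : ∀ h, I.lower h ≤ 2) (H : Settled I s)
    (hr : s 27 0 = r + 1) (hh : I.HalfOpen (tOf n s) r h) (h28 : s 28 0 ≠ 0)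
    (hc : budget n m s ≤ c + 150 * (n + 1) * (n + 1) + 10) :
    Runs W attemptProg s c (BetweenRounds I) := by
  have hm : 0 < m := h.pos
  have hc1 := le_cap_m (n := n) (m := m)
  have hc2 := le_cap_n (n := n) (m := m)
  have hgap := (H.table.halfOpen hl hh).1
  have hgap1 : 1 ≤ gap n s := Finset.card_pos.2 ⟨r, by simpa using hgap⟩
  have hbound := H.bound
  obtain ⟨E, hE⟩ : ∃ E, E = 150 * (n + 1) * (n + 1) := ⟨_, rfl⟩
  obtain ⟨F, hF⟩ : ∃ F, F = 600 * (n + 1) * (n + 1) := ⟨_, rfl⟩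
  obtain ⟨G, hG⟩ : ∃ G, G = (240 * (n + 1) + 100) * cap n m := ⟨_, rfl⟩
  have hF1 : E + 450 * (n + 1) ≤ F := by rw [hE, hF]; nlinarith
  have hbud : ∀ s' : Memory, budget n m s' = pot n m (240 * (n + 1)) s' + F * movesOf n m s' +
      (G + F) * gap n s' + F := fun s' => by rw [hF, hG]; rfl
  -- G is enough to refill the potential for the restored bounds, at which the stack is empty.
  have hpotle : ∀ s' : Memory, s' 13 0 = 0 → movesOf n m s' = movesOf n m s →
      pot n m (240 * (n + 1)) s' ≤ G := by
    intro s' h1 h2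
    unfold pot
    rw [h1, h2, Nat.mul_zero, Nat.zero_add, hG]
    exact Nat.mul_le_mul_left _ (by omega)
  obtain ⟨p, hp⟩ : ∃ p, ∀ s' : Memory, s' 10 = s 10 → s' 11 = s 11 → s' 13 = s 13 →
      pot n m (240 * (n + 1)) s' = p := ⟨_, fun _ => pot_congr⟩
  rw [hbud, hp s rfl rfl rfl, ← hE] at hc
  clear hE hF hG
  obtain ⟨d, hd⟩ : ∃ d, gap n s = d + 1 := ⟨gap n s - 1, by omega⟩
  have hval : ∀ r : Fin n, s 10 r ≤ W ∧ s 11 r ≤ W := by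
    intro x
    have h1 := H.table.le x
    have h2 := H.table.le' x
    have h3 := length_resPref_le I x
    rw [show tOf n s x = s 10 x from rfl] at h1
    rw [show bOf n s x = s 11 x from rfl] at h2
    omega
  -- save the bounds
  refine Runs.seq ((runs_copy (a := 10) (a' := 14)
    (e := p + F * movesOf n m s + (G + F) * gap n s + 300 * (n + 1))
    hW H.toReady (by omega) (by omega) (by omega) (by omega) (fun x => (hval x).1)
    (by rw [Nat.add_comm]; omega)).mono ?_)
  clear hc
  rintro c₁ s₁ ⟨⟨h1, h2⟩, h3⟩
  rw [show (copyProg 10 14).writes = [16, 14, 16] from rfl] at h3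
  have hR1 : Ready I s₁ := H.toReady.congr (fun a ha => h3 a (by simp; omega)) (h3 9 (by simp))
  refine Runs.seq ((runs_copy (a := 11) (a' := 15)
    (e := p + F * movesOf n m s + (G + F) * gap n s + 280 * (n + 1))
    hW hR1 (by omega) (by omega) (by omega) (by omega) (fun x => by
      rw [h3 11 (by simp)]; exact (hval x).2) (by rw [Nat.add_comm]; omega)).mono ?_)
  clear h1
  rintro c₂ s₂ ⟨⟨h1, h4⟩, h5⟩
  rw [show (copyProg 11 15).writes = [16, 15, 16] from rfl] at h5
  have hall : ∀ a, a ≠ 14 → a ≠ 15 → a ≠ 16 → s₂ a = s a := by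
    intro a a1 a2 a3
    rw [h5 a (by simp; omega), h3 a (by simp; omega)]
  have e14 : ∀ x : Fin n, s₂ 14 x = tOf n s x := fun x => by rw [h5 14 (by simp), h2 x]; rfl
  have e15 : ∀ x : Fin n, s₂ 15 x = bOf n s x := fun x => by rw [h4 x, h3 11 (by simp)]; rfl
  have et : tOf n s₂ = tOf n s := tOf_congr (hall 10 (by omega) (by omega) (by omega))
  have eb : bOf n s₂ = bOf n s := bOf_congr (hall 11 (by omega) (by omega) (by omega))
  have ep : pot n m (240 * (n + 1)) s₂ = p :=
    hp s₂ (hall 10 (by omega) (by omega) (by omega)) (hall 11 (by omega) (by omega) (by omega))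
      (hall 13 (by omega) (by omega) (by omega))
  have e7 : s₂ 7 0 = 0 := by rw [hall 7 (by omega) (by omega) (by omega), H.flag]
  have e27 : s₂ 27 0 = r + 1 := by rw [hall 27 (by omega) (by omega) (by omega), hr]
  have e28 : s₂ 28 0 ≠ 0 := by rwa [hall 28 (by omega) (by omega) (by omega)]
  have hW2 : Work I s₂ := H.toWork.congr
    (fun a _ _ _ => hall a (by omega) (by omega) (by omega))
  clear h2 h3 h4 h5 hR1 hall
  -- close the hospital
  refine Runs.seq ((runs_close (A := 240 * (n + 1))
    (e := F * movesOf n m s + (G + F) * gap n s + 180 * (n + 1)) hW hW2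
    (by rw [et, eb]; exact H.table) e27 (by rw [et]; exact hh) (by omega)).frame.mono ?_)
  clear h1
  rintro c₃ s₃ ⟨⟨h1, h2, h3⟩, h4⟩
  rw [et, eb] at h2
  rw [show closeProg.writes = [16, 18, 17, 19, 20, 10, 12, 13, 25, 12, 13, 11, 17] from rfl] at h4
  refine Runs.seq ((runs_settle
    (e := F * movesOf n m s + (G + F) * gap n s + 130 * (n + 1)) hW h3
    (by rw [h4 7 (by simp), e7]) (by omega)).mono ?_)
  clear h1
  rintro c₄ s₄ ⟨⟨h1, h5, h6, h7, h8, h9, h10⟩, h11⟩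
  have hsw : settleProg.writes = [13, 18, 21, 22, 17, 19, 20, 21, 22, 17, 23, 24, 17, 19, 20, 10,
    12, 13, 25, 12, 13, 11, 23, 24, 17, 26, 16, 26, 16] := rfl
  rw [hsw] at h11
  have k28 : s₄ 28 0 ≠ 0 := by rwa [h11 28 (by simp), h4 28 (by simp)]
  refine Runs.ite (by simp only [cost_var]; omega) (fun hb => ?_) (fun hb => ?_)
  · refine Runs.skip (by simp only [cost_var]; omega) ⟨by simp only [cost_var]; omega,
      fun _ => ⟨h9 hb, ?_⟩, fun h' => absurd h' k28⟩
    have g1 : movesOf n m s₄ < movesOf n m s :=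
      (Instance.moves_mono h8.t_le h8.b_le).trans_lt (h2.moves_lt (by
        rw [hh.first]; exact rk_le hh.mem))
    have g2 : gap n s₄ ≤ gap n s := gap_mono (fun x => (h2.t_le x).trans (h8.t_le x))
      (fun x => (h8.b_le x).trans (h2.b_le x))
    have g3 : F * (movesOf n m s₄ + 1) ≤ F * movesOf n m s := Nat.mul_le_mul_left _ g1
    have g4 := Nat.mul_le_mul_left (G + F) g2
    rw [hbud]
    rw [Nat.mul_add] at g3
    simp only [cost_var]
    omega
  · rw [eval_var] at hb
    have hno := h10 hb
    have k14 : ∀ x : Fin n, s₄ 14 x = tOf n s x := fun x => by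
      rw [h11 14 (by simp), h4 14 (by simp), e14]
    have k15 : ∀ x : Fin n, s₄ 15 x = bOf n s x := fun x => by
      rw [h11 15 (by simp), h4 15 (by simp), e15]
    have k27 : s₄ 27 0 = r + 1 := by rw [h11 27 (by simp), h4 27 (by simp), e27]
    have k7 : s₄ 7 0 = 0 := by rw [h11 7 (by simp), h4 7 (by simp), e7]
    simp only [cost_var]
    clear h4 h11 h3 h8 h9 e14 e15 e27 e7 e28 hb h7 h10
    rw [hd, Nat.mul_add (G + F) d 1, Nat.mul_one] at h1
    -- restore the bounds
    refine Runs.seq ((runs_copy (a := 14) (a' := 10)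
      (e := F * movesOf n m s + (G + F) * d + G + F + 100 * (n + 1))
      hW h5.toReady (by omega) (by omega) (by omega) (by omega)
      (fun x => by rw [k14]; exact (hval x).1) (by omega)).mono ?_)
    clear h1
    rintro c₅ s₅ ⟨⟨h1, h3⟩, h4⟩
    rw [show (copyProg 14 10).writes = [16, 10, 16] from rfl] at h4
    have hR5 : Ready I s₅ := h5.toReady.congr (fun a ha => h4 a (by simp; omega)) (h4 9 (by simp))
    refine Runs.seq ((runs_copy (a := 15) (a' := 11)
      (e := F * movesOf n m s + (G + F) * d + G + F + 80 * (n + 1))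
      hW hR5 (by omega) (by omega) (by omega) (by omega)
      (fun x => by rw [h4 15 (by simp), k15]; exact (hval x).2) (by omega)).mono ?_)
    clear h1
    rintro c₆ s₆ ⟨⟨h1, h7⟩, h8⟩
    rw [show (copyProg 15 11).writes = [16, 11, 16] from rfl] at h8
    have et6 : tOf n s₆ = tOf n s := by
      ext x
      unfold tOf
      rw [h8 10 (by simp), h3 x, k14]
      rfl
    have eb6 : bOf n s₆ = bOf n s := by
      ext x
      unfold bOf
      rw [h7 x, h4 15 (by simp), k15]
      rfl
    have em6 : movesOf n m s₆ = movesOf n m s := by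
      unfold movesOf
      rw [et6, eb6]
    have hall : ∀ a, a ≠ 10 → a ≠ 11 → a ≠ 16 → s₆ a = s₄ a := by
      intro a a1 a2 a3
      rw [h8 a (by simp; omega), h4 a (by simp; omega)]
    have h13 : s₆ 13 0 = 0 := by rw [hall 13 (by omega) (by omega) (by omega), h6]
    have hW6 : Work I s₆ := by
      refine ⟨h5.toReady.congr (fun a ha => hall a (by omega) (by omega) (by omega))
        (hall 9 (by omega) (by omega) (by omega)), ?_, ?_⟩
      · intro i hi
        omega
      · omega
    have ep6 : pot n m (240 * (n + 1)) s₆ ≤ G := hpotle s₆ h13 em6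
    -- open the hospital
    refine Runs.seq ((runs_open (A := 240 * (n + 1)) (r := r)
      (e := F * movesOf n m s + (G + F) * d + F + 80 * (n + 1) - 30) hW hW6
      (by rw [et6, eb6]; exact H.table) hm
      (by rw [hall 27 (by omega) (by omega) (by omega), k27]) (by omega)).frame.mono ?_)
    clear h1
    rintro c₇ s₇ ⟨⟨h1, hI7⟩, h9⟩
    rw [et6, eb6] at hI7
    rw [show openProg.writes = [19, 25, 12, 13, 11] from rfl] at h9
    have hn := r.2
    refine Runs.seq ((runs_settle (e := F * movesOf n m s + (G + F) * d + F + 10)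
      hW hI7 (by rw [h9 7 (by simp), hall 7 (by omega) (by omega) (by omega), k7])
      (by omega)).mono ?_)
    clear h1
    rintro c₈ s₈ ⟨⟨h1, g1, g2, g3, g4, g5, g6⟩, g7⟩
    rw [hsw] at g7
    have q7 : s₈ 7 0 = 0 := by
      rw [g7 7 (by simp), h9 7 (by simp), hall 7 (by omega) (by omega) (by omega), k7]
    refine Runs.assign (by rw [eval_var]; omega) (by simp only [cost_var]; omega) ?_
    rw [eval_var, cost_var]
    have p0 : ∀ a, a ≠ 28 → (s₈.set 28 0 (s₈ 26 0)) a = s₈ a := fun a ha =>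
      Memory.set_ne _ _ _ ha
    have p28 : (s₈.set 28 0 (s₈ 26 0)) 28 0 = s₈ 26 0 := by simp [Memory.set_apply]
    refine ⟨by omega, fun h' => ?_, fun h' => ?_⟩
    · rw [p28] at h'
      have hS := g5 h'
      have et9 : tOf n (s₈.set 28 0 (s₈ 26 0)) = tOf n s₈ := tOf_congr (p0 10 (by omega))
      have eb9 : bOf n (s₈.set 28 0 (s₈ 26 0)) = bOf n s₈ := bOf_congr (p0 11 (by omega))
      have hmin : min (bOf n s r) (tOf n s r) ≤ bOf n s r := min_le_left _ _
      have hb8 : ∀ x, bOf n s₈ x ≤ bOf n s x := fun x =>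
        (g4.b_le x).trans (Instance.update_le hmin x)
      refine ⟨⟨hS.toWork.congr (fun a ha _ _ => p0 a (by omega)), ?_, ?_, ?_⟩, ?_⟩
      · rw [et9, eb9]
        exact hS.table
      · rw [p0 13 (by omega), g2]
      · rw [p0 7 (by omega), q7]
      · have v1 : movesOf n m s₈ ≤ movesOf n m s := Instance.moves_mono g4.t_le hb8
        -- The upper bound of r has come down to its lower bound, so r no longer counts.
        have v2 : gap n s₈ < gap n s := by
          refine gap_lt (r := r) g4.t_le hb8 hgap ?_
          have w1 := g4.b_le r
          have w2 := g4.t_le r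
          rw [Function.update_self] at w1
          omega
        have v3 := Nat.mul_le_mul_left F v1
        have v4 : (G + F) * gap n s₈ ≤ (G + F) * d := Nat.mul_le_mul_left _ (by omega)
        rw [hbud, pot_congr (p0 10 (by omega)) (p0 11 (by omega)) (p0 13 (by omega))]
        unfold movesOf gap at *
        rw [et9, eb9]
        omega
    · rw [p28] at h'
      exact Or.inr ⟨by rw [p0 7 (by omega), q7],
        H.table.not_exists hl hh h2 hno (g6 h')⟩

theorem runs_round (hW : cap n m ≤ W) (hl : ∀ h, I.lower h ≤ 2) (H : Settled I s)
    (h28 : s 28 0 ≠ 0) (hc : budget n m s ≤ c + 3) :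
    Runs W roundProg s c (BetweenRounds I) := by
  have hF1 : 150 * (n + 1) * (n + 1) + 450 * (n + 1) ≤ 600 * (n + 1) * (n + 1) := by nlinarith
  have hbud : 600 * (n + 1) * (n + 1) ≤ budget n m s := Nat.le_add_left _ _
  refine Runs.seq ((runs_find (e := c - 150 * (n + 1) * (n + 1)) hW H.toReady H.table.one_le
    (by omega)).mono ?_)
  rintro c₁ s₁ ⟨⟨h1, h2⟩, h3⟩
  rw [show findProg.writes = [27, 16, 18, 21, 22, 17, 19, 20, 21, 22, 17, 27, 16] from rfl] at h3
  have hall : ∀ a ≤ 13, s₁ a = s a := by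
    intro a ha
    refine h3 a ?_
    simp
    omega
  have et : tOf n s₁ = tOf n s := tOf_congr (hall 10 (by omega))
  have eb : bOf n s₁ = bOf n s := bOf_congr (hall 11 (by omega))
  have hS : Settled I s₁ := by
    refine ⟨H.toWork.congr (fun a ha _ _ => hall a ha), ?_, ?_, ?_⟩
    · rw [et, eb]
      exact H.table
    · rw [hall 13 (by omega), H.empty]
    · rw [hall 7 (by omega), H.flag]
  have hbud1 : budget n m s₁ = budget n m s := by
    unfold budget
    rw [pot_congr (hall 10 (by omega)) (hall 11 (by omega)) (hall 13 (by omega))]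
    unfold movesOf gap
    rw [et, eb]
  refine Runs.ite (by simp only [cost_var]; omega) (fun hb => ?_) (fun hb => ?_)
  · rw [eval_var] at hb
    obtain ⟨h4, -⟩ | ⟨r, h, h4, h5⟩ := h2
    · exact absurd h4 hb
    · refine runs_attempt hW hl hS h5 (by rw [et]; exact h4) (by rwa [h3 28 (by simp)]) ?_
      rw [hbud1, cost_var]
      omega
  · rw [eval_var] at hb
    obtain ⟨-, h4⟩ | ⟨r, h, -, h5⟩ := h2
    · refine Runs.seq ((runs_output (e := 10) hW hS.toReady hS.table.one_le
        (by rw [cost_var]; omega)).mono ?_)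
      rintro c₂ s₂ ⟨⟨g1, g2, g3⟩, -⟩
      refine Runs.assign (by simp [Expr.eval]) (by simp only [Expr.cost]; omega) ?_
      simp only [Expr.eval, Expr.cost]
      refine ⟨by omega, fun h' => absurd (by simp [Memory.set_apply]) h', fun _ => Or.inl ⟨?_, ?_⟩⟩
      · rw [Memory.set_ne _ _ _ (by omega), g2]
      · refine ⟨I.ofPos (tOf n s₁), Instance.ofPos_stable ?_, fun r => ?_⟩
        · rw [et]
          exact H.table.stablePos hl h4
        · rw [Memory.set_ne _ _ _ (by omega), g3]
    · omega

/-- Blocking coalitions are nonempty because lower quotas are positive, so blocking requires a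
resident and a hospital. -/
theorem Instance.isStable_empty (h0 : n * m = 0) (I : Instance n m) :
    I.IsStable fun _ => none := by
  have hat : ∀ h, Assignment.at (fun _ : Fin n => (none : Option (Fin m))) h = ∅ := by
    simp [Assignment.at]
  refine ⟨fun r h e => by simp at e, fun h => Or.inl (by rw [hat]; rfl), fun r h hb => ?_,
    fun h S hb => ?_⟩
  · exact hb.1 (by rw [hat]; rfl)
  · have h1 := I.one_le_lower h
    rw [← hb.2.1] at h1
    obtain ⟨r, -⟩ := Finset.card_pos.1 h1
    have := Nat.mul_pos r.pos h.pos
    omega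

theorem runs_stable (hW : cap n m ≤ W) (hl : ∀ h, I.lower h ≤ 2) :
    Runs W stableProg I.encode (300000 * (n ^ 3 * m + 1)) fun _ s => I.CorrectOutput s := by
  have hc1 := le_cap_m (n := n) (m := m)
  have hc2 := le_cap_n (n := n) (m := m)
  have e0 : (mul (get 0 (const 0)) (get 0 (const 1))).eval I.encode = n * m := rfl
  refine Runs.ite (by simp only [Expr.cost]; omega) (fun hb => ?_) (fun hb => ?_)
  · rw [e0] at hb
    have hn : 1 ≤ n := Nat.pos_of_ne_zero fun h => hb (by rw [h, Nat.zero_mul])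
    have hm : 1 ≤ m := Nat.pos_of_ne_zero fun h => hb (by rw [h, Nat.mul_zero])
    -- For n, m ≥ 1 there hold n + 1 ≤ 2n and m + 2 ≤ 3m, and 4 · 8 · 3 = 96. All costs are bounded
    -- by multiples of P: 100P for initialization and 3000P for the rest, in total 3100 · 96 <
    -- 300000 times n³m.
    have hP : (n + 1) * (n + 1) * cap n m ≤ 96 * (n ^ 3 * m) := by
      calc (n + 1) * (n + 1) * cap n m = 4 * ((n + 1) * (n + 1) * (n + 1) * (m + 2)) := by
            unfold cap
            ring
        _ ≤ 4 * ((2 * n) * (2 * n) * (2 * n) * (3 * m)) := by gcongr <;> omega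
        _ = 96 * (n ^ 3 * m) := by ring
    have hcapn : (n + 1) * (m + 1) ≤ cap n m := by unfold cap; nlinarith
    obtain ⟨P, hPe⟩ : ∃ P, P = (n + 1) * (n + 1) * cap n m := ⟨_, rfl⟩
    have hN1 : 1 ≤ (n + 1) * (n + 1) := Nat.mul_pos (Nat.succ_pos n) (Nat.succ_pos n)
    have hP1 : cap n m ≤ P := by rw [hPe]; exact Nat.le_mul_of_pos_left _ hN1
    have hP2 : (n + 1) * cap n m ≤ P := by
      rw [hPe, Nat.mul_assoc]
      exact Nat.le_mul_of_pos_left _ (Nat.succ_pos n)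
    have hP3 : (n + 1) * (n + 1) * (n + 1) ≤ P := by
      rw [hPe]
      exact Nat.mul_le_mul_left _ hc2
    have hP4 : (n + 1) * (n + 1) ≤ P := by
      rw [hPe]
      exact Nat.le_mul_of_pos_right _ (by omega)
    have hpot : ∀ s : Memory, s 13 0 + movesOf n m s ≤ cap n m →
        pot n m (240 * (n + 1)) s ≤ 340 * P := by
      intro s hs
      calc pot n m (240 * (n + 1)) s ≤ (240 * (n + 1) + 100) * (s 13 0 + movesOf n m s) := by
            unfold pot
            nlinarith
        _ ≤ (240 * (n + 1) + 100) * cap n m := Nat.mul_le_mul_left _ hs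
        _ = 240 * ((n + 1) * cap n m) + 100 * cap n m := by ring
        _ ≤ 340 * P := by omega
    have hbudget : ∀ s : Memory, s 13 0 + movesOf n m s ≤ cap n m → budget n m s ≤ 2480 * P := by
      intro s hs
      have b1 := hpot s hs
      have b2 : 600 * (n + 1) * (n + 1) * movesOf n m s ≤ 600 * P := by
        rw [hPe, ← Nat.mul_assoc, ← Nat.mul_assoc]
        exact Nat.mul_le_mul_left _ (by omega)
      have b3 : ((240 * (n + 1) + 100) * cap n m + 600 * (n + 1) * (n + 1)) * gap n s ≤
          940 * P := by
        calc _ ≤ ((240 * (n + 1) + 100) * cap n m + 600 * (n + 1) * (n + 1)) * (n + 1) :=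
              Nat.mul_le_mul_left _ ((gap_le s).trans (Nat.le_succ n))
          _ = 240 * ((n + 1) * (n + 1) * cap n m) + 100 * ((n + 1) * cap n m) +
              600 * ((n + 1) * (n + 1) * (n + 1)) := by ring
          _ ≤ 940 * P := by omega
      have b4 : 600 * (n + 1) * (n + 1) ≤ 600 * P := by
        rw [Nat.mul_assoc]
        exact Nat.mul_le_mul_left _ hP4
      exact (Nat.add_le_add (Nat.add_le_add (Nat.add_le_add b1 b2) b3) b4).trans
        (le_of_eq (by ring))
    have hinit : 100 * (n + 1) * (m + 1) ≤ 100 * P := by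
      rw [Nat.mul_assoc]
      exact Nat.mul_le_mul_left _ (hcapn.trans hP1)
    have hlin : 40 * (n + 1) ≤ 40 * P := Nat.mul_le_mul_left _ (hc2.trans hP1)
    refine Runs.seq ((runs_init (e := 3000 * P) hW
      (by simp only [Expr.cost]; omega)).mono ?_)
    rintro c₁ s₁ ⟨⟨h1, h2, h3, h4, h5⟩, h6⟩
    rw [show initProg.writes = [16, 17, 9, 17, 10, 11, 16, 16, 12, 16, 13] from rfl] at h6
    have hpot1 := hpot s₁ h2.bound
    refine Runs.seq ((runs_settle (e := 2580 * P) hW h2 (by rw [h6 7 (by simp)]; rfl)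
      (by omega)).mono ?_)
    rintro c₂ s₂ ⟨⟨g1, g2, g3, g4, -, g6, g7⟩, g8⟩
    have q7 : s₂ 7 0 = 0 := by
      rw [g8 7 (by
        simp [settleProg, improveProg, scanProg, countProg, checkProg, loadProg, raiseProg,
          lowerProg, push, assign, forLess, Prog.writes]), h6 7 (by simp)]
      rfl
    refine Runs.seq (Runs.assign (by rw [eval_var]; omega) (by simp only [cost_var]; omega) ?_)
    rw [eval_var, cost_var]
    have p0 : ∀ a, a ≠ 28 → (s₂.set 28 0 (s₂ 26 0)) a = s₂ a := fun a ha =>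
      Memory.set_ne _ _ _ ha
    have p28 : (s₂.set 28 0 (s₂ 26 0)) 28 0 = s₂ 26 0 := by simp [Memory.set_apply]
    refine Runs.loop (BetweenRounds I) ?_ ⟨by omega, fun h' => ?_, fun h' => ?_⟩
    · rintro c s ⟨k1, k2, k3⟩
      rw [cost_var, eval_var]
      refine ⟨k1, fun h' => ?_, fun h' => ⟨c - 3, by omega, k3 h'⟩⟩
      exact runs_round hW hl (k2 h').1 h' (by have := (k2 h').2; omega)
    · rw [p28] at h'
      have hS := g6 h'
      have et : tOf n (s₂.set 28 0 (s₂ 26 0)) = tOf n s₂ := tOf_congr (p0 10 (by omega))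
      have eb : bOf n (s₂.set 28 0 (s₂ 26 0)) = bOf n s₂ := bOf_congr (p0 11 (by omega))
      have hw : Work I (s₂.set 28 0 (s₂ 26 0)) := hS.toWork.congr (fun a ha _ _ => p0 a (by omega))
      refine ⟨⟨hw, ?_, ?_, ?_⟩, ?_⟩
      · rw [et, eb]
        exact hS.table
      · rw [p0 13 (by omega), g3]
      · rw [p0 7 (by omega), q7]
      · have := hbudget _ hw.bound
        omega
    · rw [p28] at h'
      refine Or.inr ⟨by rw [p0 7 (by omega), q7], ?_⟩
      rw [Instance.exists_stable_iff]
      rintro ⟨q, hq⟩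
      -- The initial bounds are trivial, so they contain every stable position vector.
      exact g7 h' q hq hq.one_le hq.le
  · rw [e0] at hb
    refine Runs.assign (by simp only [Expr.eval]; omega) (by simp only [Expr.cost]; omega) ?_
    refine Or.inl ⟨by simp [Memory.set_apply, Expr.eval], fun _ => none, I.isStable_empty hb,
      fun r => ?_⟩
    rw [Memory.set_ne _ _ _ (by omega)]
    rfl

theorem cap_le_pow (n m : ℕ) : cap n m ≤ (n + m + 2) ^ 4 := by
  calc cap n m = (2 * 2) * (n + 1) * (m + 2) := by unfold cap; ring
    _ ≤ ((n + m + 2) * (n + m + 2)) * (n + m + 2) * (n + m + 2) := by gcongr <;> omega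
    _ = (n + m + 2) ^ 4 := by ring

theorem solvableInTime (P : ∀ n m : ℕ, Instance n m → Prop)
    (hP : ∀ n m I, P n m I → LowerQuotaAtMostTwo n m I) :
    SolvableInTime P (fun n m => n ^ 3 * m + 1) := by
  refine ⟨stableProg, 300000, 4, fun n m I hI => ?_⟩
  obtain ⟨t, s, c, h1, h2, h3⟩ := runs_stable (cap_le_pow n m) (hP n m I hI)
  exact ⟨t, s, h1, (Nat.le_add_right t c).trans h2, h3⟩

end

end HRQ

theorem theoremt :
    HRQ.SolvableInTime (fun n m I => HRQ.LowerQuotaAtMostTwo n m I)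
        (fun n m => n ^ 3 * m + 1) ∧
      HRQ.SolvableInTime
        (fun n m I => HRQ.OnlyLowerQuotas n m I ∧ HRQ.LowerQuotaAtMostTwo n m I)
        (fun n m => n ^ 3 * m + 1) :=
  ⟨HRQ.solvableInTime _ fun _ _ _ h => h, HRQ.solvableInTime _ fun _ _ _ h => h.2⟩
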